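/- Let $N\ge 1$, $\alpha=(\alpha_1,\dots,\alpha_N)\in\mathbb R^N$, and let $Y=\{y_1,\dots,y_N\}\subset\mathbb R^2$ consist of $N$ distinct points. For $\operatorname{Im}z>0$ let $\mathcal G_z(x)=\frac i4H_0^{(1)}(z|x|)$ be the convolution kernel of $(-\Delta-z^2)^{-1}$ on $\mathbb R^2$, where $$\tfrac i4H_0^{(1)}(\zeta)=\frac{e^{i\zeta}}{2^{3/2}\pi}\int_0^\infty e^{-t}t^{-1/2}\left(\tfrac t2-i\zeta\right)^{-1/2}dt\qquad(\operatorname{Im}\zeta>0),$$ let $g(z)=-\frac1{2\pi}\log\frac z2+\frac i4-\frac{\gamma}{2\pi}$ ($\gamma$ is Euler's constant), and let $\Gamma(z)$ be the $N\times N$ matrix with diagonal entries $\alpha_j-g(z)$ and off-diagonal entries $-\mathcal G_z(y_j-y_k)$. For $z$ with $\operatorname{Im}z>0$ and $\det\Gamma(z)\neq0$, the resolvent at $z^2$ of the Schrödinger operator $H_{\alpha,Y}$ with point interactions of strength $\alpha$ at $Y$ is $$R(z^2)f(x)=\int_{\mathbb R^2}\mathcal G_z(x-y)f(y)\,dy+\sum_{j,k=1}^N[\Gamma(z)^{-1}]_{jk}\,\mathcal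 G_z(x-y_j)\int_{\mathbb R^2}\mathcal G_z(y-y_k)f(y)\,dy,\qquad f\in L^2(\mathbb R^2).$$ Let $1<\sigma<2$, and let $L^2_{-\sigma}$ be the space of functions $u$ with $\|u\|_{L^2_{-\sigma}}=\|(1+|x|^2)^{-\sigma/2}u\|_{L^2(\mathbb R^2)}<\infty$. Let $R_{-\sigma}(z^2)$ be the extension by continuity of $R(z^2)$ from $L^2$ to $L^2_{-\sigma}$, and let $H^{-\sigma}_{\alpha,Y}$ be the operator in $L^2_{-\sigma}$ whose resolvent at $z^2$ is $R_{-\sigma}(z^2)$; that is, $u$ is in its domain and $H^{-\sigma}_{\alpha,Y}u=f$ if and only if $u,f\in L^2_{-\sigma}$ and $u=R_{-\sigma}(z^2)(f-z^2u)$. Let $C_b(\mathbb R^2\setminus Y)$ be the set of continuous functions $\mathbb R^2\setminus Y\to\mathbb C$ which are bounded outside a bounded open set containing $Y$, and let $$\mathcal R_{\alpha,Y}=\operatorname{Ker}H^{-\sigma}_{\alpha,Y}\cap C_b(\mathbb R^2\setminus Y)$$ be the space of threshold resonances. Let $\tilde D$ be the $N\times N$ matrix with diagonal entries $\alpha_j$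 and off-diagonal entries $\frac1{2\pi}\log|y_j-y_k|$, let $\mathbf 1=(1,\dots,1)\in\mathbb C^N$, let $P$ be the orthogonal projection of $\mathbb C^N$ onto $\mathbb C\mathbf 1$ and $S=1-P$. Write $\langle a,b\rangle=\sum_j a_jb_j$ (without complex conjugation) and $\hat x=x/|x|$. Then, for every $1<\sigma<2$ and every $z$ with $\operatorname{Im}z>0$ and $\det\Gamma(z)\ne0$: 1. The space of threshold resonances is $$\mathcal R_{\alpha,Y}=\Big\{\varphi(x)=\frac{\langle\tilde Da,\mathbf 1\rangle}{N}-\frac1{2\pi}\sum_{j=1}^Na_j\log|x-y_j|\;:\;a\in\operatorname{Ker}S\tilde DS\cap S\mathbb C^N\Big\}.$$ 2. For every $a\in\operatorname{Ker}S\tilde DS\cap S\mathbb C^N$ the corresponding function $\varphi$ satisfies $$\varphi(x)=\frac{\langle\tilde Da,\mathbf 1\rangle}{N}+\frac1{2\pi}\sum_{j=1}^N\frac{\langle\hat x,a_jy_j\rangle}{|x|}+O(|x|^{-2})\qquad(|x|\to\infty).$$ 3. $\mathcal R_{\alpha,Y}=\{0\}$ if and only if $S\tilde DS$ is non-singular as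 a linear map of $S\mathbb C^N$ to itself. -/

import Mathlib

namespace PointInteraction

open MeasureTheory Filter Topology Matrix

/-- The Euclidean plane. -/
abbrev Plane : Type := EuclideanSpace ℝ (Fin 2)

/-- `(i/4) H_0^{(1)}(ζ)` for `Im ζ > 0`, where `H_0^{(1)}` is the Hankel function of the first kind:
`e^{iζ} / (2^{3/2} π) * ∫_0^∞ e^{-t} t^{-1/2} (t/2 - iζ)^{-1/2} dt` (principal branch). -/
noncomputable def hankel (ζ : ℂ) : ℂ :=
  Complex.exp (Complex.I * ζ) / (((2 : ℝ) ^ (3 / 2 : ℝ) * Real.pi : ℝ) : ℂ) *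
    ∫ t in Set.Ioi (0 : ℝ),
      ((Real.exp (-t) * t ^ (-(1 / 2) : ℝ) : ℝ) : ℂ) *
        ((t : ℂ) / 2 - Complex.I * ζ) ^ (-(1 / 2) : ℂ)

/-- The convolution kernel of `(-Δ - z²)⁻¹` on the plane, for `Im z > 0` (and `x ≠ 0`). -/
noncomputable def green (z : ℂ) (x : Plane) : ℂ := hankel (z * (‖x‖ : ℂ))

/-- `g(z) = -(1/2π) log (z/2) + i/4 - γ/(2π)`, with `γ` Euler's constant. -/
noncomputable def gCoeff (z : ℂ) : ℂ :=
  -(1 / (2 * Real.pi)) * Complex.log (z / 2) + Complex.I / 4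
    - (Real.eulerMascheroniConstant : ℂ) / (2 * Real.pi)

/-- The matrix `Γ_{α,Y}(z)`. -/
noncomputable def gammaMatrix {N : ℕ} (α : Fin N → ℝ) (Y : Fin N → Plane) (z : ℂ) :
    Matrix (Fin N) (Fin N) ℂ :=
  Matrix.of fun j k => if j = k then (α j : ℂ) - gCoeff z else -green z (Y j - Y k)

/-- The function `R(z²) f`, where `R(z²) = (H_{α,Y} - z²)⁻¹` is the resolvent of the point
interaction Hamiltonian and `f ∈ L²`. -/
noncomputable def resolventFun {N : ℕ} (α : Fin N → ℝ) (Y : Fin N → Plane) (z : ℂ)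
    (f : Plane → ℂ) (x : Plane) : ℂ :=
  (∫ y, green z (x - y) * f y) +
    ∑ j, ∑ k, (gammaMatrix α Y z)⁻¹ j k * green z (x - Y j) * ∫ y, green z (y - Y k) * f y

/-- The function `⟨x⟩^s u(x)`, with `⟨x⟩ = (1 + |x|²)^{1/2}`. -/
noncomputable def weighted (s : ℝ) (u : Plane → ℂ) (x : Plane) : ℂ :=
  (((1 + ‖x‖ ^ 2) ^ (s / 2) : ℝ) : ℂ) * u x

/-- Membership in the weighted space `L²_s`, whose norm is `‖⟨x⟩^s u‖_{L²}`. -/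
def MemWeighted (s : ℝ) (u : Plane → ℂ) : Prop := MemLp (weighted s u) 2 volume

/-- Convergence in the norm of `L²_s`. -/
def TendstoWeighted (s : ℝ) (u : ℕ → Plane → ℂ) (v : Plane → ℂ) : Prop :=
  Tendsto (fun n => eLpNorm (weighted s (u n - v)) 2 volume) atTop (𝓝 0)

/-- `u = R_{-σ}(z²) w` (almost everywhere), where `R_{-σ}(z²)` is the extension by continuity of
`R(z²)` from the dense subspace `L²` to `L²_{-σ}`. -/
def ExtendedResolvent {N : ℕ} (α : Fin N → ℝ) (Y : Fin N → Plane) (σ : ℝ) (z : ℂ)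
    (w u : Plane → ℂ) : Prop :=
  MemWeighted (-σ) w ∧ MemWeighted (-σ) u ∧
    ∃ wn : ℕ → Plane → ℂ, (∀ n, MemLp (wn n) 2 volume) ∧
      TendstoWeighted (-σ) wn w ∧
      TendstoWeighted (-σ) (fun n => resolventFun α Y z (wn n)) u

/-- The graph of the operator `H_{α,Y}^{-σ}` in `L²_{-σ}`, i.e. of the operator whose resolvent at
`z²` is `R_{-σ}(z²)`: `u` is in its domain and `H_{α,Y}^{-σ} u = f` if and only if
`u = R_{-σ}(z²) (f - z² u)`. -/
def HamiltonianGraph {N : ℕ} (α : Fin N → ℝ) (Y : Fin N → Plane) (σ : ℝ) (z : ℂ)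
    (u f : Plane → ℂ) : Prop :=
  MemWeighted (-σ) u ∧ MemWeighted (-σ) f ∧
    ExtendedResolvent α Y σ z (fun x => f x - z ^ 2 * u x) u

/-- The plane without the points of interaction. -/
abbrev Punctured {N : ℕ} (Y : Fin N → Plane) : Type := {x : Plane // x ∉ Set.range Y}

/-- The class `C_b(ℝ² ∖ Y)` of continuous functions on `ℝ² ∖ Y` which are bounded outside a bounded
open set containing `Y`. -/
def IsCb {N : ℕ} (Y : Fin N → Plane) (φ : Punctured Y → ℂ) : Prop :=
  Continuous φ ∧ ∃ U : Set Plane, IsOpen U ∧ Bornology.IsBounded U ∧ Set.range Y ⊆ U ∧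
    ∃ C : ℝ, ∀ x : Punctured Y, (x : Plane) ∉ U → ‖φ x‖ ≤ C

/-- The space of threshold resonances: the functions in `C_b(ℝ² ∖ Y)` whose almost everywhere class
is in the null space of `H_{α,Y}^{-σ}`. -/
def resonances {N : ℕ} (α : Fin N → ℝ) (Y : Fin N → Plane) (σ : ℝ) (z : ℂ) :
    Set (Punctured Y → ℂ) :=
  {φ | IsCb Y φ ∧ ∃ u : Plane → ℂ, HamiltonianGraph α Y σ z u 0 ∧ ∀ x : Punctured Y, u x = φ x}

/-- The matrix `D̃`. -/
noncomputable def dMatrix {N : ℕ} (α : Fin N → ℝ) (Y : Fin N → Plane) :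
    Matrix (Fin N) (Fin N) ℂ :=
  Matrix.of fun j k =>
    if j = k then (α j : ℂ) else ((1 / (2 * Real.pi) * Real.log ‖Y j - Y k‖ : ℝ) : ℂ)

/-- The projection `S = 1 - P`, with `P` the orthogonal projection onto the span of `(1, …, 1)`. -/
noncomputable def sMatrix (N : ℕ) : Matrix (Fin N) (Fin N) ℂ :=
  1 - Matrix.of fun _ _ => 1 / (N : ℂ)

/-- The subspace `S ℂ^N`. -/
noncomputable def sSpace (N : ℕ) : Submodule ℂ (Fin N → ℂ) :=
  LinearMap.range (sMatrix N).mulVecLin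

/-- The matrix `S D̃ S`. -/
noncomputable def sdsMatrix {N : ℕ} (α : Fin N → ℝ) (Y : Fin N → Plane) :
    Matrix (Fin N) (Fin N) ℂ :=
  sMatrix N * dMatrix α Y * sMatrix N

/-- The space `Ker S D̃ S ∩ S ℂ^N`. -/
noncomputable def coeffSpace {N : ℕ} (α : Fin N → ℝ) (Y : Fin N → Plane) :
    Submodule ℂ (Fin N → ℂ) :=
  LinearMap.ker (sdsMatrix α Y).mulVecLin ⊓ sSpace N

/-- The constant `⟨D̃ a, 1⟩ / N`, the pairing being bilinear. -/
noncomputable def constTerm {N : ℕ} (α : Fin N → ℝ) (Y : Fin N → Plane) (a : Fin N → ℂ) : ℂ :=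
  ((dMatrix α Y).mulVec a ⬝ᵥ 1) / (N : ℂ)

/-- The function `⟨D̃ a, 1⟩ / N - (1/2π) ∑ a_j log |x - y_j|`. -/
noncomputable def logFun {N : ℕ} (α : Fin N → ℝ) (Y : Fin N → Plane) (a : Fin N → ℂ)
    (x : Plane) : ℂ :=
  constTerm α Y a - 1 / (2 * Real.pi) * ∑ j, a j * (Real.log ‖x - Y j‖ : ℂ)

/-- `S D̃ S` is non-singular as a linear map of `S ℂ^N` to itself. -/
def NonsingularOnS {N : ℕ} (α : Fin N → ℝ) (Y : Fin N → Plane) : Prop :=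
  Set.BijOn (fun a => (sdsMatrix α Y).mulVec a) (sSpace N : Set (Fin N → ℂ)) (sSpace N)

end PointInteraction

/-!
Write `E(x) = -(1/2π) log |x|` for the fundamental solution of `-Δ` and `𝒢` for the Green function
`green z`. The theorem says that `H u = 0` forces `u = c + ∑ a_j E(x - y_j)`, where boundedness at
infinity gives `∑ a_j = 0` and the boundary conditions at the points `y_j` give `D̃ a = c 𝟏`; these
two conditions describe `Ker S D̃ S ∩ S ℂ^N`, with `c = ⟨D̃ a, 𝟏⟩ / N` (`mem_coeffSpace_iff`).

Everything rests on the two values `-z² ∫ 𝒢 = 1` and `-z² 𝒢 * E = E - 𝒢`, with `-z² (𝒢 * E)(0) =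
-g(z)` (`integral_green`, `integral_green_mul_logKernel`, `integral_green_mul_logKernel_zero`). They
come from the profile of `𝒢`, the Macdonald function `K₀(-i z r) / 2π`: it is a Laplace transform,
from which its differential equation, its behaviour at `0` and its decay can be read off, and
Newton's theorem (`integral_radial_mul_log`) reduces the convolution with `log` to a one-dimensional
moment that Green's formula evaluates. Consequently `φ = c + ∑ a_j E(x - y_j)` satisfies `-z² 𝒢 * φ
= φ - ∑ a_j 𝒢(x - y_j)`, with the values `c - D̃ a + Γ(z) a` at the points `y_j`.

If `D̃ a = c 𝟏` and `∑ a_j = 0`, this says that the resolvent formula maps `-z² φ` to `φ`, and since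
`φ` is bounded at infinity, truncation to large balls shows that the formula gives the extended
resolvent at `-z² φ` (`extendedResolvent_resolventFun`).

Conversely, convolution with `𝒢` at a point is continuous on `L²_{-σ}`, so that limits of resolvents
are still given by the resolvent formula (`ExtendedResolvent.ae_eq`). Hence for a resonance `u` and
suitable `a` the function `v = u - ∑ a_j E(x - y_j)` satisfies `v = -z² 𝒢 * v` and grows at most
like `|x|^{1/2}`. Such a `v` is harmonic: with `h = E - M * E`, which is supported in the disc on
which `M` averages, the relation between `E` and `𝒢` gives the mean value property `v = M * v`
(`ae_eq_conv_discKernel`), and letting the radius grow shows that `v` is constant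
(`exists_ae_eq_const`).

The expansion at infinity is that of `log |x - y|` with `∑ a_j = 0`, and the coefficients `a` can be
recovered from the singularities of the resonance, so that there are none besides `0` if and only if
`Ker S D̃ S ∩ S ℂ^N` is trivial.
-/

namespace PointInteraction

open MeasureTheory Filter Topology Set

/-! ### Damped Laplace transforms -/

theorem ofReal_mul_cpow {r : ℝ} (hr : 0 < r) {w : ℂ} (hw : w ≠ 0) (a : ℂ) :
    ((r : ℂ) * w) ^ a = (r : ℂ) ^ a * w ^ a := by
  have hr' : (r : ℂ) ≠ 0 := by exact_mod_cast hr.ne'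
  rw [Complex.cpow_def_of_ne_zero (mul_ne_zero hr' hw), Complex.cpow_def_of_ne_zero hr',
    Complex.cpow_def_of_ne_zero hw, Complex.log_ofReal_mul hr hw, ← Complex.exp_add,
    Complex.ofReal_log hr.le]
  congr 1; ring

/-- The fundamental theorem of calculus on a half-line for a function which merely has a limit at
the finite endpoint. -/
theorem integral_Ioi_of_hasDerivAt_of_tendsto_nhdsGT {f f' : ℝ → ℂ} {a : ℝ} {l m : ℂ}
    (hl : Tendsto f (𝓝[>] a) (𝓝 l)) (hderiv : ∀ x ∈ Ioi a, HasDerivAt f (f' x) x)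
    (hint : IntegrableOn f' (Ioi a)) (hm : Tendsto f atTop (𝓝 m)) :
    ∫ x in Ioi a, f' x = m - l := by
  have h1 : ∀ x ∈ Ioi a, f =ᶠ[𝓝 x] Function.update f a l := by
    intro x hx
    filter_upwards [Ioi_mem_nhds hx] with y hy
    rw [Function.update_of_ne (ne_of_gt hy)]
  have := integral_Ioi_of_hasDerivAt_of_tendsto (f := Function.update f a l) (f' := f') (a := a)
    (m := m) ?_ ?_ hint ?_
  · simpa using this
  · rw [continuousWithinAt_update_same]
    simpa using hl
  · intro x hx
    exact (hderiv x hx).congr_of_eventuallyEq (h1 x hx).symm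
  · refine hm.congr' ?_
    filter_upwards [Ioi_mem_atTop a] with y hy
    rw [Function.update_of_ne (ne_of_gt hy)]

theorem integral_Ioi_of_hasDerivAt_of_integrableOn {f f' : ℝ → ℂ} {a : ℝ} {l : ℂ}
    (hl : Tendsto f (𝓝[>] a) (𝓝 l)) (hderiv : ∀ x ∈ Ioi a, HasDerivAt f (f' x) x)
    (hint : IntegrableOn f' (Ioi a)) (hf : IntegrableOn f (Ioi a)) :
    ∫ x in Ioi a, f' x = -l := by
  rw [integral_Ioi_of_hasDerivAt_of_tendsto_nhdsGT hl hderiv hint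
    (tendsto_zero_of_hasDerivAt_of_integrableOn_Ioi hderiv hint hf), zero_sub]

/-- Integrability on the half-line against `e^{-ετ}` for every `ε > 0`. -/
def ExpIntegrable (m : ℝ → ℂ) : Prop :=
  ∀ ε : ℝ, 0 < ε → IntegrableOn (fun τ => (Real.exp (-(ε * τ)) : ℂ) * m τ) (Ioi 0)

/-- The Laplace transform of `m`, damped by `e^{-lam r}`. -/
noncomputable def dampedLaplace (lam : ℂ) (m : ℝ → ℂ) (r : ℝ) : ℂ :=
  ∫ τ in Ioi (0 : ℝ), Complex.exp (-(r * (τ + lam))) * m τ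

theorem ExpIntegrable.aestronglyMeasurable {m : ℝ → ℂ} (hm : ExpIntegrable m) :
    AEStronglyMeasurable m (volume.restrict (Ioi 0)) := by
  have h := (hm 1 one_pos).aestronglyMeasurable
  have h2 : AEStronglyMeasurable (fun τ : ℝ => (Real.exp (1 * τ) : ℂ))
    (volume.restrict (Ioi 0)) := by
    apply Continuous.aestronglyMeasurable; fun_prop
  refine (h2.mul h).congr (Eventually.of_forall fun τ => ?_)
  simp only [Pi.mul_apply, ← mul_assoc, ← Complex.ofReal_mul, ← Real.exp_add]
  simp

theorem expIntegrable_of_norm_le {m : ℝ → ℂ} {g : ℝ → ℝ}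
    (hm : AEStronglyMeasurable m (volume.restrict (Ioi 0))) (hg : ∀ τ, 0 < τ → ‖m τ‖ ≤ g τ)
    (hgi : ∀ ε : ℝ, 0 < ε → IntegrableOn (fun τ => Real.exp (-(ε * τ)) * g τ) (Ioi 0)) :
    ExpIntegrable m := by
  intro ε hε
  refine (hgi ε hε).mono' ?_ ?_
  · refine AEStronglyMeasurable.mul ?_ hm
    apply Continuous.aestronglyMeasurable; fun_prop
  · filter_upwards [ae_restrict_mem measurableSet_Ioi] with τ hτ
    rw [norm_mul, Complex.norm_real, Real.norm_of_nonneg (Real.exp_pos _).le]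
    exact mul_le_mul_of_nonneg_left (hg τ hτ) (Real.exp_pos _).le

theorem ExpIntegrable.add_mul {m : ℝ → ℂ} (hm : ExpIntegrable m) (lam : ℂ) :
    ExpIntegrable fun τ => (τ + lam) * m τ := by
  intro ε hε
  have h := (hm (ε / 2) (by positivity)).norm.const_mul (2 / ε + ‖lam‖)
  refine h.mono' ?_ ?_
  · have := hm.aestronglyMeasurable
    refine AEStronglyMeasurable.mul ?_ (AEStronglyMeasurable.mul ?_ this)
    all_goals apply Continuous.aestronglyMeasurable; fun_prop
  · filter_upwards [ae_restrict_mem measurableSet_Ioi] with τ (hτ : 0 < τ)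
    simp only [norm_mul, Complex.norm_real, Real.norm_of_nonneg (Real.exp_pos _).le]
    have h1 : ‖(τ : ℂ) + lam‖ ≤ τ + ‖lam‖ := by
      refine (norm_add_le _ _).trans ?_
      rw [Complex.norm_real, Real.norm_of_nonneg hτ.le]
    have h2 : Real.exp (-(ε * τ)) = Real.exp (-(ε / 2 * τ)) * Real.exp (-(ε / 2 * τ)) := by
      rw [← Real.exp_add]; ring_nf
    have h3 : Real.exp (-(ε / 2 * τ)) * (τ + ‖lam‖) ≤ 2 / ε + ‖lam‖ := by
      have h4 : Real.exp (-(ε / 2 * τ)) ≤ 1 := Real.exp_le_one_iff.2 (by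
        have : 0 < ε / 2 * τ := by positivity
        linarith)
      have h5 : Real.exp (-(ε / 2 * τ)) * τ ≤ 2 / ε := by
        have h6 : ε / 2 * τ ≤ Real.exp (ε / 2 * τ) := by
          linarith [Real.add_one_le_exp (ε / 2 * τ)]
        rw [Real.exp_neg, inv_mul_le_iff₀ (Real.exp_pos _)]
        calc τ = (ε / 2 * τ) * (2 / ε) := by field_simp
          _ ≤ _ := mul_le_mul_of_nonneg_right h6 (by positivity)
      nlinarith [norm_nonneg lam, Real.exp_pos (-(ε / 2 * τ))]
    rw [h2]
    calc Real.exp (-(ε / 2 * τ)) * Real.exp (-(ε / 2 * τ)) * (‖(τ : ℂ) + lam‖ * ‖m τ‖)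
        ≤ Real.exp (-(ε / 2 * τ)) * Real.exp (-(ε / 2 * τ)) * ((τ + ‖lam‖) * ‖m τ‖) := by
          gcongr
      _ = (Real.exp (-(ε / 2 * τ)) * (τ + ‖lam‖)) * (Real.exp (-(ε / 2 * τ)) * ‖m τ‖) := by ring
      _ ≤ _ := by gcongr

theorem norm_exp_damped (lam : ℂ) (r τ : ℝ) :
    ‖Complex.exp (-(r * (τ + lam)))‖ = Real.exp (-(r * τ)) * Real.exp (-(r * lam.re)) := by
  rw [Complex.norm_exp, ← Real.exp_add]
  congr 1
  simp; ring

theorem ExpIntegrable.integrableOn {m : ℝ → ℂ} (hm : ExpIntegrable m) (lam : ℂ) {r : ℝ}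
    (hr : 0 < r) :
    IntegrableOn (fun τ : ℝ => Complex.exp (-(r * (τ + lam))) * m τ) (Ioi 0) := by
  have h := (hm r hr).const_mul (Complex.exp (-(r * lam)))
  refine h.congr (Eventually.of_forall fun τ => ?_)
  simp only [← mul_assoc, Complex.ofReal_exp, ← Complex.exp_add]
  congr 2
  push_cast; ring

theorem hasDerivAt_dampedLaplace {lam : ℂ} (hlam : 0 < lam.re) {m : ℝ → ℂ}
    (hm : ExpIntegrable m) {r : ℝ} (hr : 0 < r) :
    HasDerivAt (dampedLaplace lam m) (-dampedLaplace lam (fun τ => (τ + lam) * m τ) r) r := by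
  have key := hasDerivAt_integral_of_dominated_loc_of_deriv_le
    (μ := volume.restrict (Ioi (0 : ℝ))) (𝕜 := ℝ) (x₀ := r) (s := Ioi (r / 2))
    (F := fun r τ => Complex.exp (-((r : ℝ) * (τ + lam))) * m τ)
    (F' := fun r τ => -(Complex.exp (-((r : ℝ) * (τ + lam))) * ((τ + lam) * m τ)))
    (bound := fun τ => ‖(Real.exp (-(r / 2 * τ)) : ℂ) * ((τ + lam) * m τ)‖)
    (Ioi_mem_nhds (by linarith)) ?_ (hm.integrableOn lam hr) ?_ ?_ ?_ ?_
  · have h := key.2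
    rw [integral_neg] at h
    exact h
  · refine Eventually.of_forall fun x => AEStronglyMeasurable.mul ?_ hm.aestronglyMeasurable
    apply Continuous.aestronglyMeasurable; fun_prop
  · exact ((hm.add_mul lam).integrableOn lam hr).neg.aestronglyMeasurable
  · filter_upwards [ae_restrict_mem measurableSet_Ioi] with τ (hτ : 0 < τ) x (hx : r / 2 < x)
    rw [norm_neg, norm_mul, norm_mul _ ((τ + lam) * m τ)]
    gcongr
    rw [norm_exp_damped, Complex.norm_real, Real.norm_of_nonneg (Real.exp_pos _).le]
    have h1 : Real.exp (-(x * lam.re)) ≤ 1 := Real.exp_le_one_iff.2 (by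
      have : 0 < x * lam.re := by
        apply mul_pos _ hlam; linarith
      linarith)
    have h2 : Real.exp (-(x * τ)) ≤ Real.exp (-(r / 2 * τ)) := by
      apply Real.exp_le_exp.2
      nlinarith
    calc _ ≤ Real.exp (-(r / 2 * τ)) * 1 := by gcongr
      _ = _ := mul_one _
  · exact (hm.add_mul lam (r / 2) (by positivity)).norm
  · refine Eventually.of_forall fun τ x _ => ?_
    have h1 : HasDerivAt (fun x : ℝ => -((x : ℂ) * (τ + lam))) (-(1 * (τ + lam))) x :=
      ((Complex.ofRealCLM.hasDerivAt (x := x)).mul_const _).neg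
    refine (h1.cexp.mul_const (m τ)).congr_deriv ?_
    ring

theorem norm_dampedLaplace_le {lam : ℂ} {m : ℝ → ℂ} (hm : ExpIntegrable m) {r : ℝ}
    (hr : 1 ≤ r) : ‖dampedLaplace lam m r‖ ≤
      Real.exp (-(r * lam.re)) * ∫ τ in Ioi (0 : ℝ), ‖(Real.exp (-(1 * τ)) : ℂ) * m τ‖ := by
  rw [← integral_const_mul]
  refine norm_integral_le_of_norm_le ((hm 1 one_pos).norm.const_mul _) ?_
  filter_upwards [ae_restrict_mem measurableSet_Ioi] with τ (hτ : 0 < τ)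
  rw [norm_mul, norm_mul, norm_exp_damped, Complex.norm_real,
    Real.norm_of_nonneg (Real.exp_pos _).le, mul_comm (Real.exp (-(r * τ))), mul_assoc]
  gcongr

/-! ### The Macdonald function and the Hankel function -/

/-- The function `√τ (τ + 2 lam)^{1/2}`, a square root of `(τ + lam)² - lam²` on the half-line. -/
noncomputable def rootFun (lam : ℂ) (τ : ℝ) : ℂ :=
  (Real.sqrt τ : ℂ) * ((τ : ℂ) + 2 * lam) ^ (1 / 2 : ℂ)

theorem re_half_cpow_nonneg (w : ℂ) : 0 ≤ (w ^ (1 / 2 : ℂ)).re := by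
  by_cases hw : w = 0
  · subst hw; simp
  rw [Complex.cpow_def_of_ne_zero hw, Complex.exp_re]
  apply mul_nonneg (Real.exp_pos _).le
  apply Real.cos_nonneg_of_mem_Icc
  have h1 : (Complex.log w * (1 / 2 : ℂ)).im = w.arg / 2 := by
    simp [Complex.mul_im, Complex.log_im]; ring
  rw [h1]
  have := Complex.neg_pi_lt_arg w
  have := Complex.arg_le_pi w
  constructor <;> linarith

theorem half_cpow_mul_self (w : ℂ) : w ^ (1 / 2 : ℂ) * w ^ (1 / 2 : ℂ) = w := by
  rw [← sq]; simp

theorem norm_half_cpow (w : ℂ) : ‖w ^ (1 / 2 : ℂ)‖ = Real.sqrt ‖w‖ := by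
  rw [Real.sqrt_eq_rpow, ← Complex.norm_cpow_real]; norm_num

theorem add_two_mul_mem_slitPlane {lam : ℂ} (hlam : 0 < lam.re) {τ : ℝ} (hτ : 0 ≤ τ) :
    (τ : ℂ) + 2 * lam ∈ Complex.slitPlane := by
  left; simp; linarith

theorem sqrt_mul_self_complex {τ : ℝ} (hτ : 0 ≤ τ) : (Real.sqrt τ : ℂ) * Real.sqrt τ = τ := by
  rw [← Complex.ofReal_mul, Real.mul_self_sqrt hτ]

theorem rootFun_mul_self (lam : ℂ) {τ : ℝ} (hτ : 0 ≤ τ) :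
    rootFun lam τ * rootFun lam τ = (τ + lam) ^ 2 - lam ^ 2 := by
  have h1 := sqrt_mul_self_complex hτ
  have h2 := half_cpow_mul_self ((τ : ℂ) + 2 * lam)
  calc rootFun lam τ * rootFun lam τ = ((Real.sqrt τ : ℂ) * Real.sqrt τ) *
      (((τ : ℂ) + 2 * lam) ^ (1 / 2 : ℂ) * ((τ : ℂ) + 2 * lam) ^ (1 / 2 : ℂ)) := by
        rw [rootFun]; ring
    _ = _ := by rw [h1, h2]; ring

theorem rootFun_ne_zero {lam : ℂ} (hlam : 0 < lam.re) {τ : ℝ} (hτ : 0 < τ) :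
    rootFun lam τ ≠ 0 := by
  refine mul_ne_zero (by exact_mod_cast (Real.sqrt_pos.2 hτ).ne') ?_
  rw [Complex.cpow_ne_zero_iff]
  exact Or.inl (Complex.slitPlane_ne_zero (add_two_mul_mem_slitPlane hlam hτ.le))

theorem norm_rootFun {lam : ℂ} (τ : ℝ) :
    ‖rootFun lam τ‖ = Real.sqrt τ * Real.sqrt ‖(τ : ℂ) + 2 * lam‖ := by
  rw [rootFun, norm_mul, norm_half_cpow, Complex.norm_real,
    Real.norm_of_nonneg (Real.sqrt_nonneg _)]

theorem norm_rootFun_le (lam : ℂ) {τ : ℝ} (hτ : 0 ≤ τ) : ‖rootFun lam τ‖ ≤ τ + 2 * ‖lam‖ := by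
  have h1 : ‖(τ : ℂ) + 2 * lam‖ ≤ τ + 2 * ‖lam‖ := by
    refine (norm_add_le _ _).trans ?_
    rw [Complex.norm_real, Real.norm_of_nonneg hτ, norm_mul]; simp
  rw [norm_rootFun, ← Real.sqrt_mul hτ]
  apply Real.sqrt_le_iff.2
  have := norm_nonneg lam
  constructor
  · positivity
  · nlinarith [mul_le_mul_of_nonneg_left h1 hτ]

theorem norm_inv_rootFun_le {lam : ℂ} (hlam : 0 < lam.re) {τ : ℝ} (hτ : 0 < τ) :
    ‖(rootFun lam τ)⁻¹‖ ≤ (Real.sqrt (2 * lam.re))⁻¹ * τ ^ (-(1 / 2) : ℝ) := by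
  rw [norm_inv, norm_rootFun, mul_inv, mul_comm, Real.rpow_neg hτ.le, ← Real.sqrt_eq_rpow]
  have h1 : 2 * lam.re ≤ ‖(τ : ℂ) + 2 * lam‖ := by
    refine le_trans ?_ (Complex.re_le_norm _)
    simp; linarith
  have h2 := Real.sqrt_le_sqrt h1
  have h3 : 0 < Real.sqrt (2 * lam.re) := Real.sqrt_pos.2 (by linarith)
  gcongr

theorem continuousOn_rootFun {lam : ℂ} (hlam : 0 < lam.re) :
    ContinuousOn (rootFun lam) (Ici 0) := by
  refine ContinuousOn.mul (by fun_prop) ?_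
  refine ContinuousOn.cpow_const (by fun_prop) fun τ hτ => ?_
  exact add_two_mul_mem_slitPlane hlam hτ

theorem hasDerivAt_rootFun {lam : ℂ} (hlam : 0 < lam.re) {τ : ℝ} (hτ : 0 < τ) :
    HasDerivAt (rootFun lam) ((τ + lam) * (rootFun lam τ)⁻¹) τ := by
  have hw := add_two_mul_mem_slitPlane hlam hτ.le
  have hw0 := Complex.slitPlane_ne_zero hw
  have h1 : HasDerivAt (fun τ : ℝ => (Real.sqrt τ : ℂ)) ((1 / (2 * Real.sqrt τ) : ℝ) : ℂ) τ :=
    (Real.hasDerivAt_sqrt hτ.ne').ofReal_comp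
  have h2 : HasDerivAt (fun τ : ℝ => (τ : ℂ) + 2 * lam) 1 τ :=
    (Complex.ofRealCLM.hasDerivAt (x := τ)).add_const _
  have h3 := (HasDerivAt.cpow_const (c := (1 / 2 : ℂ)) (x := (τ : ℂ) + 2 * lam)
    (hasDerivAt_id _) hw).comp τ h2
  refine (h1.mul h3).congr_deriv ?_
  simp only [Function.comp, id]
  rw [Complex.cpow_sub _ _ hw0, Complex.cpow_one]
  have e1 := sqrt_mul_self_complex hτ.le
  have e2 := half_cpow_mul_self ((τ : ℂ) + 2 * lam)
  have n1 : (Real.sqrt τ : ℂ) ≠ 0 := by exact_mod_cast (Real.sqrt_pos.2 hτ).ne'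
  have n2 : ((τ : ℂ) + 2 * lam) ^ (1 / 2 : ℂ) ≠ 0 := by
    rw [Complex.cpow_ne_zero_iff]; exact Or.inl hw0
  rw [rootFun]
  set h := ((τ : ℂ) + 2 * lam) ^ (1 / 2 : ℂ) with hh
  set t := (Real.sqrt τ : ℂ) with ht
  have e3 : (τ : ℂ) + lam = (h * h + t * t) / 2 := by rw [e1, e2]; ring
  rw [e3, ← e2]
  push_cast
  rw [← ht]
  field_simp

theorem integrableOn_exp_neg_mul_rpow {ε a : ℝ} (hε : 0 < ε) (ha : -1 < a) :
    IntegrableOn (fun τ => Real.exp (-(ε * τ)) * τ ^ a) (Ioi 0) := by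
  have := integrableOn_rpow_mul_exp_neg_mul_rpow (s := a) (p := 1) (b := ε) ha one_pos hε
  refine this.congr_fun (fun τ _ => ?_) measurableSet_Ioi
  simp only [Real.rpow_one]
  rw [mul_comm, neg_mul]

theorem expIntegrable_inv_rootFun {lam : ℂ} (hlam : 0 < lam.re) :
    ExpIntegrable fun τ => (rootFun lam τ)⁻¹ := by
  refine expIntegrable_of_norm_le ?_ (fun τ hτ => norm_inv_rootFun_le hlam hτ) fun ε hε => ?_
  · refine ContinuousOn.aestronglyMeasurable ?_ measurableSet_Ioi
    exact ((continuousOn_rootFun hlam).mono Ioi_subset_Ici_self).inv₀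
      fun τ hτ => rootFun_ne_zero hlam hτ
  · refine ((integrableOn_exp_neg_mul_rpow hε (a := -(1 / 2)) (by norm_num)).const_mul
      (Real.sqrt (2 * lam.re))⁻¹).congr (Eventually.of_forall fun τ => ?_)
    simp only; ring

theorem expIntegrable_rootFun {lam : ℂ} (hlam : 0 < lam.re) :
    ExpIntegrable (rootFun lam) := by
  refine expIntegrable_of_norm_le ?_ (fun τ hτ => norm_rootFun_le lam hτ.le) fun ε hε => ?_
  · exact ((continuousOn_rootFun hlam).mono Ioi_subset_Ici_self).aestronglyMeasurable
      measurableSet_Ioi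
  · refine ((integrableOn_exp_neg_mul_rpow hε (a := 1) (by norm_num)).add
      ((integrableOn_exp_neg_mul_rpow hε (a := 0) (by norm_num)).const_mul
      (2 * ‖lam‖))).congr (Eventually.of_forall fun τ => ?_)
    simp; ring

/-- The Macdonald function `r ↦ K₀(lam r)`, written as a Laplace transform. -/
noncomputable def macdonald (lam : ℂ) : ℝ → ℂ := dampedLaplace lam fun τ => (rootFun lam τ)⁻¹

/-- The negative of the derivative of `macdonald lam`. -/
noncomputable def macdonaldOne (lam : ℂ) : ℝ → ℂ :=
  dampedLaplace lam fun τ => (τ + lam) * (rootFun lam τ)⁻¹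

theorem hasDerivAt_exp_damped (lam : ℂ) (r τ : ℝ) :
    HasDerivAt (fun τ : ℝ => Complex.exp (-(r * (τ + lam))))
      (-r * Complex.exp (-(r * (τ + lam)))) τ := by
  have h1 : HasDerivAt (fun τ : ℝ => -((r : ℂ) * (τ + lam))) (-(r * 1)) τ :=
    (((Complex.ofRealCLM.hasDerivAt (x := τ)).add_const lam).const_mul _).neg
  refine h1.cexp.congr_deriv ?_
  ring

/-- Integration by parts, with `d/dτ √(τ(τ + 2 lam)) = (τ + lam) / √(τ(τ + 2 lam))`. -/
theorem mul_dampedLaplace_rootFun {lam : ℂ} (hlam : 0 < lam.re) {r : ℝ} (hr : 0 < r) :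
    r * dampedLaplace lam (rootFun lam) r = macdonaldOne lam r := by
  have i1 := (expIntegrable_rootFun hlam).integrableOn lam hr
  have i2 := ((expIntegrable_inv_rootFun hlam).add_mul lam).integrableOn lam hr
  have hd : ∀ τ ∈ Ioi (0 : ℝ), HasDerivAt
      (fun τ : ℝ => Complex.exp (-(r * (τ + lam))) * rootFun lam τ)
      (Complex.exp (-(r * (τ + lam))) * ((τ + lam) * (rootFun lam τ)⁻¹) -
        r * (Complex.exp (-(r * (τ + lam))) * rootFun lam τ)) τ := fun τ hτ => by
    refine ((hasDerivAt_exp_damped lam r τ).mul (hasDerivAt_rootFun hlam hτ)).congr_deriv ?_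
    ring
  have h0 : Tendsto (fun τ : ℝ => Complex.exp (-(r * (τ + lam))) * rootFun lam τ) (𝓝[>] 0)
      (𝓝 0) := by
    have hc : ContinuousOn (fun τ : ℝ => Complex.exp (-(r * (τ + lam))) * rootFun lam τ)
        (Ici 0) := (by fun_prop : Continuous fun τ : ℝ =>
          Complex.exp (-(r * (τ + lam)))).continuousOn.mul (continuousOn_rootFun hlam)
    have := (hc 0 self_mem_Ici).mono_left (nhdsWithin_mono _ Ioi_subset_Ici_self)
    simpa [rootFun] using this
  have h := integral_Ioi_of_hasDerivAt_of_integrableOn h0 hd (i2.sub (i1.const_mul _)) i1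
  rw [integral_sub i2 (i1.const_mul _), integral_const_mul, neg_zero, sub_eq_zero] at h
  exact h.symm

theorem hasDerivAt_macdonald {lam : ℂ} (hlam : 0 < lam.re) {r : ℝ} (hr : 0 < r) :
    HasDerivAt (macdonald lam) (-macdonaldOne lam r) r :=
  hasDerivAt_dampedLaplace hlam (expIntegrable_inv_rootFun hlam) hr

/-- The Macdonald function satisfies the modified Bessel equation `(r k')' = lam² r k`. -/
theorem hasDerivAt_mul_macdonaldOne {lam : ℂ} (hlam : 0 < lam.re) {r : ℝ} (hr : 0 < r) :
    HasDerivAt (fun r : ℝ => r * macdonaldOne lam r) (-(lam ^ 2 * (r * macdonald lam r))) r := by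
  have hi := expIntegrable_inv_rootFun hlam
  have h1 := hasDerivAt_dampedLaplace hlam (hi.add_mul lam) hr
  have h2 : dampedLaplace lam (fun τ => (τ + lam) * ((τ + lam) * (rootFun lam τ)⁻¹)) r =
      dampedLaplace lam (rootFun lam) r + lam ^ 2 * macdonald lam r := by
    rw [macdonald, dampedLaplace, dampedLaplace, dampedLaplace, ← integral_const_mul,
      ← integral_add ((expIntegrable_rootFun hlam).integrableOn lam hr)
        ((hi.integrableOn lam hr).const_mul _)]
    refine setIntegral_congr_fun measurableSet_Ioi fun τ (hτ : 0 < τ) => ?_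
    have e1 := rootFun_mul_self lam hτ.le
    have e2 := rootFun_ne_zero hlam hτ
    field_simp
    linear_combination -e1
  refine ((Complex.ofRealCLM.hasDerivAt (x := r)).mul h1).congr_deriv ?_
  have h3 := mul_dampedLaplace_rootFun hlam hr
  rw [macdonaldOne] at h3
  rw [h2]
  simp only [Complex.ofRealCLM_apply, Complex.ofReal_one]
  linear_combination -h3

/-- The Macdonald function is at most of order `r^{-1/2}` at the origin and decays exponentially at
infinity. -/
theorem norm_macdonald_le {lam : ℂ} (hlam : 0 < lam.re) :
    ∃ C : ℝ, 0 ≤ C ∧ ∀ r : ℝ, 0 < r →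
      ‖macdonald lam r‖ ≤ C * (r ^ (-(1 / 2) : ℝ) * Real.exp (-(r * lam.re))) := by
  refine ⟨(Real.sqrt (2 * lam.re))⁻¹ * Real.Gamma (1 / 2), by positivity, fun r hr => ?_⟩
  have hI := Real.integral_rpow_mul_exp_neg_mul_Ioi (a := 1 / 2) (r := r) (by norm_num) hr
  have hb := norm_integral_le_of_norm_le (f := fun τ : ℝ => Complex.exp (-(r * (τ + lam))) *
      (rootFun lam τ)⁻¹)
    ((integrableOn_exp_neg_mul_rpow hr (a := -(1 / 2)) (by norm_num)).const_mul
      (Real.exp (-(r * lam.re)) * (Real.sqrt (2 * lam.re))⁻¹)) (by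
        filter_upwards [ae_restrict_mem measurableSet_Ioi] with τ (hτ : 0 < τ)
        rw [norm_mul, norm_exp_damped]
        calc _ ≤ Real.exp (-(r * τ)) * Real.exp (-(r * lam.re)) *
              ((Real.sqrt (2 * lam.re))⁻¹ * τ ^ (-(1 / 2) : ℝ)) := by
              gcongr; exact norm_inv_rootFun_le hlam hτ
          _ = _ := by ring)
  refine hb.trans (le_of_eq ?_)
  rw [integral_const_mul]
  have : ∫ τ in Ioi (0 : ℝ), Real.exp (-(r * τ)) * τ ^ (-(1 / 2) : ℝ) =
      (1 / r) ^ (1 / 2 : ℝ) * Real.Gamma (1 / 2) := by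
    rw [← hI]
    refine setIntegral_congr_fun measurableSet_Ioi fun τ _ => ?_
    rw [mul_comm]; norm_num
  rw [this, one_div r, Real.inv_rpow hr.le, Real.rpow_neg hr.le]
  ring

/-- `(i/4) H₀⁽¹⁾(z r) = K₀(-i z r) / 2π`, by the substitution `t = r τ`. -/
theorem hankel_eq_macdonald {z : ℂ} (hz : 0 < z.im) {r : ℝ} (hr : 0 < r) :
    hankel (z * r) = macdonald (-Complex.I * z) r / (2 * Real.pi) := by
  set lam := -Complex.I * z with hl
  have hlam : 0 < lam.re := by simpa [hl] using hz
  set F : ℝ → ℂ := fun t => ((Real.exp (-t) * t ^ (-(1 / 2) : ℝ) : ℝ) : ℂ) *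
    ((t : ℂ) / 2 - Complex.I * (z * r)) ^ (-(1 / 2) : ℂ) with hF
  have hsub := integral_comp_mul_left_Ioi F 0 hr
  rw [mul_zero] at hsub
  have hr0 : (r : ℂ) ≠ 0 := by exact_mod_cast hr.ne'
  have hI : ∫ t in Ioi (0 : ℝ), F t =
      Real.sqrt 2 * Complex.exp (r * lam) * macdonald lam r := by
    have h1 : (r : ℂ) * ((r⁻¹ : ℝ) • ∫ t in Ioi (0 : ℝ), F t) = ∫ t in Ioi (0 : ℝ), F t := by
      rw [Complex.real_smul, ← mul_assoc, Complex.ofReal_inv, mul_inv_cancel₀ hr0, one_mul]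
    rw [← h1, ← hsub, macdonald, dampedLaplace, ← integral_const_mul, ← integral_const_mul]
    refine setIntegral_congr_fun measurableSet_Ioi fun τ (hτ : 0 < τ) => ?_
    simp only [hF]
    have hw := Complex.slitPlane_ne_zero (add_two_mul_mem_slitPlane hlam hτ.le)
    have e1 : ((r * τ : ℝ) : ℂ) / 2 - Complex.I * (z * r) = ((r / 2 : ℝ) : ℂ) * (τ + 2 * lam) := by
      rw [hl]; push_cast; ring
    have e2 : (((r / 2 : ℝ) : ℂ)) ^ (-(1 / 2) : ℂ) = ((r / 2) ^ (-(1 / 2) : ℝ) : ℝ) := by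
      rw [Complex.ofReal_cpow (by positivity)]; norm_num
    have e3 : ((τ : ℂ) + 2 * lam) ^ (-(1 / 2) : ℂ) = (((τ : ℂ) + 2 * lam) ^ (1 / 2 : ℂ))⁻¹ :=
      Complex.cpow_neg _ _
    have e4 : r * (Real.exp (-(r * τ)) * (r * τ) ^ (-(1 / 2) : ℝ)) * (r / 2) ^ (-(1 / 2) : ℝ) =
        Real.sqrt 2 * Real.exp (-(r * τ)) * (Real.sqrt τ)⁻¹ := by
      rw [Real.rpow_neg (by positivity), Real.rpow_neg (by positivity), ← Real.sqrt_eq_rpow,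
        ← Real.sqrt_eq_rpow, Real.sqrt_mul hr.le, Real.sqrt_div hr.le]
      have := Real.mul_self_sqrt hr.le
      have h3 := Real.sqrt_pos.2 hr
      have h4 := Real.sqrt_pos.2 hτ
      field_simp
      linear_combination -this
    rw [e1, ofReal_mul_cpow (by positivity) hw, e2, e3, rootFun, mul_inv]
    have e5 : Complex.exp (r * lam) * Complex.exp (-(r * (τ + lam))) =
        (Real.exp (-(r * τ)) : ℂ) := by
      rw [← Complex.exp_add, Complex.ofReal_exp]; congr 1; push_cast; ring
    have e6 := congrArg (fun x : ℝ => (x : ℂ)) e4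
    simp only [Complex.ofReal_mul, Complex.ofReal_inv] at e6
    simp only [Complex.ofReal_mul]
    linear_combination (((τ : ℂ) + 2 * lam) ^ (1 / 2 : ℂ))⁻¹ * e6 -
      Real.sqrt 2 * (Real.sqrt τ : ℂ)⁻¹ * (((τ : ℂ) + 2 * lam) ^ (1 / 2 : ℂ))⁻¹ * e5
  rw [hankel]
  change _ * ∫ t in Ioi (0 : ℝ), F t = _
  rw [hI]
  have e7 : Complex.exp (Complex.I * (z * r)) * Complex.exp (r * lam) = 1 := by
    rw [← Complex.exp_add, hl]
    convert Complex.exp_zero using 2; ring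
  have e8 : ((2 : ℝ) ^ (3 / 2 : ℝ)) = 2 * Real.sqrt 2 := by
    rw [Real.sqrt_eq_rpow, ← Real.rpow_one_add' (by norm_num) (by norm_num)]; norm_num
  have e9 : (Real.sqrt 2 : ℂ) ≠ 0 := by
    exact_mod_cast (Real.sqrt_pos.2 two_pos).ne'
  have e10 : (Real.pi : ℂ) ≠ 0 := by exact_mod_cast Real.pi_ne_zero
  rw [e8]
  rw [eq_inv_of_mul_eq_one_left e7]
  push_cast
  have e11 := Complex.exp_ne_zero (r * lam)
  field_simp

/-! ### Behaviour of the Macdonald function at the origin -/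

theorem abs_log_le_rpow_add_rpow {ε t : ℝ} (hε : 0 < ε) (ht : 0 < t) :
    |Real.log t| ≤ ε⁻¹ * (t ^ ε + t ^ (-ε)) := by
  have h1 := Real.log_le_rpow_div ht.le hε
  have h2 := Real.log_le_rpow_div (inv_pos.2 ht).le hε
  rw [Real.log_inv, Real.inv_rpow ht.le, ← Real.rpow_neg ht.le] at h2
  have h3 := Real.rpow_pos_of_pos ht ε
  have h4 := Real.rpow_pos_of_pos ht (-ε)
  rw [div_eq_inv_mul] at h1 h2
  have h5 : 0 < ε⁻¹ := inv_pos.2 hε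
  have h6 := mul_pos h5 h3
  have h7 := mul_pos h5 h4
  rw [abs_le]
  constructor <;> linarith

theorem integrableOn_exp_neg_mul_abs_log {ε : ℝ} (hε : 0 < ε) :
    IntegrableOn (fun t => Real.exp (-(ε * t)) * |Real.log t|) (Ioi 0) := by
  refine (((integrableOn_exp_neg_mul_rpow hε (a := 1 / 2) (by norm_num)).add
    (integrableOn_exp_neg_mul_rpow hε (a := -(1 / 2)) (by norm_num))).const_mul
      (1 / 2 : ℝ)⁻¹).mono' ?_ ?_
  · exact (by fun_prop : Measurable _).aestronglyMeasurable
  · filter_upwards [ae_restrict_mem measurableSet_Ioi] with t (ht : 0 < t)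
    rw [Real.norm_of_nonneg (by positivity)]
    have := abs_log_le_rpow_add_rpow (ε := 1 / 2) (by norm_num) ht
    calc _ ≤ Real.exp (-(ε * t)) * ((1 / 2 : ℝ)⁻¹ * (t ^ (1 / 2 : ℝ) + t ^ (-(1 / 2) : ℝ))) := by
          gcongr
      _ = _ := by simp only [Pi.add_apply]; ring

/-- `Γ'(1) = -γ`. -/
theorem integral_exp_neg_mul_log :
    ∫ t in Ioi (0 : ℝ), (Real.exp (-t) : ℂ) * (Real.log t : ℂ) =
      -(Real.eulerMascheroniConstant : ℂ) := by
  have h1 := Complex.hasDerivAt_GammaIntegral (s := 1) (by simp)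
  have h2 : HasDerivAt Complex.GammaIntegral (-(Real.eulerMascheroniConstant : ℂ)) 1 := by
    refine Complex.hasDerivAt_Gamma_one.congr_of_eventuallyEq ?_
    have : {s : ℂ | 0 < s.re} ∈ 𝓝 (1 : ℂ) :=
      (isOpen_lt continuous_const Complex.continuous_re).mem_nhds (by simp)
    filter_upwards [this] with s hs using (Complex.Gamma_eq_integral hs).symm
  rw [← h1.unique h2]
  refine setIntegral_congr_fun measurableSet_Ioi fun t _ => ?_
  simp [mul_comm]

theorem rootFun_mul_mul (lam : ℂ) (hlam : 0 < lam.re) {r τ : ℝ} (hr : 0 < r) (hτ : 0 ≤ τ) :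
    rootFun (r * lam) (r * τ) = r * rootFun lam τ := by
  have hw := Complex.slitPlane_ne_zero (add_two_mul_mem_slitPlane hlam hτ)
  have e1 : ((r * τ : ℝ) : ℂ) + 2 * (r * lam) = (r : ℂ) * (τ + 2 * lam) := by push_cast; ring
  have e2 : (r : ℂ) ^ (1 / 2 : ℂ) = (Real.sqrt r : ℂ) := by
    rw [Real.sqrt_eq_rpow, Complex.ofReal_cpow hr.le]; norm_num
  rw [rootFun, e1, ofReal_mul_cpow hr hw, e2, rootFun, Real.sqrt_mul hr.le]
  push_cast
  linear_combination (Real.sqrt τ : ℂ) * ((τ : ℂ) + 2 * lam) ^ (1 / 2 : ℂ) *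
    sqrt_mul_self_complex hr.le

/-- For vanishing parameter `√(t(t + 2 r lam))` becomes `t`. -/
theorem tendsto_rootFun_mul (lam : ℂ) {t : ℝ} (ht : 0 < t) :
    Tendsto (fun r : ℝ => rootFun (r * lam) t) (𝓝[>] 0) (𝓝 (t : ℂ)) := by
  have h1 : ContinuousAt (fun r : ℝ => rootFun (r * lam) t) 0 := by
    unfold rootFun
    refine ContinuousAt.mul continuousAt_const
      (ContinuousAt.cpow (by fun_prop) continuousAt_const ?_)
    left; simpa using ht
  have h2 := h1.tendsto.mono_left (nhdsWithin_le_nhds (s := Ioi 0))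
  convert h2 using 2
  have e2 : (t : ℂ) ^ (1 / 2 : ℂ) = (Real.sqrt t : ℂ) := by
    rw [Real.sqrt_eq_rpow, Complex.ofReal_cpow ht.le]; norm_num
  simp only [rootFun, Complex.ofReal_zero, zero_mul, mul_zero, add_zero]
  rw [e2, sqrt_mul_self_complex ht.le]

theorem norm_exp_neg_add_le {lam : ℂ} (hlam : 0 < lam.re) {r : ℝ} (hr : 0 < r) (t : ℝ) :
    ‖Complex.exp (-(t + r * lam))‖ ≤ Real.exp (-(1 * t)) := by
  rw [Complex.norm_exp]
  apply Real.exp_le_exp.2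
  have := mul_pos hr hlam
  simp; linarith

theorem mem_Ioo_nhdsGT : Ioo (0 : ℝ) 1 ∈ 𝓝[>] (0 : ℝ) := Ioo_mem_nhdsGT one_pos

theorem aestronglyMeasurable_rootFun {lam : ℂ} (hlam : 0 < lam.re) :
    AEStronglyMeasurable (rootFun lam) (volume.restrict (Ioi 0)) :=
  ((continuousOn_rootFun hlam).mono Ioi_subset_Ici_self).aestronglyMeasurable measurableSet_Ioi

theorem re_ofReal_mul_pos {lam : ℂ} (hlam : 0 < lam.re) {r : ℝ} (hr : 0 < r) :
    0 < ((r : ℂ) * lam).re := by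
  simpa using mul_pos hr hlam

/-- `r K₁(lam r) lam → 1`: the logarithmic slope of the Macdonald function at the origin. -/
theorem tendsto_mul_macdonaldOne {lam : ℂ} (hlam : 0 < lam.re) :
    Tendsto (fun r : ℝ => r * macdonaldOne lam r) (𝓝[>] 0) (𝓝 1) := by
  have hT : Tendsto (fun r : ℝ => ∫ t in Ioi (0 : ℝ),
      Complex.exp (-(t + r * lam)) * rootFun (r * lam) t) (𝓝[>] 0)
      (𝓝 (∫ t in Ioi (0 : ℝ), (Real.exp (-t) : ℂ) * t)) := by
    refine tendsto_integral_filter_of_dominated_convergence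
      (fun t => Real.exp (-(1 * t)) * t ^ (1 : ℝ) +
        2 * ‖lam‖ * (Real.exp (-(1 * t)) * t ^ (0 : ℝ))) ?_ ?_
      ((integrableOn_exp_neg_mul_rpow one_pos (by norm_num)).add
        ((integrableOn_exp_neg_mul_rpow one_pos (by norm_num)).const_mul _)) ?_
    · filter_upwards [self_mem_nhdsWithin] with r (hr : 0 < r)
      refine AEStronglyMeasurable.mul ?_ (aestronglyMeasurable_rootFun (re_ofReal_mul_pos hlam hr))
      apply Continuous.aestronglyMeasurable; fun_prop
    · filter_upwards [mem_Ioo_nhdsGT] with r hr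
      filter_upwards [ae_restrict_mem measurableSet_Ioi] with t (ht : 0 < t)
      have h1 := norm_rootFun_le (r * lam) ht.le
      have h2 : ‖(r : ℂ) * lam‖ ≤ ‖lam‖ := by
        rw [norm_mul, Complex.norm_real, Real.norm_of_nonneg hr.1.le]
        nlinarith [norm_nonneg lam, hr.2]
      rw [norm_mul]
      calc _ ≤ Real.exp (-(1 * t)) * (t + 2 * ‖lam‖) := by
            gcongr
            · exact norm_exp_neg_add_le hlam hr.1 t
            · linarith
        _ = _ := by rw [Real.rpow_one, Real.rpow_zero]; ring
    · filter_upwards [ae_restrict_mem measurableSet_Ioi] with t (ht : 0 < t)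
      refine Tendsto.mul ?_ (tendsto_rootFun_mul lam ht)
      have : ContinuousAt (fun r : ℝ => Complex.exp (-(t + r * lam))) 0 := by fun_prop
      convert this.tendsto.mono_left (nhdsWithin_le_nhds (s := Ioi 0)) using 2
      simp
  have hI : ∫ t in Ioi (0 : ℝ), (Real.exp (-t) : ℂ) * t = 1 := by
    have h := Real.Gamma_eq_integral (s := 2) two_pos
    have h2 : Real.Gamma 2 = 1 := Real.Gamma_two
    rw [h2] at h
    have h3 : ∫ t in Ioi (0 : ℝ), (Real.exp (-t) : ℂ) * t =
        ((∫ t in Ioi (0 : ℝ), Real.exp (-t) * t ^ ((2 : ℝ) - 1) : ℝ) : ℂ) := by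
      rw [← integral_complex_ofReal]
      refine setIntegral_congr_fun measurableSet_Ioi fun t _ => ?_
      norm_num
    rw [h3, ← h, Complex.ofReal_one]
  rw [hI] at hT
  refine hT.congr' ?_
  filter_upwards [self_mem_nhdsWithin] with r (hr : 0 < r)
  have hr0 : (r : ℂ) ≠ 0 := by exact_mod_cast hr.ne'
  have hsub := integral_comp_mul_left_Ioi
    (fun t : ℝ => Complex.exp (-(t + r * lam)) * rootFun (r * lam) t) 0 hr
  rw [mul_zero, Complex.real_smul, Complex.ofReal_inv] at hsub
  rw [← mul_dampedLaplace_rootFun hlam hr]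
  have h2 : ∫ τ in Ioi (0 : ℝ), Complex.exp (-((r * τ : ℝ) + r * lam)) *
      rootFun (r * lam) (r * τ) = r * dampedLaplace lam (rootFun lam) r := by
    rw [dampedLaplace, ← integral_const_mul]
    refine setIntegral_congr_fun measurableSet_Ioi fun τ (hτ : 0 < τ) => ?_
    rw [rootFun_mul_mul lam hlam hr hτ.le]
    push_cast
    ring_nf
  rw [h2] at hsub
  field_simp at hsub
  rw [← hsub]; ring

/-- The argument `τ + lam + √(τ(τ + 2 lam))` of the logarithmic antiderivative of
`1 / √(τ(τ + 2 lam))`. -/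
noncomputable def logArg (lam : ℂ) (τ : ℝ) : ℂ := τ + lam + rootFun lam τ

theorem re_rootFun_nonneg (lam : ℂ) (τ : ℝ) : 0 ≤ (rootFun lam τ).re := by
  rw [rootFun, Complex.re_ofReal_mul]
  exact mul_nonneg (Real.sqrt_nonneg _) (re_half_cpow_nonneg _)

theorem le_re_logArg (lam : ℂ) (τ : ℝ) : τ + lam.re ≤ (logArg lam τ).re := by
  have := re_rootFun_nonneg lam τ
  simp [logArg]; linarith

theorem logArg_mem_slitPlane {lam : ℂ} (hlam : 0 < lam.re) {τ : ℝ} (hτ : 0 ≤ τ) :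
    logArg lam τ ∈ Complex.slitPlane := by
  left
  have := le_re_logArg lam τ
  linarith

theorem norm_log_logArg_le {lam : ℂ} (hlam : 0 < lam.re) {t : ℝ} (ht : 0 < t) :
    ‖Complex.log (logArg lam t)‖ ≤ |Real.log t| + 2 * t + (3 * ‖lam‖ + Real.pi) := by
  have h1 : t ≤ ‖logArg lam t‖ := by
    have := le_re_logArg lam t
    have := Complex.re_le_norm (logArg lam t)
    linarith
  have h2 : ‖logArg lam t‖ ≤ 2 * t + 3 * ‖lam‖ := by
    have e1 := norm_add_le ((t : ℂ) + lam) (rootFun lam t)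
    have e2 := norm_add_le (t : ℂ) lam
    have e3 := norm_rootFun_le lam ht.le
    rw [Complex.norm_real, Real.norm_of_nonneg ht.le] at e2
    rw [logArg]; linarith
  have h3 := Complex.norm_le_abs_re_add_abs_im (Complex.log (logArg lam t))
  rw [Complex.log_re, Complex.log_im] at h3
  have h4 := Complex.abs_arg_le_pi (logArg lam t)
  have h5 := Real.log_le_log ht h1
  have h6 := Real.log_le_self (norm_nonneg (logArg lam t))
  have h7 : |Real.log ‖logArg lam t‖| ≤ |Real.log t| + 2 * t + 3 * ‖lam‖ := by
    rw [abs_le]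
    have := neg_abs_le (Real.log t)
    have := abs_nonneg (Real.log t)
    have := norm_nonneg lam
    constructor <;> linarith
  linarith

theorem continuousOn_log_logArg {lam : ℂ} (hlam : 0 < lam.re) :
    ContinuousOn (fun τ => Complex.log (logArg lam τ)) (Ici 0) := by
  refine ContinuousOn.clog ?_ fun τ hτ => logArg_mem_slitPlane hlam hτ
  exact ContinuousOn.add (by fun_prop) (continuousOn_rootFun hlam)

theorem hasDerivAt_log_logArg {lam : ℂ} (hlam : 0 < lam.re) {τ : ℝ} (hτ : 0 < τ) :
    HasDerivAt (fun τ => Complex.log (logArg lam τ)) (rootFun lam τ)⁻¹ τ := by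
  have h1 : HasDerivAt (logArg lam) (1 + (τ + lam) * (rootFun lam τ)⁻¹) τ :=
    ((Complex.ofRealCLM.hasDerivAt (x := τ)).add_const lam).add (hasDerivAt_rootFun hlam hτ)
  refine (h1.clog_real (logArg_mem_slitPlane hlam hτ.le)).congr_deriv ?_
  have e1 := rootFun_ne_zero hlam hτ
  have e2 := Complex.slitPlane_ne_zero (logArg_mem_slitPlane hlam hτ.le)
  rw [logArg] at *
  field_simp
  ring

theorem integrableOn_exp_neg_mul_log_bound (c : ℝ) {ε : ℝ} (hε : 0 < ε) : IntegrableOn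
    (fun t => Real.exp (-(ε * t)) * (|Real.log t| + 2 * t + c)) (Ioi 0) := by
  refine (((integrableOn_exp_neg_mul_abs_log hε).add
    ((integrableOn_exp_neg_mul_rpow hε (a := 1) (by norm_num)).const_mul 2)).add
    ((integrableOn_exp_neg_mul_rpow hε (a := 0) (by norm_num)).const_mul c)).congr
      (Eventually.of_forall fun t => ?_)
  simp; ring

theorem expIntegrable_log_logArg {lam : ℂ} (hlam : 0 < lam.re) :
    ExpIntegrable fun τ => Complex.log (logArg lam τ) := by
  refine expIntegrable_of_norm_le ?_ (fun τ hτ => norm_log_logArg_le hlam hτ)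
    fun ε hε => integrableOn_exp_neg_mul_log_bound _ hε
  exact ((continuousOn_log_logArg hlam).mono Ioi_subset_Ici_self).aestronglyMeasurable
    measurableSet_Ioi

/-- Integration by parts against the antiderivative `log (logArg lam)`, which moves the singularity
of `K₀(lam r)` at `r = 0` into a factor `r`. -/
theorem macdonald_eq_log_add {lam : ℂ} (hlam : 0 < lam.re) {r : ℝ} (hr : 0 < r) :
    macdonald lam r = r * dampedLaplace lam (fun τ => Complex.log (logArg lam τ)) r -
      Complex.exp (-(r * lam)) * Complex.log lam := by
  have i1 := (expIntegrable_log_logArg hlam).integrableOn lam hr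
  have i2 := (expIntegrable_inv_rootFun hlam).integrableOn lam hr
  have hd : ∀ τ ∈ Ioi (0 : ℝ), HasDerivAt
      (fun τ : ℝ => Complex.exp (-(r * (τ + lam))) * Complex.log (logArg lam τ))
      (Complex.exp (-(r * (τ + lam))) * (rootFun lam τ)⁻¹ -
        r * (Complex.exp (-(r * (τ + lam))) * Complex.log (logArg lam τ))) τ := fun τ hτ => by
    refine ((hasDerivAt_exp_damped lam r τ).mul (hasDerivAt_log_logArg hlam hτ)).congr_deriv ?_
    ring
  have h0 : Tendsto (fun τ : ℝ => Complex.exp (-(r * (τ + lam))) * Complex.log (logArg lam τ))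
      (𝓝[>] 0) (𝓝 (Complex.exp (-(r * lam)) * Complex.log lam)) := by
    have hc : ContinuousOn (fun τ : ℝ => Complex.exp (-(r * (τ + lam))) *
        Complex.log (logArg lam τ)) (Ici 0) := (by fun_prop : Continuous fun τ : ℝ =>
          Complex.exp (-(r * (τ + lam)))).continuousOn.mul (continuousOn_log_logArg hlam)
    have := (hc 0 self_mem_Ici).mono_left (nhdsWithin_mono _ Ioi_subset_Ici_self)
    simpa [rootFun, logArg] using this
  have h := integral_Ioi_of_hasDerivAt_of_integrableOn h0 hd (i2.sub (i1.const_mul _)) i1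
  rw [integral_sub i2 (i1.const_mul _), integral_const_mul] at h
  rw [macdonald, dampedLaplace, dampedLaplace]
  linear_combination h

/-- The constant term in the expansion of `K₀(lam r)` at the origin. -/
noncomputable def macdonaldConst (lam : ℂ) : ℂ :=
  Real.log 2 - Complex.log lam - Real.eulerMascheroniConstant

/-- `K₀(lam r) = -log r + macdonaldConst lam + o(1)` as `r → 0`. After the substitution `t = r τ`
the integral of `macdonald_eq_log_add` converges to `∫ e^{-t} log (2t) dt = log 2 - γ`. -/
theorem tendsto_macdonald_add_log {lam : ℂ} (hlam : 0 < lam.re) :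
    Tendsto (fun r : ℝ => macdonald lam r + Real.log r) (𝓝[>] 0) (𝓝 (macdonaldConst lam)) := by
  have hT : Tendsto (fun r : ℝ => ∫ t in Ioi (0 : ℝ),
      Complex.exp (-(t + r * lam)) * Complex.log (logArg (r * lam) t)) (𝓝[>] 0)
      (𝓝 (∫ t in Ioi (0 : ℝ), (Real.exp (-t) : ℂ) * (Real.log (2 * t) : ℂ))) := by
    refine tendsto_integral_filter_of_dominated_convergence
      (fun t => Real.exp (-(1 * t)) * (|Real.log t| + 2 * t + (3 * ‖lam‖ + Real.pi))) ?_ ?_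
      (integrableOn_exp_neg_mul_log_bound _ one_pos) ?_
    · filter_upwards [self_mem_nhdsWithin] with r (hr : 0 < r)
      refine AEStronglyMeasurable.mul ?_
        (((continuousOn_log_logArg (re_ofReal_mul_pos hlam hr)).mono
          Ioi_subset_Ici_self).aestronglyMeasurable measurableSet_Ioi)
      apply Continuous.aestronglyMeasurable; fun_prop
    · filter_upwards [mem_Ioo_nhdsGT] with r hr
      filter_upwards [ae_restrict_mem measurableSet_Ioi] with t (ht : 0 < t)
      have h1 := norm_log_logArg_le (re_ofReal_mul_pos hlam hr.1) ht
      have h2 : ‖(r : ℂ) * lam‖ ≤ ‖lam‖ := by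
        rw [norm_mul, Complex.norm_real, Real.norm_of_nonneg hr.1.le]
        nlinarith [norm_nonneg lam, hr.2]
      rw [norm_mul]
      gcongr
      · exact norm_exp_neg_add_le hlam hr.1 t
      · linarith
    · filter_upwards [ae_restrict_mem measurableSet_Ioi] with t (ht : 0 < t)
      refine Tendsto.mul ?_ ?_
      · have : ContinuousAt (fun r : ℝ => Complex.exp (-(t + r * lam))) 0 := by fun_prop
        convert this.tendsto.mono_left (nhdsWithin_le_nhds (s := Ioi 0)) using 2
        simp
      · have h1 : Tendsto (fun r : ℝ => logArg (r * lam) t) (𝓝[>] 0) (𝓝 ((2 * t : ℝ) : ℂ)) := by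
          have h2 : ContinuousAt (fun r : ℝ => (t : ℂ) + r * lam) 0 := by fun_prop
          have h3 := (h2.tendsto.mono_left (nhdsWithin_le_nhds (s := Ioi 0))).add
            (tendsto_rootFun_mul lam ht)
          have e : ((2 * t : ℝ) : ℂ) = t + (0 : ℝ) * lam + t := by push_cast; ring
          rw [e]
          exact h3
        rw [Complex.ofReal_log (by positivity)]
        refine h1.clog ?_
        left; simpa using ht
  have hI : ∫ t in Ioi (0 : ℝ), (Real.exp (-t) : ℂ) * (Real.log (2 * t) : ℂ) =
      Real.log 2 - Real.eulerMascheroniConstant := by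
    have i1 : IntegrableOn (fun t : ℝ => (Real.exp (-t) : ℂ)) (Ioi 0) := by
      have := (integrableOn_exp_neg_mul_rpow one_pos (a := 0) (by norm_num)).ofReal (𝕜 := ℂ)
      simpa [IntegrableOn] using this
    have i2 : IntegrableOn (fun t : ℝ => (Real.exp (-t) : ℂ) * (Real.log t : ℂ)) (Ioi 0) := by
      refine (integrableOn_exp_neg_mul_abs_log one_pos).mono' ?_ ?_
      · exact (by fun_prop : Measurable _).aestronglyMeasurable
      · refine Eventually.of_forall fun t => ?_
        rw [norm_mul, Complex.norm_real, Complex.norm_real, Real.norm_of_nonneg (Real.exp_pos _).le,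
          Real.norm_eq_abs, one_mul]
    have h1 : ∫ t in Ioi (0 : ℝ), (Real.exp (-t) : ℂ) = 1 := by
      rw [integral_complex_ofReal, integral_exp_neg_Ioi_zero, Complex.ofReal_one]
    calc _ = ∫ t in Ioi (0 : ℝ), (Real.log 2 * (Real.exp (-t) : ℂ) +
          (Real.exp (-t) : ℂ) * (Real.log t : ℂ)) := by
          refine setIntegral_congr_fun measurableSet_Ioi fun t (ht : 0 < t) => ?_
          rw [Real.log_mul two_ne_zero ht.ne']
          push_cast; ring
      _ = _ := by
          rw [integral_add (i1.const_mul _) i2, integral_const_mul, h1, integral_exp_neg_mul_log]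
          ring
  rw [hI] at hT
  have hexp : Tendsto (fun r : ℝ => Complex.exp (-(r * lam))) (𝓝[>] 0) (𝓝 1) := by
    have : ContinuousAt (fun r : ℝ => Complex.exp (-(r * lam))) 0 := by fun_prop
    convert this.tendsto.mono_left (nhdsWithin_le_nhds (s := Ioi 0)) using 2
    simp
  have hlog : Tendsto (fun r : ℝ => (Real.log r : ℂ) * (1 - Complex.exp (-(r * lam)))) (𝓝[>] 0)
      (𝓝 0) := by
    have h1 : Tendsto (fun r : ℝ => Real.log r * r) (𝓝[>] 0) (𝓝 0) := by
      simpa using tendsto_log_mul_rpow_nhdsGT_zero one_pos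
    have h2 := (h1.abs).mul_const (2 * ‖lam‖)
    rw [abs_zero, zero_mul] at h2
    refine squeeze_zero_norm' ?_ h2
    have h3 : Tendsto (fun r : ℝ => ‖-((r : ℂ) * lam)‖) (𝓝[>] 0) (𝓝 0) := by
      have : ContinuousAt (fun r : ℝ => ‖-((r : ℂ) * lam)‖) 0 := by fun_prop
      convert this.tendsto.mono_left (nhdsWithin_le_nhds (s := Ioi 0)) using 2
      simp
    filter_upwards [self_mem_nhdsWithin, h3.eventually (ge_mem_nhds one_pos)] with
      r (hr : 0 < r) hr1
    have h4 := Complex.norm_exp_sub_one_le hr1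
    rw [norm_neg, norm_mul, Complex.norm_real, Real.norm_of_nonneg hr.le] at h4
    rw [norm_mul, Complex.norm_real, Real.norm_eq_abs, norm_sub_rev, abs_mul, abs_of_pos hr]
    calc _ ≤ |Real.log r| * (2 * (r * ‖lam‖)) := by gcongr
      _ = _ := by ring
  have hfin := (hT.sub (hexp.mul_const (Complex.log lam))).add hlog
  rw [show (Real.log 2 : ℂ) - Real.eulerMascheroniConstant - 1 * Complex.log lam + 0 =
    macdonaldConst lam by rw [macdonaldConst]; ring] at hfin
  refine hfin.congr' ?_
  filter_upwards [self_mem_nhdsWithin] with r (hr : 0 < r)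
  have hr0 : (r : ℂ) ≠ 0 := by exact_mod_cast hr.ne'
  have hsub := integral_comp_mul_left_Ioi
    (fun t : ℝ => Complex.exp (-(t + r * lam)) * Complex.log (logArg (r * lam) t)) 0 hr
  rw [mul_zero, Complex.real_smul, Complex.ofReal_inv] at hsub
  have i1 := (expIntegrable_log_logArg hlam).integrableOn lam hr
  have i0 : IntegrableOn (fun τ : ℝ => Complex.exp (-(r * (τ + lam)))) (Ioi 0) := by
    have : ExpIntegrable fun _ => 1 := fun ε hε => by
      have := (integrableOn_exp_neg_mul_rpow hε (a := 0) (by norm_num)).ofReal (𝕜 := ℂ)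
      simpa [IntegrableOn] using this
    simpa using this.integrableOn lam hr
  have h1 : ∫ τ in Ioi (0 : ℝ), Complex.exp (-(r * (τ + lam))) = (r : ℂ)⁻¹ *
      Complex.exp (-(r * lam)) := by
    have hs := integral_comp_mul_left_Ioi
      (fun t : ℝ => Complex.exp (-(r * lam)) * (Real.exp (-t) : ℂ)) 0 hr
    rw [mul_zero, Complex.real_smul, Complex.ofReal_inv,
      integral_const_mul (Complex.exp (-(r * lam))) (fun t : ℝ => (Real.exp (-t) : ℂ)),
      integral_complex_ofReal, integral_exp_neg_Ioi_zero, Complex.ofReal_one, mul_one] at hs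
    rw [← hs]
    refine setIntegral_congr_fun measurableSet_Ioi fun τ _ => ?_
    rw [Complex.ofReal_exp, ← Complex.exp_add]
    push_cast
    ring_nf
  have h2 : ∫ τ in Ioi (0 : ℝ), Complex.exp (-((r * τ : ℝ) + r * lam)) *
      Complex.log (logArg (r * lam) (r * τ)) = (Real.log r : ℂ) * ((r : ℂ)⁻¹ *
      Complex.exp (-(r * lam))) + dampedLaplace lam (fun τ => Complex.log (logArg lam τ)) r := by
    rw [dampedLaplace, ← h1, ← integral_const_mul, ← integral_add (i0.const_mul _) i1]
    refine setIntegral_congr_fun measurableSet_Ioi fun τ (hτ : 0 < τ) => ?_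
    have e1 : logArg (r * lam) (r * τ) = r * logArg lam τ := by
      rw [logArg, rootFun_mul_mul lam hlam hr hτ.le, logArg]; push_cast; ring
    rw [e1, Complex.log_ofReal_mul hr
      (Complex.slitPlane_ne_zero (logArg_mem_slitPlane hlam hτ.le))]
    have e2 : -(((r * τ : ℝ) : ℂ) + r * lam) = -(r * (τ + lam)) := by push_cast; ring
    rw [e2]; ring
  rw [h2] at hsub
  rw [macdonald_eq_log_add hlam hr]
  have h3 : ∫ (x : ℝ) in Ioi 0, Complex.exp (-(↑x + ↑r * lam)) *
      Complex.log (logArg (↑r * lam) x) = Real.log r * Complex.exp (-(r * lam)) +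
      r * dampedLaplace lam (fun τ => Complex.log (logArg lam τ)) r := by
    field_simp at hsub
    rw [← hsub]
  rw [h3]; ring

/-! ### Moments of the Macdonald function -/

theorem continuousOn_macdonald {lam : ℂ} (hlam : 0 < lam.re) :
    ContinuousOn (macdonald lam) (Ioi 0) := fun _ hr =>
  (hasDerivAt_macdonald hlam hr).continuousAt.continuousWithinAt

theorem integrableOn_mul_macdonald {lam : ℂ} (hlam : 0 < lam.re) :
    IntegrableOn (fun r : ℝ => r * macdonald lam r) (Ioi 0) := by
  obtain ⟨C, hC, hb⟩ := norm_macdonald_le hlam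
  refine ((integrableOn_exp_neg_mul_rpow hlam (a := 1 / 2) (by norm_num)).const_mul C).mono' ?_ ?_
  · exact (ContinuousOn.mul (by fun_prop) (continuousOn_macdonald hlam)).aestronglyMeasurable
      measurableSet_Ioi
  · filter_upwards [ae_restrict_mem measurableSet_Ioi] with r (hr : 0 < r)
    rw [norm_mul, Complex.norm_real, Real.norm_of_nonneg hr.le]
    have h1 : r ^ (1 / 2 : ℝ) = r * r ^ (-(1 / 2) : ℝ) := by
      rw [← Real.rpow_one_add' hr.le (by norm_num)]; norm_num
    calc _ ≤ r * (C * (r ^ (-(1 / 2) : ℝ) * Real.exp (-(r * lam.re)))) := by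
          gcongr; exact hb r hr
      _ = _ := by rw [h1, mul_comm lam.re r]; ring

theorem integrableOn_mul_macdonald_mul_log {lam : ℂ} (hlam : 0 < lam.re) :
    IntegrableOn (fun r : ℝ => r * macdonald lam r * (Real.log r : ℂ)) (Ioi 0) := by
  obtain ⟨C, hC, hb⟩ := norm_macdonald_le hlam
  refine (((integrableOn_exp_neg_mul_rpow hlam (a := 1) (by norm_num)).add
    (integrableOn_exp_neg_mul_rpow hlam (a := 0) (by norm_num))).const_mul
      (C * (1 / 2 : ℝ)⁻¹)).mono' ?_ ?_
  · exact ((ContinuousOn.mul (by fun_prop) (continuousOn_macdonald hlam)).aestronglyMeasurable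
      measurableSet_Ioi).mul (by fun_prop : Measurable _).aestronglyMeasurable
  · filter_upwards [ae_restrict_mem measurableSet_Ioi] with r (hr : 0 < r)
    rw [norm_mul, norm_mul, Complex.norm_real, Real.norm_of_nonneg hr.le, Complex.norm_real,
      Real.norm_eq_abs]
    have h1 : r * r ^ (-(1 / 2) : ℝ) = r ^ (1 / 2 : ℝ) := by
      rw [← Real.rpow_one_add' hr.le (by norm_num)]; norm_num
    have h2 : r ^ (1 / 2 : ℝ) * r ^ (1 / 2 : ℝ) = r ^ (1 : ℝ) := by
      rw [← Real.rpow_add hr]; norm_num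
    have h3 : r ^ (1 / 2 : ℝ) * r ^ (-(1 / 2) : ℝ) = r ^ (0 : ℝ) := by
      rw [← Real.rpow_add hr]; norm_num
    calc _ ≤ r * (C * (r ^ (-(1 / 2) : ℝ) * Real.exp (-(r * lam.re)))) *
          ((1 / 2 : ℝ)⁻¹ * (r ^ (1 / 2 : ℝ) + r ^ (-(1 / 2) : ℝ))) := by
          gcongr
          · exact hb r hr
          · exact abs_log_le_rpow_add_rpow (by norm_num) hr
      _ = C * (1 / 2 : ℝ)⁻¹ * (Real.exp (-(lam.re * r)) * (r * r ^ (-(1 / 2) : ℝ) *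
          (r ^ (1 / 2 : ℝ) + r ^ (-(1 / 2) : ℝ)))) := by rw [mul_comm lam.re r]; ring
      _ = _ := by
        rw [h1, mul_add, h2, h3]; simp only [Pi.add_apply]; ring

theorem tendsto_macdonald_atTop {lam : ℂ} (hlam : 0 < lam.re) :
    Tendsto (fun r : ℝ => macdonald lam r) atTop (𝓝 0) := by
  have hi := expIntegrable_inv_rootFun hlam
  have h1 := (tendsto_rpow_mul_exp_neg_mul_atTop_nhds_zero 0 lam.re hlam).mul_const
    (∫ τ in Ioi (0 : ℝ), ‖(Real.exp (-(1 * τ)) : ℂ) * (rootFun lam τ)⁻¹‖)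
  rw [zero_mul] at h1
  refine squeeze_zero_norm' ?_ h1
  filter_upwards [eventually_ge_atTop 1] with r hr
  refine (norm_dampedLaplace_le hi hr).trans (le_of_eq ?_)
  rw [Real.rpow_zero, one_mul, neg_mul, mul_comm lam.re]

theorem tendsto_mul_macdonaldOne_mul_log_atTop {lam : ℂ} (hlam : 0 < lam.re) :
    Tendsto (fun r : ℝ => r * macdonaldOne lam r * (1 + Real.log r : ℝ)) atTop (𝓝 0) := by
  have hi := (expIntegrable_inv_rootFun hlam).add_mul lam
  have h1 := (tendsto_rpow_mul_exp_neg_mul_atTop_nhds_zero 2 lam.re hlam).mul_const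
    (∫ τ in Ioi (0 : ℝ), ‖(Real.exp (-(1 * τ)) : ℂ) * ((τ + lam) * (rootFun lam τ)⁻¹)‖)
  rw [zero_mul] at h1
  refine squeeze_zero_norm' ?_ h1
  filter_upwards [eventually_ge_atTop 1] with r hr
  have h2 := norm_dampedLaplace_le (lam := lam) hi hr
  have h3 : 0 < r := by linarith
  have h4 : 1 + Real.log r ≤ r := by linarith [Real.log_le_sub_one_of_pos h3]
  have h5 : 0 ≤ 1 + Real.log r := by linarith [Real.log_nonneg hr]
  rw [norm_mul, norm_mul, Complex.norm_real, Complex.norm_real, Real.norm_of_nonneg h3.le,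
    Real.norm_of_nonneg h5]
  calc _ ≤ r * (Real.exp (-(r * lam.re)) * ∫ τ in Ioi (0 : ℝ), ‖(Real.exp (-(1 * τ)) : ℂ) *
        ((τ + lam) * (rootFun lam τ)⁻¹)‖) * r := by
        gcongr; exact h2
    _ = _ := by
        rw [neg_mul, mul_comm lam.re, Real.rpow_two]; ring

theorem tendsto_mul_macdonaldOne_atTop {lam : ℂ} (hlam : 0 < lam.re) :
    Tendsto (fun r : ℝ => r * macdonaldOne lam r) atTop (𝓝 0) := by
  refine squeeze_zero_norm' ?_
    (tendsto_norm_zero.comp (tendsto_mul_macdonaldOne_mul_log_atTop hlam))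
  filter_upwards [eventually_ge_atTop 1] with r hr
  have h5 := Real.log_nonneg hr
  simp only [Function.comp]
  rw [norm_mul _ ((1 + Real.log r : ℝ) : ℂ), Complex.norm_real,
    Real.norm_of_nonneg (by linarith : 0 ≤ 1 + Real.log r)]
  exact le_mul_of_one_le_right (norm_nonneg _) (by linarith)

/-- `∫₀^∞ r K₀(lam r) dr = 1 / lam²`. -/
theorem integral_mul_macdonald {lam : ℂ} (hlam : 0 < lam.re) :
    lam ^ 2 * ∫ r in Ioi (0 : ℝ), (r : ℂ) * macdonald lam r = 1 := by
  have h := integral_Ioi_of_hasDerivAt_of_tendsto_nhdsGT (tendsto_mul_macdonaldOne hlam)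
    (fun r hr => hasDerivAt_mul_macdonaldOne hlam hr)
    ((integrableOn_mul_macdonald hlam).const_mul _).neg (tendsto_mul_macdonaldOne_atTop hlam)
  rw [integral_neg, integral_const_mul] at h
  linear_combination -h

theorem log_max_eq {ρ r : ℝ} : Real.log (max ρ r) = if r ≤ ρ then Real.log ρ else Real.log r := by
  split_ifs with h
  · rw [max_eq_left h]
  · rw [max_eq_right (by linarith)]

theorem integrableOn_mul_macdonald_mul_log_max {lam : ℂ} (hlam : 0 < lam.re) (ρ : ℝ) :
    IntegrableOn (fun r : ℝ => r * macdonald lam r * (Real.log (max ρ r) : ℂ)) (Ioi 0) := by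
  refine (((integrableOn_mul_macdonald_mul_log hlam).norm).add
    ((integrableOn_mul_macdonald hlam).norm.mul_const |Real.log ρ|)).mono' ?_ ?_
  · exact (integrableOn_mul_macdonald hlam).aestronglyMeasurable.mul
      (by fun_prop : Measurable _).aestronglyMeasurable
  · refine Eventually.of_forall fun r => ?_
    simp only [Pi.add_apply]
    rw [norm_mul, norm_mul _ (Real.log r : ℂ), Complex.norm_real, Complex.norm_real,
      Real.norm_eq_abs, Real.norm_eq_abs, log_max_eq, ← mul_add]
    gcongr
    split_ifs
    · linarith [abs_nonneg (Real.log r)]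
    · linarith [abs_nonneg (Real.log ρ)]

/-- `∫₀^∞ r K₀(lam r) log (max ρ r) dr = (log ρ + K₀(lam ρ)) / lam²` for `ρ > 0`. -/
theorem integral_mul_macdonald_mul_log_max {lam : ℂ} (hlam : 0 < lam.re) {ρ : ℝ} (hρ : 0 < ρ) :
    lam ^ 2 * ∫ r in Ioi (0 : ℝ), (r : ℂ) * macdonald lam r * (Real.log (max ρ r) : ℂ) =
      Real.log ρ + macdonald lam ρ := by
  have hsub : Ioi ρ ⊆ Ioi 0 := Ioi_subset_Ioi hρ.le
  have i0 := integrableOn_mul_macdonald_mul_log_max hlam ρ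
  have i1 := integrableOn_mul_macdonald hlam
  have i2 := integrableOn_mul_macdonald_mul_log hlam
  have ht : ∀ {f : ℝ → ℂ} {a : ℂ}, HasDerivAt f a ρ → Tendsto f (𝓝[>] ρ) (𝓝 (f ρ)) :=
    fun h => h.continuousAt.tendsto.mono_left nhdsWithin_le_nhds
  have hA := integral_mul_macdonald hlam
  have hB := integral_Ioi_of_hasDerivAt_of_tendsto_nhdsGT
    (ht (hasDerivAt_mul_macdonaldOne hlam hρ))
    (fun r (hr : ρ < r) => hasDerivAt_mul_macdonaldOne hlam (hρ.trans hr))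
    ((i1.mono_set hsub).const_mul _).neg (tendsto_mul_macdonaldOne_atTop hlam)
  rw [integral_neg, integral_const_mul] at hB
  -- Green's formula for `K₀` and `log`, both radial solutions up to the term `lam² K₀`
  have hd : ∀ r : ℝ, 0 < r → HasDerivAt (fun r : ℝ => (r * macdonaldOne lam r) * (Real.log r : ℂ) +
      macdonald lam r) (-(lam ^ 2 * (r * macdonald lam r * (Real.log r : ℂ)))) r := fun r hr => by
    have hr0 : (r : ℂ) ≠ 0 := by exact_mod_cast hr.ne'
    refine (((hasDerivAt_mul_macdonaldOne hlam hr).mul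
      (Real.hasDerivAt_log hr.ne').ofReal_comp).add (hasDerivAt_macdonald hlam hr)).congr_deriv ?_
    push_cast
    field_simp
    ring
  have hinf : Tendsto (fun r : ℝ => (r * macdonaldOne lam r) * (Real.log r : ℂ) +
      macdonald lam r) atTop (𝓝 0) := by
    have := ((tendsto_mul_macdonaldOne_mul_log_atTop hlam).sub
      (tendsto_mul_macdonaldOne_atTop hlam)).add (tendsto_macdonald_atTop hlam)
    rw [sub_zero, add_zero] at this
    refine this.congr fun r => ?_
    push_cast; ring
  have hC := integral_Ioi_of_hasDerivAt_of_tendsto_nhdsGT (ht (hd ρ hρ))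
    (fun r (hr : ρ < r) => hd r (hρ.trans hr)) ((i2.mono_set hsub).const_mul _).neg hinf
  rw [integral_neg, integral_const_mul] at hC
  have hu : Ioc 0 ρ ∪ Ioi ρ = Ioi (0 : ℝ) := Ioc_union_Ioi_eq_Ioi hρ.le
  have hdisj : Disjoint (Ioc 0 ρ) (Ioi ρ) := Ioc_disjoint_Ioi le_rfl
  have hs1 : Ioc 0 ρ ⊆ Ioi (0 : ℝ) := Ioc_subset_Ioi_self
  rw [← hu, setIntegral_union hdisj measurableSet_Ioi (i1.mono_set hs1) (i1.mono_set hsub)] at hA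
  rw [← hu, setIntegral_union hdisj measurableSet_Ioi (i0.mono_set hs1) (i0.mono_set hsub)]
  have e1 : ∫ r in Ioc 0 ρ, (r : ℂ) * macdonald lam r * (Real.log (max ρ r) : ℂ) =
      (∫ r in Ioc 0 ρ, (r : ℂ) * macdonald lam r) * (Real.log ρ : ℂ) := by
    rw [← integral_mul_const]
    refine setIntegral_congr_fun measurableSet_Ioc fun r hr => ?_
    rw [max_eq_left hr.2]
  have e2 : ∫ r in Ioi ρ, (r : ℂ) * macdonald lam r * (Real.log (max ρ r) : ℂ) =
      ∫ r in Ioi ρ, (r : ℂ) * macdonald lam r * (Real.log r : ℂ) := by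
    refine setIntegral_congr_fun measurableSet_Ioi fun r (hr : ρ < r) => ?_
    rw [max_eq_right hr.le]
  rw [e1, e2]
  -- `hB` and `hC` evaluate the integrals over `r > ρ`; `hA` yields the remaining one over `r ≤ ρ`
  linear_combination (Real.log ρ : ℂ) * hA + (Real.log ρ : ℂ) * hB - hC

/-- `∫₀^∞ r K₀(lam r) log r dr`, obtained by letting `ρ → 0` in the previous formula. -/
theorem integral_mul_macdonald_mul_log {lam : ℂ} (hlam : 0 < lam.re) :
    lam ^ 2 * ∫ r in Ioi (0 : ℝ), (r : ℂ) * macdonald lam r * (Real.log r : ℂ) =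
      macdonaldConst lam := by
  have h1 : Tendsto (fun ρ : ℝ => ∫ r in Ioi (0 : ℝ), (r : ℂ) * macdonald lam r *
      (Real.log (max ρ r) : ℂ)) (𝓝[>] 0)
      (𝓝 (∫ r in Ioi (0 : ℝ), (r : ℂ) * macdonald lam r * (Real.log r : ℂ))) := by
    refine tendsto_integral_filter_of_dominated_convergence _ ?_ ?_
      (integrableOn_mul_macdonald_mul_log hlam).norm ?_
    · exact Eventually.of_forall fun ρ =>
        (integrableOn_mul_macdonald_mul_log_max hlam ρ).aestronglyMeasurable
    · filter_upwards [mem_Ioo_nhdsGT] with ρ hρ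
      filter_upwards [ae_restrict_mem measurableSet_Ioi] with r (hr : 0 < r)
      rw [norm_mul, norm_mul _ (Real.log r : ℂ), Complex.norm_real, Complex.norm_real,
        Real.norm_eq_abs, Real.norm_eq_abs, log_max_eq]
      refine mul_le_mul_of_nonneg_left ?_ (norm_nonneg _)
      split_ifs with h
      · have h2 := Real.log_le_log hr h
        have h3 := Real.log_nonpos hρ.1.le hρ.2.le
        rw [abs_of_nonpos h3, abs_of_nonpos (h2.trans h3)]
        linarith
      · rfl
    · filter_upwards [ae_restrict_mem measurableSet_Ioi] with r (hr : 0 < r)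
      refine tendsto_const_nhds.congr' ?_
      filter_upwards [Ioo_mem_nhdsGT hr] with ρ hρ
      rw [max_eq_right hρ.2.le]
  have h2 := h1.const_mul (lam ^ 2)
  refine tendsto_nhds_unique h2 ((tendsto_macdonald_add_log hlam).congr' ?_)
  filter_upwards [self_mem_nhdsWithin] with ρ (hρ : 0 < ρ)
  rw [integral_mul_macdonald_mul_log_max hlam hρ, add_comm]

/-! ### Newton's theorem in the plane -/

theorem log_add_posLog_eq_log_max {R t : ℝ} (hR : 0 < R) (ht : 0 ≤ t) :
    Real.log R + Real.posLog (R⁻¹ * t) = Real.log (max t R) := by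
  rcases le_total t R with h | h
  · rw [max_eq_right h, Real.posLog_eq_zero_iff _ |>.2, add_zero]
    rw [abs_of_nonneg (by positivity), inv_mul_le_iff₀ hR]; linarith
  · have ht' : 0 < t := hR.trans_le h
    rw [max_eq_left h, Real.posLog_eq_log, Real.log_mul (by positivity) ht'.ne', Real.log_inv]
    · ring
    · rw [abs_of_nonneg (by positivity), le_inv_mul_iff₀ hR]; linarith

/-- The mean of `log ‖x - ·‖` over the circle through `y` centred at the origin. -/
theorem integral_log_norm_sub_rotation (x : ℂ) {y : ℂ} (hy : y ≠ 0) :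
    ∫ θ in (0 : ℝ)..(2 * Real.pi), Real.log ‖x - rotation (Circle.exp θ) y‖ =
      2 * Real.pi * Real.log (max ‖x‖ ‖y‖) := by
  -- a rotation by `-arg y` turns the integral into a circle average over the radius `‖y‖`
  set u : ℂ := Complex.exp (-(y.arg * Complex.I)) with hu
  have hu1 : ‖u‖ = 1 := by
    rw [hu, ← neg_mul, ← Complex.ofReal_neg]; exact Complex.norm_exp_ofReal_mul_I _
  have hR : 0 < ‖y‖ := norm_pos_iff.2 hy
  have h := circleAverage_log_norm_sub_const_eq_log_radius_add_posLog (a := u * x) (c := 0)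
    hR.ne'
  rw [zero_sub, norm_neg, norm_mul, hu1, one_mul, log_add_posLog_eq_log_max hR (norm_nonneg _),
    Real.circleAverage, smul_eq_mul, inv_mul_eq_iff_eq_mul₀ (by positivity)] at h
  rw [← h]
  refine intervalIntegral.integral_congr fun θ _ => ?_
  simp only [rotation_apply, Circle.coe_exp, circleMap, zero_add]
  congr 1
  have e1 : y * u = ‖y‖ := by
    conv_lhs => rw [← Complex.norm_mul_exp_arg_mul_I y]
    rw [hu, mul_assoc, ← Complex.exp_add, add_neg_cancel, Complex.exp_zero, mul_one]
  calc ‖x - Complex.exp (θ * Complex.I) * y‖ = ‖u‖ * ‖x - Complex.exp (θ * Complex.I) * y‖ := by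
        rw [hu1, one_mul]
    _ = ‖u * x - ‖y‖ * Complex.exp (θ * Complex.I)‖ := by
        rw [← norm_mul, ← e1]; ring_nf
    _ = _ := norm_sub_rev _ _

/-- The logarithm may be replaced by its means over circles centred at the origin, by averaging over
rotations. -/
theorem integral_radial_mul_log_complex {k : ℝ → ℂ} {x : ℂ}
    (hk : AEStronglyMeasurable (fun y : ℂ => k ‖y‖))
    (hi : Integrable fun y : ℂ => k ‖y‖ * (Real.log ‖x - y‖ : ℂ)) :
    ∫ y : ℂ, k ‖y‖ * (Real.log ‖x - y‖ : ℂ) =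
      ∫ y : ℂ, k ‖y‖ * (Real.log (max ‖x‖ ‖y‖) : ℂ) := by
  set I := ∫ y : ℂ, k ‖y‖ * (Real.log ‖x - y‖ : ℂ) with hI
  have hmp : ∀ θ : ℝ, MeasurePreserving (rotation (Circle.exp θ)) (volume : Measure ℂ) volume :=
    fun θ => (rotation (Circle.exp θ)).measurePreserving
  have hemb : ∀ θ : ℝ, MeasurableEmbedding (rotation (Circle.exp θ)) :=
    fun θ => (rotation (Circle.exp θ)).toHomeomorph.measurableEmbedding
  set F : ℝ → ℂ → ℂ := fun θ y => k ‖y‖ * (Real.log ‖x - rotation (Circle.exp θ) y‖ : ℂ) with hF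
  have hF' : ∀ θ, F θ = (fun y : ℂ => k ‖y‖ * (Real.log ‖x - y‖ : ℂ)) ∘ rotation (Circle.exp θ) :=
    fun θ => by ext y; simp [hF]
  have hFi : ∀ θ, Integrable (F θ) := fun θ => by
    rw [hF']; exact (hmp θ).integrable_comp_of_integrable hi
  have hFI : ∀ θ, ∫ y, F θ y = I := fun θ => by
    rw [hF', hI]; exact (hmp θ).integral_comp (hemb θ)
      (fun y : ℂ => k ‖y‖ * (Real.log ‖x - y‖ : ℂ))
  have hFn : ∀ θ, ∫ y, ‖F θ y‖ = ∫ y : ℂ, ‖k ‖y‖ * (Real.log ‖x - y‖ : ℂ)‖ := fun θ => by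
    rw [hF']; exact (hmp θ).integral_comp (hemb θ) (fun y => ‖k ‖y‖ * (Real.log ‖x - y‖ : ℂ)‖)
  have hprod : Integrable (Function.uncurry F)
      ((volume.restrict (Ioc 0 (2 * Real.pi))).prod volume) := by
    rw [integrable_prod_iff]
    · refine ⟨Eventually.of_forall hFi, ?_⟩
      simp only [Function.uncurry_apply_pair, hFn]
      exact integrable_const _
    · refine AEStronglyMeasurable.mul hk.comp_snd ?_
      have hc : Continuous fun p : ℝ × ℂ => ‖x - rotation (Circle.exp p.1) p.2‖ := by
        simp only [rotation_apply, Circle.coe_exp]; fun_prop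
      have : Measurable fun p : ℝ × ℂ => (Real.log ‖x - rotation (Circle.exp p.1) p.2‖ : ℂ) :=
        Complex.measurable_ofReal.comp (Real.measurable_log.comp hc.measurable)
      exact this.aestronglyMeasurable
  have hswap := integral_integral_swap hprod
  simp only [hFI, integral_const] at hswap
  have hpi : (0 : ℝ) ≤ 2 * Real.pi := by positivity
  have hin : ∀ᵐ y : ℂ, ∫ θ in Ioc 0 (2 * Real.pi), F θ y =
      (2 * Real.pi : ℂ) * (k ‖y‖ * (Real.log (max ‖x‖ ‖y‖) : ℂ)) := by
    have : ∀ᵐ y : ℂ, y ≠ 0 := by simp [ae_iff]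
    filter_upwards [this] with y hy
    have h := integral_log_norm_sub_rotation x hy
    rw [intervalIntegral.integral_of_le hpi] at h
    simp only [hF]
    rw [integral_const_mul, integral_complex_ofReal, h]
    push_cast; ring
  rw [integral_congr_ae hin, integral_const_mul] at hswap
  have hv : ((volume : Measure ℝ).restrict (Ioc 0 (2 * Real.pi))).real univ = 2 * Real.pi := by
    simp [Measure.real, Real.pi_pos.le]
  rw [hv, Complex.real_smul] at hswap
  push_cast at hswap
  exact mul_left_cancel₀ (by simp) hswap

theorem volume_real_unitBall : (volume : Measure Plane).real (Metric.ball 0 1) = Real.pi := by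
  simp [Measure.real, EuclideanSpace.volume_ball_fin_two, Real.pi_pos.le]

theorem integral_radial (k : ℝ → ℂ) :
    ∫ x : Plane, k ‖x‖ = 2 * Real.pi * ∫ r in Ioi (0 : ℝ), (r : ℂ) * k r := by
  rw [integral_fun_norm_addHaar (volume : Measure Plane) k, volume_real_unitBall]
  simp [mul_assoc]

theorem integrable_radial_iff {F : Type*} [NormedAddCommGroup F] [NormedSpace ℝ F] {k : ℝ → F} :
    Integrable (fun x : Plane => k ‖x‖) ↔ IntegrableOn (fun r : ℝ => r • k r) (Ioi 0) := by
  rw [integrable_fun_norm_addHaar (volume : Measure Plane)]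
  simp

/-- Newton's theorem in the plane: a radial density acts on `log ‖x - ·‖` through its masses inside
and outside the circle through `x`. -/
theorem integral_radial_mul_log {k : ℝ → ℂ} {x : Plane}
    (hk : AEStronglyMeasurable (fun y : Plane => k ‖y‖))
    (hi : Integrable fun y : Plane => k ‖y‖ * (Real.log ‖x - y‖ : ℂ)) :
    ∫ y : Plane, k ‖y‖ * (Real.log ‖x - y‖ : ℂ) =
      2 * Real.pi * ∫ r in Ioi (0 : ℝ), (r : ℂ) * k r * (Real.log (max ‖x‖ r) : ℂ) := by
  set e : ℂ ≃ₗᵢ[ℝ] Plane := Complex.orthonormalBasisOneI.repr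
  have hmp : MeasurePreserving e volume volume := e.measurePreserving
  have hemb : MeasurableEmbedding e := e.toHomeomorph.measurableEmbedding
  have e1 : ∀ w : ℂ, ‖x - e w‖ = ‖e.symm x - w‖ := fun w => by
    rw [← e.symm.norm_map, map_sub, e.symm_apply_apply]
  have h := integral_radial_mul_log_complex (k := k) (x := e.symm x) ?_ ?_
  · rw [← hmp.integral_comp hemb]
    simp only [e1, e.norm_map]
    rw [h]
    have h2 := integral_radial fun r => k r * (Real.log (max ‖x‖ r) : ℂ)
    rw [← hmp.integral_comp hemb] at h2
    simp only [e.norm_map, e.symm.norm_map] at h2 ⊢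
    rw [h2]
    simp only [mul_assoc]
  · have := hk.comp_measurePreserving hmp
    simpa [Function.comp_def] using this
  · have := hmp.integrable_comp_of_integrable hi
    simpa [Function.comp_def, e1] using this

/-! ### Integrability of the Green function and the weighted spaces -/

theorem one_add_norm_le_mul (x y : Plane) : 1 + ‖y‖ ≤ (1 + ‖x‖) * (1 + ‖x - y‖) := by
  have h1 : ‖y‖ ≤ ‖x‖ + ‖x - y‖ := by
    have := norm_sub_le x (x - y)
    rwa [sub_sub_cancel] at this
  nlinarith [mul_nonneg (norm_nonneg x) (norm_nonneg (x - y))]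

theorem integrable_one_add_norm_pow_mul (n : ℕ) {a c : ℝ} (ha : -2 < a) (hc : 0 < c) :
    Integrable fun x : Plane => (1 + ‖x‖) ^ n * (‖x‖ ^ a * Real.exp (-(c * ‖x‖))) := by
  refine (integrable_radial_iff
    (k := fun r : ℝ => (1 + r) ^ n * (r ^ a * Real.exp (-(c * r))))).2 ?_
  -- half of the exponential absorbs the polynomial factor
  set D : ℝ := n.factorial * (2 / c) ^ n * Real.exp (c / 2) with hD
  refine ((integrableOn_exp_neg_mul_rpow (half_pos hc)
    (a := 1 + a) (by linarith)).const_mul D).mono' ?_ ?_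
  · exact (by fun_prop : Measurable _).aestronglyMeasurable
  · filter_upwards [ae_restrict_mem measurableSet_Ioi] with r (hr : 0 < r)
    rw [smul_eq_mul, Real.norm_of_nonneg (by positivity), Real.rpow_add hr, Real.rpow_one]
    have h1 := Real.pow_div_factorial_le_exp (c / 2 * (1 + r)) (by positivity) n
    have h2 : (1 + r) ^ n ≤ D * Real.exp (c / 2 * r) := by
      rw [div_le_iff₀ (by positivity), mul_pow] at h1
      calc (1 + r) ^ n = (2 / c) ^ n * ((c / 2) ^ n * (1 + r) ^ n) := by
            rw [← mul_assoc, ← mul_pow, div_mul_div_cancel₀ hc.ne', div_self two_ne_zero, one_pow,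
              one_mul]
        _ ≤ (2 / c) ^ n * (Real.exp (c / 2 * (1 + r)) * n.factorial) := by gcongr
        _ = _ := by rw [hD, mul_add, mul_one, Real.exp_add]; ring
    have h3 : Real.exp (c / 2 * r) * Real.exp (-(c * r)) = Real.exp (-(c / 2 * r)) := by
      rw [← Real.exp_add]; ring_nf
    calc r * ((1 + r) ^ n * (r ^ a * Real.exp (-(c * r))))
        ≤ r * ((D * Real.exp (c / 2 * r)) * (r ^ a * Real.exp (-(c * r)))) := by gcongr
      _ = _ := by rw [← h3]; ring

section green

variable {z : ℂ}

theorem re_neg_I_mul (z : ℂ) : (-Complex.I * z).re = z.im := by simp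

/-- The Green function is radial with profile `K₀(-i z r) / 2π`. -/
theorem green_eq_macdonald (hz : 0 < z.im) {x : Plane} (hx : x ≠ 0) :
    green z x = macdonald (-Complex.I * z) ‖x‖ / (2 * Real.pi) := by
  rw [green, hankel_eq_macdonald hz (norm_pos_iff.2 hx)]

theorem ae_ne_plane (y : Plane) : ∀ᵐ x : Plane, x ≠ y := by
  simp [ae_iff]

theorem green_ae_eq (hz : 0 < z.im) :
    green z =ᵐ[volume] fun x => macdonald (-Complex.I * z) ‖x‖ / (2 * Real.pi) := by
  filter_upwards [ae_ne_plane 0] with x hx using green_eq_macdonald hz hx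

theorem aestronglyMeasurable_macdonald_norm {lam : ℂ} (hlam : 0 < lam.re) :
    AEStronglyMeasurable (fun x : Plane => macdonald lam ‖x‖) := by
  have h : ContinuousOn (fun x : Plane => macdonald lam ‖x‖) {0}ᶜ :=
    (continuousOn_macdonald hlam).comp continuous_norm.continuousOn
      fun x hx => norm_pos_iff.2 hx
  have := h.aestronglyMeasurable (μ := volume) (measurableSet_singleton 0).compl
  rwa [restrict_compl_singleton] at this

theorem aestronglyMeasurable_green (hz : 0 < z.im) : AEStronglyMeasurable (green z) :=
  AEStronglyMeasurable.congr ((aestronglyMeasurable_macdonald_norm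
    (by rwa [re_neg_I_mul] : 0 < (-Complex.I * z).re)).mul
      (aestronglyMeasurable_const (b := (2 * (Real.pi : ℂ))⁻¹))) (green_ae_eq hz).symm

theorem norm_green_le (hz : 0 < z.im) : ∃ C : ℝ, 0 ≤ C ∧ ∀ x : Plane, x ≠ 0 →
    ‖green z x‖ ≤ C * (‖x‖ ^ (-(1 / 2) : ℝ) * Real.exp (-(z.im * ‖x‖))) := by
  obtain ⟨C, hC, hb⟩ := norm_macdonald_le (by rwa [re_neg_I_mul] : 0 < (-Complex.I * z).re)
  refine ⟨C / (2 * Real.pi), by positivity, fun x hx => ?_⟩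
  have h := hb ‖x‖ (norm_pos_iff.2 hx)
  rw [re_neg_I_mul] at h
  rw [green_eq_macdonald hz hx, norm_div, norm_mul, Complex.norm_real,
    Real.norm_of_nonneg Real.pi_pos.le, div_mul_eq_mul_div, mul_comm z.im]
  norm_num
  gcongr
  norm_num at h
  exact h

theorem integrable_one_add_norm_pow_mul_green (hz : 0 < z.im) (n : ℕ) :
    Integrable fun x : Plane => (((1 + ‖x‖) ^ n : ℝ) : ℂ) * green z x := by
  obtain ⟨C, hC, hb⟩ := norm_green_le hz
  refine ((integrable_one_add_norm_pow_mul n (a := -(1 / 2)) (by norm_num) hz).const_mul C).mono'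
    ?_ ?_
  · refine AEStronglyMeasurable.mul ?_ (aestronglyMeasurable_green hz)
    exact Continuous.aestronglyMeasurable (by fun_prop)
  · filter_upwards [ae_ne_plane 0] with x hx
    rw [norm_mul, Complex.norm_real, Real.norm_of_nonneg (by positivity)]
    calc _ ≤ (1 + ‖x‖) ^ n * (C * (‖x‖ ^ (-(1 / 2) : ℝ) * Real.exp (-(z.im * ‖x‖)))) := by
          gcongr; exact hb x hx
      _ = _ := by ring

theorem integrable_green (hz : 0 < z.im) : Integrable (green z) := by
  simpa using integrable_one_add_norm_pow_mul_green hz 0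

/-- Square integrability after multiplication by `(1 + |x|)²`. Convolution with such a kernel is
defined at every point for functions in `L²_{-σ}`, `σ ≤ 2`. -/
def SqDecay (K : Plane → ℂ) : Prop :=
  MemLp (fun x : Plane => (((1 + ‖x‖) ^ 2 : ℝ) : ℂ) * K x) 2 volume

theorem sqDecay_green (hz : 0 < z.im) : SqDecay (green z) := by
  obtain ⟨C, hC, hb⟩ := norm_green_le hz
  have hm : AEStronglyMeasurable fun x : Plane => (((1 + ‖x‖) ^ 2 : ℝ) : ℂ) * green z x :=
    (integrable_one_add_norm_pow_mul_green hz 2).aestronglyMeasurable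
  refine (memLp_two_iff_integrable_sq_norm hm).2 ?_
  refine ((integrable_one_add_norm_pow_mul 4 (a := -1) (by norm_num)
    (by positivity : 0 < 2 * z.im)).const_mul (C ^ 2)).mono' (hm.norm.pow 2) ?_
  filter_upwards [ae_ne_plane 0] with x hx
  have hx' := norm_pos_iff.2 hx
  rw [Real.norm_of_nonneg (by positivity), norm_mul, Complex.norm_real,
    Real.norm_of_nonneg (by positivity)]
  have e1 : ‖x‖ ^ (-1 : ℝ) = (‖x‖ ^ (-(1 / 2) : ℝ)) ^ 2 := by
    rw [← Real.rpow_natCast, ← Real.rpow_mul hx'.le]; norm_num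
  have e2 : Real.exp (-(2 * z.im * ‖x‖)) = Real.exp (-(z.im * ‖x‖)) ^ 2 := by
    rw [← Real.exp_nat_mul]; push_cast; ring_nf
  rw [e1, e2]
  calc _ ≤ ((1 + ‖x‖) ^ 2 * (C * (‖x‖ ^ (-(1 / 2) : ℝ) * Real.exp (-(z.im * ‖x‖))))) ^ 2 := by
        gcongr; exact hb x hx
    _ = _ := by ring

end green

theorem one_add_norm_sq_rpow_pos (x : Plane) (s : ℝ) : 0 < (1 + ‖x‖ ^ 2) ^ s := by positivity

theorem one_add_norm_sq_rpow_le {s : ℝ} (hs : s ≤ 2) (x : Plane) :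
    (1 + ‖x‖ ^ 2) ^ (s / 2) ≤ (1 + ‖x‖) ^ 2 := by
  have h1 : (1 + ‖x‖ ^ 2) ^ (s / 2) ≤ (1 + ‖x‖ ^ 2) ^ (1 : ℝ) :=
    Real.rpow_le_rpow_of_exponent_le (by nlinarith [sq_nonneg ‖x‖]) (by linarith)
  rw [Real.rpow_one] at h1
  nlinarith [norm_nonneg x]

/-- Removal of the weight: `u = ⟨x⟩^s (⟨x⟩^{-s} u)`. -/
theorem eq_mul_weighted (s : ℝ) (u : Plane → ℂ) (x : Plane) :
    u x = (((1 + ‖x‖ ^ 2) ^ (s / 2) : ℝ) : ℂ) * weighted (-s) u x := by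
  rw [weighted, ← mul_assoc, ← Complex.ofReal_mul, ← Real.rpow_add (by positivity)]
  rw [show s / 2 + -s / 2 = 0 by ring, Real.rpow_zero, Complex.ofReal_one, one_mul]

theorem measurable_one_add_norm_sq_rpow (s : ℝ) :
    Measurable fun x : Plane => (((1 + ‖x‖ ^ 2) ^ s : ℝ) : ℂ) :=
  Complex.measurable_ofReal.comp (by fun_prop)

theorem aestronglyMeasurable_of_weighted {s : ℝ} {u : Plane → ℂ}
    (h : AEStronglyMeasurable (weighted (-s) u)) : AEStronglyMeasurable u := by
  have := (measurable_one_add_norm_sq_rpow (s / 2)).aestronglyMeasurable.mul h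
  exact this.congr (Eventually.of_forall fun x => (eq_mul_weighted s u x).symm)

theorem AEStronglyMeasurable.weighted {s : ℝ} {u : Plane → ℂ}
    (h : AEStronglyMeasurable u) : AEStronglyMeasurable (weighted s u) :=
  (measurable_one_add_norm_sq_rpow (s / 2)).aestronglyMeasurable.mul h

/-- A kernel in `L²((1 + |x|)⁴ dx)` translated to `x` and multiplied by the weight dual to
`L²_{-σ}` remains square integrable. -/
theorem SqDecay.memLp_translate {K : Plane → ℂ} (hK : SqDecay K) {σ : ℝ} (hσ : σ ≤ 2)
    (x : Plane) :
    MemLp (fun y => (((1 + ‖y‖ ^ 2) ^ (σ / 2) : ℝ) : ℂ) * K (x - y)) 2 volume := by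
  have hmp := (Measure.measurePreserving_sub_left (volume : Measure Plane) x)
  have h1 := hK.comp_measurePreserving hmp
  refine h1.of_le_mul (c := (1 + ‖x‖) ^ 2) ?_ ?_
  · have hm : AEStronglyMeasurable (fun y : Plane => K (x - y)) := by
      have h2 : AEStronglyMeasurable (fun y : Plane => (((1 + ‖x - y‖) ^ 2 : ℝ) : ℂ)⁻¹) := by
        refine Continuous.aestronglyMeasurable (Continuous.inv₀ (by fun_prop) fun y => ?_)
        exact_mod_cast (by positivity : ((1 + ‖x - y‖) ^ 2 : ℝ) ≠ 0)
      refine (h2.mul h1.aestronglyMeasurable).congr (Eventually.of_forall fun y => ?_)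
      have h3 : ((((1 + ‖x - y‖) ^ 2 : ℝ)) : ℂ) ≠ 0 := by
        exact_mod_cast (by positivity : ((1 + ‖x - y‖) ^ 2 : ℝ) ≠ 0)
      simp only [Pi.mul_apply, Function.comp]
      rw [inv_mul_cancel_left₀ h3]
    exact (measurable_one_add_norm_sq_rpow (σ / 2)).aestronglyMeasurable.mul hm
  · refine Eventually.of_forall fun y => ?_
    simp only [Function.comp]
    rw [norm_mul, norm_mul, Complex.norm_real, Complex.norm_real,
      Real.norm_of_nonneg (by positivity), Real.norm_of_nonneg (by positivity), ← mul_assoc]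
    gcongr
    calc _ ≤ (1 + ‖y‖) ^ 2 := one_add_norm_sq_rpow_le hσ y
      _ ≤ ((1 + ‖x‖) * (1 + ‖x - y‖)) ^ 2 := by gcongr; exact one_add_norm_le_mul x y
      _ = _ := by ring

theorem SqDecay.integrable_mul {K : Plane → ℂ} (hK : SqDecay K) {σ : ℝ} (hσ : σ ≤ 2)
    {f : Plane → ℂ} (hf : MemWeighted (-σ) f) (x : Plane) :
    Integrable fun y => K (x - y) * f y := by
  refine ((hK.memLp_translate hσ x).integrable_mul hf).congr (Eventually.of_forall fun y => ?_)
  simp only [Pi.mul_apply]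
  rw [eq_mul_weighted σ f y]; ring

/-- By the Cauchy-Schwarz inequality, the value of `K * f` at a point is bounded on `L²_{-σ}`. -/
theorem SqDecay.enorm_integral_le {K : Plane → ℂ} (hK : SqDecay K) {σ : ℝ} (hσ : σ ≤ 2)
    (x : Plane) : ∃ C : ENNReal, C ≠ ⊤ ∧ ∀ f : Plane → ℂ, AEStronglyMeasurable f →
      ‖∫ y, K (x - y) * f y‖ₑ ≤ C * eLpNorm (weighted (-σ) f) 2 volume := by
  have h1 := hK.memLp_translate hσ x
  refine ⟨_, h1.eLpNorm_ne_top, fun f hf => ?_⟩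
  refine (enorm_integral_le_lintegral_enorm _).trans ?_
  rw [← eLpNorm_one_eq_lintegral_enorm]
  have h2 := eLpNorm_smul_le_mul_eLpNorm (p := 2) (q := 2) (r := 1)
    (AEStronglyMeasurable.weighted (s := -σ) hf) h1.aestronglyMeasurable
  refine le_trans (le_of_eq ?_) h2
  refine eLpNorm_congr_ae (Eventually.of_forall fun y => ?_)
  simp only [Pi.smul_apply', smul_eq_mul]
  rw [eq_mul_weighted σ f y]; ring

theorem memWeighted_const {σ : ℝ} (hσ : 1 < σ) (c : ℂ) : MemWeighted (-σ) fun _ => c := by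
  refine (memLp_two_iff_integrable_sq_norm
    (AEStronglyMeasurable.weighted aestronglyMeasurable_const)).2 ?_
  have h := integrable_rpow_neg_one_add_norm_sq (E := Plane) (μ := volume) (r := 2 * σ)
    (by simp; linarith)
  refine (h.mul_const (‖c‖ ^ 2)).congr (Eventually.of_forall fun x => ?_)
  simp only [weighted]
  rw [norm_mul, Complex.norm_real, Real.norm_of_nonneg (by positivity), mul_pow,
    ← Real.rpow_natCast ((1 + ‖x‖ ^ 2) ^ (-σ / 2)) 2, ← Real.rpow_mul (by positivity)]
  congr 2
  push_cast; ring

theorem memLp_weight_mul_log {σ : ℝ} (hσ : 1 < σ) (hσ2 : σ < 2) :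
    MemLp (fun x : Plane => ((((1 + ‖x‖) ^ 2) ^ (-σ / 2) : ℝ) : ℂ) * (Real.log ‖x‖ : ℂ)) 2
      volume := by
  have hm : AEStronglyMeasurable
      (fun x : Plane => ((((1 + ‖x‖) ^ 2) ^ (-σ / 2) : ℝ) : ℂ) * (Real.log ‖x‖ : ℂ)) :=
    (by fun_prop : Measurable _).aestronglyMeasurable
  refine (memLp_two_iff_integrable_sq_norm hm).2 ?_
  refine (integrable_radial_iff (k := fun r : ℝ =>
    ‖((((1 + r) ^ 2) ^ (-σ / 2) : ℝ) : ℂ) * (Real.log r : ℂ)‖ ^ 2)).2 ?_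
  -- bounding `|log r|` by `r^ε + r^{-ε}` keeps both `r^{1 ± 2ε}` below `(1 + r)^σ`
  set ε : ℝ := (σ - 1) / 2 with hε
  have hε0 : 0 < ε := by rw [hε]; linarith
  have h := (integrable_one_add_norm (E := ℝ) (μ := volume) (r := σ)
    (by simpa using hσ)).integrableOn (s := Ioi 0)
  refine (h.const_mul (4 * ε⁻¹ ^ 2)).mono' ?_ ?_
  · exact (by fun_prop : Measurable _).aestronglyMeasurable
  · filter_upwards [ae_restrict_mem measurableSet_Ioi] with r (hr : 0 < r)
    have h0 : ‖((((1 + r) ^ 2) ^ (-σ / 2) : ℝ) : ℂ) * (Real.log r : ℂ)‖ =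
        ((1 + r) ^ 2) ^ (-σ / 2) * |Real.log r| := by
      rw [norm_mul, Complex.norm_real, Complex.norm_real, Real.norm_eq_abs (Real.log r),
        Real.norm_of_nonneg (by positivity)]
    rw [smul_eq_mul, h0, Real.norm_of_nonneg (by positivity), Real.norm_of_nonneg hr.le]
    have h1 := abs_log_le_rpow_add_rpow hε0 hr
    have h2 : |Real.log r| ^ 2 ≤ ε⁻¹ ^ 2 * (2 * (r ^ (2 * ε) + r ^ (-(2 * ε)))) := by
      have e1 : r ^ (2 * ε) = (r ^ ε) ^ 2 := by
        rw [← Real.rpow_natCast, ← Real.rpow_mul hr.le]; push_cast; ring_nf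
      have e2 : r ^ (-(2 * ε)) = (r ^ (-ε)) ^ 2 := by
        rw [← Real.rpow_natCast, ← Real.rpow_mul hr.le]; push_cast; ring_nf
      rw [e1, e2]
      calc |Real.log r| ^ 2 ≤ (ε⁻¹ * (r ^ ε + r ^ (-ε))) ^ 2 := by gcongr
        _ = ε⁻¹ ^ 2 * (r ^ ε + r ^ (-ε)) ^ 2 := by ring
        _ ≤ _ := by gcongr; nlinarith [sq_nonneg (r ^ ε - r ^ (-ε))]
    have h3 : r * r ^ (2 * ε) ≤ (1 + r) ^ σ := by
      rw [← Real.rpow_one_add' hr.le (by linarith), show 1 + 2 * ε = σ by rw [hε]; ring]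
      gcongr; linarith
    have h4 : r * r ^ (-(2 * ε)) ≤ (1 + r) ^ σ := by
      rw [← Real.rpow_one_add' hr.le (by rw [hε]; linarith)]
      calc r ^ (1 + -(2 * ε)) ≤ (1 + r) ^ (1 + -(2 * ε)) := by
            apply Real.rpow_le_rpow hr.le (by linarith); rw [hε]; linarith
        _ ≤ _ := Real.rpow_le_rpow_of_exponent_le (by linarith) (by rw [hε]; linarith)
    have h5 : (((1 + r) ^ 2) ^ (-σ / 2)) ^ 2 = (1 + r) ^ (-σ) * (1 + r) ^ (-σ) := by
      have h0 : (0 : ℝ) ≤ 1 + r := by linarith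
      rw [← Real.rpow_natCast (1 + r), ← Real.rpow_mul h0, sq]
      push_cast
      rw [show 2 * (-σ / 2) = -σ by ring]
    have h6 : (1 + r) ^ (-σ) * (1 + r) ^ σ = 1 := by
      rw [← Real.rpow_add (by linarith)]; simp
    rw [mul_pow, h5]
    have h7 : 0 < (1 + r) ^ (-σ) := by positivity
    calc r * ((1 + r) ^ (-σ) * (1 + r) ^ (-σ) * |Real.log r| ^ 2)
        ≤ r * ((1 + r) ^ (-σ) * (1 + r) ^ (-σ) *
          (ε⁻¹ ^ 2 * (2 * (r ^ (2 * ε) + r ^ (-(2 * ε)))))) := by gcongr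
      _ = (2 * ε⁻¹ ^ 2) * ((1 + r) ^ (-σ) * (1 + r) ^ (-σ)) *
          (r * r ^ (2 * ε) + r * r ^ (-(2 * ε))) := by ring
      _ ≤ (2 * ε⁻¹ ^ 2) * ((1 + r) ^ (-σ) * (1 + r) ^ (-σ)) * ((1 + r) ^ σ + (1 + r) ^ σ) := by
          gcongr
      _ = 4 * ε⁻¹ ^ 2 * (1 + r) ^ (-σ) * ((1 + r) ^ (-σ) * (1 + r) ^ σ) := by ring
      _ = _ := by rw [h6, mul_one]

theorem memWeighted_log {σ : ℝ} (hσ : 1 < σ) (hσ2 : σ < 2) (y : Plane) :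
    MemWeighted (-σ) fun x => (Real.log ‖x - y‖ : ℂ) := by
  have hmp := (measurePreserving_sub_right (volume : Measure Plane) y)
  have h1 := (memLp_weight_mul_log hσ hσ2).comp_measurePreserving hmp
  refine h1.of_le_mul (c := (2 * (1 + ‖y‖) ^ 2) ^ (σ / 2)) ?_ ?_
  · refine AEStronglyMeasurable.weighted ?_
    exact (by fun_prop : Measurable _).aestronglyMeasurable
  · refine Eventually.of_forall fun x => ?_
    simp only [Function.comp, weighted]
    simp only [norm_mul, Complex.norm_real]
    rw [Real.norm_of_nonneg (by positivity : (0 : ℝ) ≤ (1 + ‖x‖ ^ 2) ^ (-σ / 2)),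
      Real.norm_of_nonneg (by positivity : (0 : ℝ) ≤ ((1 + ‖x - y‖) ^ 2) ^ (-σ / 2)), ← mul_assoc]
    refine mul_le_mul_of_nonneg_right ?_ (norm_nonneg _)
    have h2 : (1 + ‖x - y‖) ^ 2 ≤ 2 * (1 + ‖y‖) ^ 2 * (1 + ‖x‖ ^ 2) := by
      have h3 : 1 + ‖x - y‖ ≤ (1 + ‖y‖) * (1 + ‖x‖) := by
        have := one_add_norm_le_mul y (y - x)
        rwa [sub_sub_cancel, norm_sub_rev] at this
      calc _ ≤ ((1 + ‖y‖) * (1 + ‖x‖)) ^ 2 := by gcongr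
        _ = (1 + ‖y‖) ^ 2 * (1 + ‖x‖) ^ 2 := by ring
        _ ≤ (1 + ‖y‖) ^ 2 * (2 * (1 + ‖x‖ ^ 2)) := by
          gcongr; nlinarith [sq_nonneg (1 - ‖x‖)]
        _ = _ := by ring
    rw [neg_div, Real.rpow_neg (by positivity), Real.rpow_neg (by positivity),
      ← div_eq_mul_inv, inv_eq_one_div, div_le_div_iff₀ (by positivity) (by positivity), one_mul,
      ← Real.mul_rpow (by positivity) (by positivity)]
    gcongr

theorem MemWeighted.add {s : ℝ} {u v : Plane → ℂ} (hu : MemWeighted s u) (hv : MemWeighted s v) :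
    MemWeighted s fun x => u x + v x := by
  refine (MemLp.add hu hv).ae_eq (Eventually.of_forall fun x => ?_)
  simp [weighted, mul_add]

theorem MemWeighted.const_mul {s : ℝ} {u : Plane → ℂ} (hu : MemWeighted s u) (c : ℂ) :
    MemWeighted s fun x => c * u x := by
  refine (MemLp.const_mul hu c).ae_eq (Eventually.of_forall fun x => ?_)
  simp only [weighted]; ring

theorem MemWeighted.sum {ι : Type*} {s : ℝ} {t : Finset ι} {u : ι → Plane → ℂ}
    (hu : ∀ i ∈ t, MemWeighted s (u i)) : MemWeighted s fun x => ∑ i ∈ t, u i x := by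
  refine (memLp_finsetSum t hu).ae_eq (Eventually.of_forall fun x => ?_)
  simp [weighted, Finset.mul_sum]

/-! ### Convolution of the Green function with the logarithm -/

/-- The fundamental solution `-(1/2π) log |x|` of `-Δ`. -/
noncomputable def logKernel (x : Plane) : ℂ := -(1 / (2 * Real.pi)) * (Real.log ‖x‖ : ℂ)

theorem logKernel_neg (x : Plane) : logKernel (-x) = logKernel x := by
  simp [logKernel]

theorem green_neg (z : ℂ) (x : Plane) : green z (-x) = green z x := by
  simp [green]

theorem memWeighted_logKernel {σ : ℝ} (hσ : 1 < σ) (hσ2 : σ < 2) (y : Plane) :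
    MemWeighted (-σ) fun x => logKernel (x - y) :=
  (memWeighted_log hσ hσ2 y).const_mul _

theorem two_pi_ne_zero : (2 * Real.pi : ℂ) ≠ 0 := by
  exact_mod_cast (by positivity : (2 * Real.pi : ℝ) ≠ 0)

section
variable {z : ℂ}

theorem neg_I_mul_sq (z : ℂ) : (-Complex.I * z) ^ 2 = -z ^ 2 := by
  rw [mul_pow, neg_sq, Complex.I_sq]; ring

theorem re_neg_I_mul_pos (hz : 0 < z.im) : 0 < (-Complex.I * z).re := by rwa [re_neg_I_mul]

/-- `∫ 𝒢_z = -1/z²`. -/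
theorem integral_green (hz : 0 < z.im) : -z ^ 2 * ∫ x, green z x = 1 := by
  rw [integral_congr_ae (green_ae_eq hz),
    integral_radial (fun r => macdonald (-Complex.I * z) r / (2 * Real.pi))]
  have h := integral_mul_macdonald (re_neg_I_mul_pos hz)
  rw [neg_I_mul_sq] at h
  have h2 : ∫ r in Ioi (0 : ℝ), (r : ℂ) * (macdonald (-Complex.I * z) r / (2 * Real.pi)) =
      (∫ r in Ioi (0 : ℝ), (r : ℂ) * macdonald (-Complex.I * z) r) / (2 * Real.pi) := by
    rw [← integral_div]
    congr 1; ext r; ring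
  rw [h2, mul_div_cancel₀ _ two_pi_ne_zero, h]

theorem integrable_green_mul_logKernel (hz : 0 < z.im) (x : Plane) :
    Integrable fun y => green z y * logKernel (x - y) := by
  have h := (sqDecay_green hz).integrable_mul (σ := 3 / 2) (by norm_num)
    (memWeighted_logKernel (by norm_num) (by norm_num) x) 0
  refine h.congr (Eventually.of_forall fun y => ?_)
  simp only
  rw [zero_sub, green_neg, ← logKernel_neg, neg_sub]

theorem integral_green_mul_logKernel_eq (hz : 0 < z.im) (x : Plane) :
    ∫ y, green z y * logKernel (x - y) = -(1 / (2 * Real.pi)) *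
      ∫ r in Ioi (0 : ℝ), (r : ℂ) * macdonald (-Complex.I * z) r *
        (Real.log (max ‖x‖ r) : ℂ) := by
  have hlam := re_neg_I_mul_pos hz
  set c : ℂ := -(1 / (2 * Real.pi)) * (1 / (2 * Real.pi)) with hc
  have hae : (fun y => green z y * logKernel (x - y)) =ᵐ[volume] fun y =>
      c * (macdonald (-Complex.I * z) ‖y‖ * (Real.log ‖x - y‖ : ℂ)) := by
    filter_upwards [green_ae_eq hz] with y hy
    rw [hy, logKernel, hc]; ring
  have hc0 : c ≠ 0 := by
    rw [hc]
    have := two_pi_ne_zero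
    have h1 := one_div_ne_zero this
    exact mul_ne_zero (neg_ne_zero.2 h1) h1
  have hi : Integrable fun y : Plane =>
      macdonald (-Complex.I * z) ‖y‖ * (Real.log ‖x - y‖ : ℂ) := by
    have := ((integrable_green_mul_logKernel hz x).congr hae).const_mul c⁻¹
    refine this.congr (Eventually.of_forall fun y => ?_)
    simp only
    rw [inv_mul_cancel_left₀ hc0]
  rw [integral_congr_ae hae, integral_const_mul,
    integral_radial_mul_log (aestronglyMeasurable_macdonald_norm hlam) hi, hc]
  have := two_pi_ne_zero
  field_simp

/-- `-z² 𝒢 * E = E - 𝒢` away from the origin, where `E` is the fundamental solution of `-Δ`. -/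
theorem integral_green_mul_logKernel (hz : 0 < z.im) {x : Plane} (hx : x ≠ 0) :
    -z ^ 2 * ∫ y, green z y * logKernel (x - y) = logKernel x - green z x := by
  have h := integral_mul_macdonald_mul_log_max (re_neg_I_mul_pos hz) (norm_pos_iff.2 hx)
  rw [neg_I_mul_sq] at h
  rw [integral_green_mul_logKernel_eq hz, green_eq_macdonald hz hx, logKernel, mul_left_comm, h]
  ring

theorem macdonaldConst_eq (hz : 0 < z.im) :
    macdonaldConst (-Complex.I * z) = 2 * Real.pi * gCoeff z := by
  have hz0 : z ≠ 0 := fun h => by simp [h] at hz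
  have h1 : Complex.log (-Complex.I * z) = Complex.log z - Real.pi / 2 * Complex.I := by
    rw [Complex.log_mul (by simp) hz0, Complex.log_neg_I]
    · ring
    · rw [Complex.arg_neg_I]
      have := Complex.arg_lt_pi_iff.2 (Or.inr hz.ne')
      have h2 : 0 ≤ z.arg := Complex.arg_nonneg_iff.2 hz.le
      have := Complex.arg_le_pi z
      have := Real.pi_pos
      constructor <;> linarith
  have h2 : Complex.log (z / 2) = Complex.log z - Real.log 2 := by
    have h3 : z / 2 = ((1 / 2 : ℝ) : ℂ) * z := by push_cast; ring
    rw [h3, Complex.log_ofReal_mul (by norm_num) hz0, one_div, Real.log_inv]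
    push_cast; ring
  rw [macdonaldConst, gCoeff, h1, h2]
  have : (Real.pi : ℂ) ≠ 0 := by exact_mod_cast Real.pi_ne_zero
  field_simp
  ring

/-- `-z² (𝒢 * E)(0) = -g(z)`: the regular part of `E - 𝒢` at the origin. -/
theorem integral_green_mul_logKernel_zero (hz : 0 < z.im) :
    -z ^ 2 * ∫ y, green z y * logKernel (0 - y) = -gCoeff z := by
  have h := integral_mul_macdonald_mul_log (re_neg_I_mul_pos hz)
  rw [neg_I_mul_sq, macdonaldConst_eq hz] at h
  have h2 : ∫ r in Ioi (0 : ℝ), (r : ℂ) * macdonald (-Complex.I * z) r *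
      (Real.log (max ‖(0 : Plane)‖ r) : ℂ) = ∫ r in Ioi (0 : ℝ),
      (r : ℂ) * macdonald (-Complex.I * z) r * (Real.log r : ℂ) := by
    refine setIntegral_congr_fun measurableSet_Ioi fun r (hr : 0 < r) => ?_
    rw [norm_zero, max_eq_right hr.le]
  rw [integral_green_mul_logKernel_eq hz, h2, mul_left_comm, h]
  have := two_pi_ne_zero
  field_simp

end

/-! ### Convolution on weighted spaces -/

/-- Convolution of complex functions on the plane. -/
noncomputable def conv (K f : Plane → ℂ) (x : Plane) : ℂ := ∫ t, K t * f (x - t)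

/-- Absolute convergence of the convolution integral at `x`. -/
def ConvAt (K f : Plane → ℂ) (x : Plane) : Prop := Integrable fun t => K t * f (x - t)

/-- Integrability against a weight. -/
def WInt (w : Plane → ℝ) (f : Plane → ℂ) : Prop := Integrable fun x => (w x : ℂ) * f x

/-- The growing weight `(1 + |x|)⁴`; functions integrable against it serve as kernels. -/
noncomputable def growWeight (x : Plane) : ℝ := (1 + ‖x‖) ^ 4

/-- The decaying weight `(1 + |x|)⁻⁴`; all of `L²_{-σ}`, `σ ≤ 2`, is integrable against it. -/
noncomputable def decayWeight (x : Plane) : ℝ := ((1 + ‖x‖) ^ 4)⁻¹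

/-- A positive continuous weight which translations distort at most by the factor `growWeight`. -/
structure Moderate (w : Plane → ℝ) : Prop where
  continuous : Continuous w
  pos : ∀ x, 0 < w x
  le_mul : ∀ x t, w x ≤ growWeight t * w (x - t)

theorem moderate_growWeight : Moderate growWeight where
  continuous := by unfold growWeight; fun_prop
  pos x := by unfold growWeight; positivity
  le_mul x t := by
    unfold growWeight
    rw [← mul_pow]
    gcongr
    have := one_add_norm_le_mul t x
    rwa [norm_sub_rev t x] at this

theorem moderate_decayWeight : Moderate decayWeight where
  continuous := by
    unfold decayWeight
    exact Continuous.inv₀ (by fun_prop) fun x => by positivity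
  pos x := by unfold decayWeight; positivity
  le_mul x t := by
    unfold decayWeight growWeight
    rw [← div_eq_mul_inv, inv_eq_one_div, div_le_div_iff₀ (by positivity) (by positivity), one_mul,
      ← mul_pow]
    gcongr
    have := one_add_norm_le_mul t (t - x)
    rwa [sub_sub_cancel, norm_sub_rev t x] at this

section
variable {w : Plane → ℝ} {K f g : Plane → ℂ}

theorem WInt.aestronglyMeasurable (hw : Moderate w) (hf : WInt w f) :
    AEStronglyMeasurable f := by
  have h2 : AEStronglyMeasurable (fun x : Plane => (w x : ℂ)⁻¹) := by
    refine Continuous.aestronglyMeasurable (Continuous.inv₀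
      (Complex.continuous_ofReal.comp hw.continuous) fun y => ?_)
    simpa using (hw.pos y).ne'
  refine (h2.mul (Integrable.aestronglyMeasurable hf)).congr (Eventually.of_forall fun y => ?_)
  have h3 : (w y : ℂ) ≠ 0 := by exact_mod_cast (hw.pos y).ne'
  simp only [Pi.mul_apply]
  rw [inv_mul_cancel_left₀ h3]

theorem aestronglyMeasurable_convolution_integrand (hK : AEStronglyMeasurable K)
    (hf : AEStronglyMeasurable f) (x : Plane) :
    AEStronglyMeasurable (fun t => K t * f (x - t)) :=
  AEStronglyMeasurable.convolution_integrand_snd (ContinuousLinearMap.mul ℂ ℂ) hK hf x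

theorem aestronglyMeasurable_conv (hK : AEStronglyMeasurable K)
    (hf : AEStronglyMeasurable f) : AEStronglyMeasurable (conv K f) :=
  (AEStronglyMeasurable.convolution_integrand (ContinuousLinearMap.mul ℂ ℂ) hK
    hf).integral_prod_right'

theorem weight_mul_norm_le (hw : Moderate w) (x t : Plane) :
    w x * ‖K t * f (x - t)‖ ≤
      ‖(growWeight t : ℂ) * K t‖ * ‖(w (x - t) : ℂ) * f (x - t)‖ := by
  rw [norm_mul, norm_mul, norm_mul, Complex.norm_real, Complex.norm_real,
    Real.norm_of_nonneg (moderate_growWeight.pos t).le, Real.norm_of_nonneg (hw.pos _).le]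
  calc _ ≤ (growWeight t * w (x - t)) * (‖K t‖ * ‖f (x - t)‖) := by
        gcongr; exact hw.le_mul x t
    _ = _ := by ring

theorem WInt.ae_majorant (hK : WInt growWeight K) (hf : WInt w f) :
    ∀ᵐ x, Integrable fun t =>
      ‖(growWeight t : ℂ) * K t‖ * ‖(w (x - t) : ℂ) * f (x - t)‖ := by
  have h : ∀ᵐ x, ConvolutionExistsAt (fun t => ‖(growWeight t : ℂ) * K t‖)
      (fun t => ‖(w t : ℂ) * f t‖) x (ContinuousLinearMap.mul ℝ ℝ) volume :=
    Integrable.ae_convolution_exists _ (Integrable.norm hK) (Integrable.norm hf)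
  exact h

theorem WInt.ae_convAt (hw : Moderate w) (hK : WInt growWeight K) (hf : WInt w f) :
    ∀ᵐ x, ConvAt K f x := by
  filter_upwards [WInt.ae_majorant hK hf] with x hx
  refine (hx.const_mul (w x)⁻¹).mono'
    (aestronglyMeasurable_convolution_integrand (hK.aestronglyMeasurable moderate_growWeight)
      (hf.aestronglyMeasurable hw) x) (Eventually.of_forall fun t => ?_)
  rw [le_inv_mul_iff₀ (hw.pos x)]
  exact weight_mul_norm_le hw x t

theorem WInt.norm_conv_le (hw : Moderate w) (hK : WInt growWeight K) (hf : WInt w f) :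
    ∀ᵐ x, ‖(w x : ℂ) * conv K f x‖ ≤ ∫ t,
      ‖(growWeight t : ℂ) * K t‖ * ‖(w (x - t) : ℂ) * f (x - t)‖ := by
  filter_upwards [WInt.ae_majorant hK hf] with x hx
  rw [conv, ← integral_const_mul]
  refine norm_integral_le_of_norm_le hx (Eventually.of_forall fun t => ?_)
  rw [norm_mul, Complex.norm_real, Real.norm_of_nonneg (hw.pos x).le]
  exact weight_mul_norm_le hw x t

theorem WInt.conv (hw : Moderate w) (hK : WInt growWeight K) (hf : WInt w f) :
    WInt w (conv K f) := by
  have h := Integrable.integrable_convolution (ContinuousLinearMap.mul ℝ ℝ) (Integrable.norm hK)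
    (Integrable.norm hf)
  refine Integrable.mono' h ?_ (WInt.norm_conv_le hw hK hf)
  exact (Complex.continuous_ofReal.comp hw.continuous).aestronglyMeasurable.mul
    (aestronglyMeasurable_conv (hK.aestronglyMeasurable moderate_growWeight)
      (hf.aestronglyMeasurable hw))

theorem conv_comm (K f : Plane → ℂ) : conv K f = conv f K := by
  ext x
  rw [conv, ← integral_sub_left_eq_self _ volume x]
  simp only [sub_sub_cancel, conv, mul_comm]

theorem conv_eq_integral (K f : Plane → ℂ) (x : Plane) : conv K f x = ∫ y, K (x - y) * f y := by
  rw [conv, ← integral_sub_left_eq_self _ volume x]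
  simp only [sub_sub_cancel]

theorem conv_congr_right (h : f =ᵐ[volume] g) (K : Plane → ℂ) : conv K f = conv K g := by
  ext x
  rw [conv_eq_integral, conv_eq_integral]
  refine integral_congr_ae ?_
  filter_upwards [h] with y hy
  rw [hy]

theorem conv_congr_left (h : f =ᵐ[volume] g) (K : Plane → ℂ) : conv f K = conv g K := by
  rw [conv_comm, conv_congr_right h, conv_comm]

theorem WInt.norm (hf : WInt w f) (hw : Moderate w) : WInt w fun x => (‖f x‖ : ℂ) := by
  refine (Integrable.norm hf).ofReal.congr (Eventually.of_forall fun x => ?_)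
  simp [abs_of_pos (hw.pos x)]

theorem WInt.congr (hf : WInt w f) (h : f =ᵐ[volume] g) : WInt w g := by
  refine Integrable.congr hf ?_
  filter_upwards [h] with x hx
  rw [hx]

theorem WInt.add (hf : WInt w f) (hg : WInt w g) : WInt w fun x => f x + g x := by
  refine (Integrable.add hf hg).congr (Eventually.of_forall fun x => ?_)
  simp [mul_add]

theorem WInt.const_mul (hf : WInt w f) (c : ℂ) : WInt w fun x => c * f x := by
  refine (Integrable.const_mul hf c).congr (Eventually.of_forall fun x => ?_)
  simp only; ring

theorem WInt.sub (hf : WInt w f) (hg : WInt w g) : WInt w fun x => f x - g x := by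
  refine (hf.add (hg.const_mul (-1))).congr (Eventually.of_forall fun x => ?_)
  simp only; ring

theorem conv_const_mul_left (c : ℂ) (K f : Plane → ℂ) (x : Plane) :
    conv (fun t => c * K t) f x = c * conv K f x := by
  rw [conv, conv, ← integral_const_mul]
  simp only [mul_assoc]

theorem conv_const_mul_right (c : ℂ) (K f : Plane → ℂ) (x : Plane) :
    conv K (fun t => c * f t) x = c * conv K f x := by
  rw [conv_comm, conv_const_mul_left, conv_comm]

theorem conv_add_right {x : Plane} (hf : ConvAt K f x) (hg : ConvAt K g x) :
    conv K (fun t => f t + g t) x = conv K f x + conv K g x := by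
  rw [conv, conv, conv, ← integral_add hf hg]
  simp only [mul_add]

theorem conv_sub_right {x : Plane} (hf : ConvAt K f x) (hg : ConvAt K g x) :
    conv K (fun t => f t - g t) x = conv K f x - conv K g x := by
  rw [conv, conv, conv, ← integral_sub hf hg]
  simp only [mul_sub]

theorem conv_add_left {x : Plane} (hf : ConvAt f K x) (hg : ConvAt g K x) :
    conv (fun t => f t + g t) K x = conv f K x + conv g K x := by
  rw [conv, conv, conv, ← integral_add hf hg]
  simp only [add_mul]

theorem conv_sub_left {x : Plane} (hf : ConvAt f K x) (hg : ConvAt g K x) :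
    conv (fun t => f t - g t) K x = conv f K x - conv g K x := by
  rw [conv, conv, conv, ← integral_sub hf hg]
  simp only [sub_mul]

/-- Associativity of the convolution of two kernels with a tempered function. -/
theorem conv_assoc_ae {K₁ K₂ : Plane → ℂ} (hw : Moderate w) (h₁ : WInt growWeight K₁)
    (h₂ : WInt growWeight K₂) (hf : WInt w f) :
    conv (conv K₁ K₂) f =ᵐ[volume] conv K₁ (conv K₂ f) := by
  have hN := WInt.conv hw (h₂.norm moderate_growWeight) (hf.norm hw)
  filter_upwards [WInt.ae_convAt hw h₁ hN] with x hx
  refine convolution_assoc (L := ContinuousLinearMap.mul ℂ ℂ) (L₂ := ContinuousLinearMap.mul ℂ ℂ)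
    (L₃ := ContinuousLinearMap.mul ℂ ℂ) (L₄ := ContinuousLinearMap.mul ℂ ℂ)
    (fun a b c => by simp [mul_assoc]) (h₁.aestronglyMeasurable moderate_growWeight)
    (h₂.aestronglyMeasurable moderate_growWeight) (hf.aestronglyMeasurable hw)
    (WInt.ae_convAt moderate_growWeight h₁ h₂) ?_ ?_
  · filter_upwards [WInt.ae_convAt hw h₂ hf] with y hy
    refine (Integrable.norm hy).congr (Eventually.of_forall fun t => ?_)
    simp
  · refine (Integrable.norm hx).congr (Eventually.of_forall fun t => ?_)
    have e1 : conv (fun x => (‖K₂ x‖ : ℂ)) (fun x => (‖f x‖ : ℂ)) (x - t) =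
        ((∫ s, ‖K₂ s‖ * ‖f (x - t - s)‖ : ℝ) : ℂ) := by
      rw [conv, ← integral_complex_ofReal]
      simp only [Complex.ofReal_mul]
    simp only
    rw [norm_mul, e1, Complex.norm_real, Real.norm_of_nonneg
      (integral_nonneg fun s => by positivity)]
    rfl

end

theorem memLp_decayWeight_mul {σ : ℝ} (hσ : σ ≤ 2) :
    MemLp (fun x : Plane => ((decayWeight x * (1 + ‖x‖ ^ 2) ^ (σ / 2) : ℝ) : ℂ)) 2 volume := by
  have hm : AEStronglyMeasurable
      (fun x : Plane => ((decayWeight x * (1 + ‖x‖ ^ 2) ^ (σ / 2) : ℝ) : ℂ)) := by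
    simp only [Complex.ofReal_mul]
    exact (Complex.continuous_ofReal.comp
      moderate_decayWeight.continuous).aestronglyMeasurable.mul
      (measurable_one_add_norm_sq_rpow (σ / 2)).aestronglyMeasurable
  refine (memLp_two_iff_integrable_sq_norm hm).2 ?_
  have h := integrable_one_add_norm (E := Plane) (μ := volume) (r := 4) (by norm_num)
  refine h.mono' (hm.norm.pow 2) (Eventually.of_forall fun x => ?_)
  have hp := moderate_decayWeight.pos x
  rw [Real.norm_of_nonneg (by positivity), Complex.norm_real, Real.norm_of_nonneg (by positivity)]
  have h2 := one_add_norm_sq_rpow_le hσ x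
  rw [Real.rpow_neg (by positivity), show (4 : ℝ) = (4 : ℕ) by norm_num, Real.rpow_natCast]
  calc (decayWeight x * (1 + ‖x‖ ^ 2) ^ (σ / 2)) ^ 2
      ≤ (decayWeight x * (1 + ‖x‖) ^ 2) ^ 2 := by gcongr
    _ = _ := by
      rw [decayWeight]
      have : (1 + ‖x‖) ≠ 0 := by positivity
      field_simp

theorem decayWeight_mul_eq (σ : ℝ) (f : Plane → ℂ) (x : Plane) :
    (decayWeight x : ℂ) * f x =
      ((decayWeight x * (1 + ‖x‖ ^ 2) ^ (σ / 2) : ℝ) : ℂ) * weighted (-σ) f x := by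
  conv_lhs => rw [eq_mul_weighted σ f x]
  push_cast; ring

theorem MemWeighted.wInt {σ : ℝ} (hσ : σ ≤ 2) {f : Plane → ℂ} (hf : MemWeighted (-σ) f) :
    WInt decayWeight f :=
  ((memLp_decayWeight_mul hσ).integrable_mul hf).congr
    (Eventually.of_forall fun x => (decayWeight_mul_eq σ f x).symm)

theorem wInt_green {z : ℂ} (hz : 0 < z.im) : WInt growWeight (green z) :=
  integrable_one_add_norm_pow_mul_green hz 4

/-! ### A Liouville theorem -/

/-- The normalized indicator of the disc of radius `R`, as a function of the distance to its
centre. -/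
noncomputable def discProfile (R r : ℝ) : ℂ := if r < R then ((Real.pi * R ^ 2)⁻¹ : ℝ) else 0

/-- The kernel averaging a function over discs of radius `R`. -/
noncomputable def discKernel (R : ℝ) (x : Plane) : ℂ := discProfile R ‖x‖

theorem discKernel_eq_indicator (R : ℝ) : discKernel R =
    (Metric.ball (0 : Plane) R).indicator fun _ => (((Real.pi * R ^ 2)⁻¹ : ℝ) : ℂ) := by
  ext x
  simp [discKernel, discProfile, indicator]

theorem volume_real_ball (x : Plane) {R : ℝ} (hR : 0 ≤ R) :
    (volume : Measure Plane).real (Metric.ball x R) = Real.pi * R ^ 2 := by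
  simp [Measure.real, EuclideanSpace.volume_ball_fin_two, Real.pi_pos.le, hR, mul_comm]

theorem integral_discKernel {R : ℝ} (hR : 0 < R) : ∫ x, discKernel R x = 1 := by
  rw [discKernel_eq_indicator, integral_indicator_const _ measurableSet_ball,
    volume_real_ball 0 hR.le, Complex.real_smul, ← Complex.ofReal_mul,
    mul_inv_cancel₀ (by positivity), Complex.ofReal_one]

theorem memLp_pow_mul_discKernel (R : ℝ) (n : ℕ) (p : ENNReal) :
    MemLp (fun x : Plane => (((1 + ‖x‖) ^ n : ℝ) : ℂ) * discKernel R x) p volume := by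
  have h := memLp_indicator_const (E := ℂ) (μ := (volume : Measure Plane)) p
    (measurableSet_ball (x := 0) (ε := R)) ((((Real.pi * R ^ 2)⁻¹ : ℝ) : ℂ))
    (Or.inr measure_ball_lt_top.ne)
  rw [← discKernel_eq_indicator] at h
  refine h.of_le_mul (c := (1 + R) ^ n) ?_ (Eventually.of_forall fun x => ?_)
  · exact (Continuous.aestronglyMeasurable (by fun_prop)).mul h.aestronglyMeasurable
  · rw [norm_mul, Complex.norm_real, Real.norm_of_nonneg (by positivity)]
    by_cases hx : ‖x‖ < R
    · gcongr
    · simp [discKernel, discProfile, hx]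

theorem wInt_discKernel (R : ℝ) : WInt growWeight (discKernel R) :=
  memLp_one_iff_integrable.1 (memLp_pow_mul_discKernel R 4 1)

theorem sqDecay_discKernel (R : ℝ) : SqDecay (discKernel R) := memLp_pow_mul_discKernel R 2 2

/-- The mean of `log` over a disc not containing the origin is its value at the centre. -/
theorem conv_discKernel_logKernel {R : ℝ} (hR : 0 < R) {x : Plane} (hx : R ≤ ‖x‖) :
    conv (discKernel R) logKernel x = logKernel x := by
  have hi : Integrable fun y : Plane => discProfile R ‖y‖ * (Real.log ‖x - y‖ : ℂ) := by
    have h := (sqDecay_discKernel R).integrable_mul (σ := 3 / 2) (by norm_num)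
      (memWeighted_log (by norm_num) (by norm_num) x) 0
    refine h.congr (Eventually.of_forall fun y => ?_)
    simp [discKernel, norm_sub_rev]
  have hm : AEStronglyMeasurable fun y : Plane => discProfile R ‖y‖ :=
    ((wInt_discKernel R).aestronglyMeasurable moderate_growWeight)
  have h1 := integral_radial_mul_log hm hi
  have h2 : ∫ r in Ioi (0 : ℝ), (r : ℂ) * discProfile R r * (Real.log (max ‖x‖ r) : ℂ) =
      (∫ r in Ioi (0 : ℝ), (r : ℂ) * discProfile R r) * (Real.log ‖x‖ : ℂ) := by
    rw [← integral_mul_const]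
    refine setIntegral_congr_fun measurableSet_Ioi fun r _ => ?_
    by_cases hr : r < R
    · rw [max_eq_left (by linarith)]
    · simp [discProfile, hr]
  have h3 := integral_radial (discProfile R)
  have h4 : ∫ x : Plane, discProfile R ‖x‖ = 1 := integral_discKernel hR
  rw [h2, ← mul_assoc, ← h3, h4, one_mul] at h1
  calc conv (discKernel R) logKernel x = -(1 / (2 * Real.pi)) *
        ∫ y : Plane, discProfile R ‖y‖ * (Real.log ‖x - y‖ : ℂ) := by
        rw [conv, ← integral_const_mul]
        congr 1; ext y
        simp only [logKernel, discKernel]; ring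
    _ = _ := by rw [h1, logKernel]

theorem wInt_logKernel : WInt decayWeight logKernel := by
  have := MemWeighted.wInt (σ := 3 / 2) (by norm_num)
    (memWeighted_logKernel (by norm_num) (by norm_num) 0)
  simpa using this

/-- A tempered function vanishing outside a ball can serve as a convolution kernel. -/
theorem WInt.growWeight_of_eq_zero {f : Plane → ℂ} (hf : WInt decayWeight f) {R : ℝ}
    (h0 : ∀ x, R ≤ ‖x‖ → f x = 0) : WInt growWeight f := by
  have hm := hf.aestronglyMeasurable moderate_decayWeight
  refine (Integrable.const_mul (Integrable.norm hf) ((1 + R) ^ 8)).mono'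
    ((Complex.continuous_ofReal.comp moderate_growWeight.continuous).aestronglyMeasurable.mul hm)
    (Eventually.of_forall fun x => ?_)
  rw [norm_mul, norm_mul, Complex.norm_real, Complex.norm_real,
    Real.norm_of_nonneg (moderate_growWeight.pos x).le,
    Real.norm_of_nonneg (moderate_decayWeight.pos x).le, ← mul_assoc]
  rcases le_or_gt R ‖x‖ with hx | hx
  · simp [h0 x hx]
  · gcongr
    rw [growWeight, decayWeight, ← div_eq_mul_inv, le_div_iff₀ (by positivity), ← pow_add]
    gcongr

/-- A tempered solution of `v = -z² 𝒢_z * v`, that is, of `Δ v = 0`, has the mean value property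
over discs. With `h = E - M * E` for the disc mean `M`, the relation `E = 𝒢 - z² 𝒢 * E` gives
`h = 𝒢 - M * 𝒢 - z² 𝒢 * h`; convolving with `v` cancels the terms in `h`, which is legitimate as
`h` has compact support. -/
theorem ae_eq_conv_discKernel {z : ℂ} (hz : 0 < z.im) {v : Plane → ℂ} (hv : WInt decayWeight v)
    (hvz : v =ᵐ[volume] fun x => -z ^ 2 * conv (green z) v x) {R : ℝ} (hR : 0 < R) :
    v =ᵐ[volume] conv (discKernel R) v := by
  set G := green z with hG
  set M := discKernel R with hM
  set K : Plane → ℂ := fun x => -z ^ 2 * G x with hK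
  have md := moderate_decayWeight
  have mg := moderate_growWeight
  have wG : WInt growWeight G := wInt_green hz
  have wK : WInt growWeight K := wG.const_mul _
  have wM : WInt growWeight M := wInt_discKernel R
  have wE := wInt_logKernel
  set h : Plane → ℂ := fun x => logKernel x - conv M logKernel x with hh
  have wME : WInt decayWeight (conv M logKernel) := WInt.conv md wM wE
  have wKE : WInt decayWeight (conv K logKernel) := WInt.conv md wK wE
  have wh : WInt growWeight h := (wE.sub wME).growWeight_of_eq_zero (R := R) fun x hx => by
    rw [conv_discKernel_logKernel hR hx, sub_self]
  have wMG : WInt growWeight (conv M G) := WInt.conv mg wM wG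
  have wKh : WInt growWeight (conv K h) := WInt.conv mg wK wh
  have wGd : WInt decayWeight G := by
    have hm := wG.aestronglyMeasurable mg
    refine Integrable.mono wG ((Complex.continuous_ofReal.comp
      md.continuous).aestronglyMeasurable.mul hm) (Eventually.of_forall fun x => ?_)
    rw [norm_mul, norm_mul, Complex.norm_real, Complex.norm_real,
      Real.norm_of_nonneg (mg.pos x).le, Real.norm_of_nonneg (md.pos x).le]
    gcongr
    have h1 : 1 ≤ (1 + ‖x‖) ^ 4 := one_le_pow₀ (by linarith [norm_nonneg x])
    exact (inv_le_one_of_one_le₀ h1).trans h1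
  -- the fundamental solutions of `-Δ` and of `-Δ - z²` are linked by `E = 𝒢 + K * E`
  have hE : logKernel =ᵐ[volume] fun x => G x + conv K logKernel x := by
    filter_upwards [ae_ne_plane 0] with x hx
    have := integral_green_mul_logKernel hz hx
    rw [hK, conv_const_mul_left, conv, this]; ring
  have hMK : conv M (conv K logKernel) =ᵐ[volume] conv K (conv M logKernel) :=
    (conv_assoc_ae md wM wK wE).symm.trans (conv_comm M K ▸ conv_assoc_ae md wK wM wE)
  have hhe : h =ᵐ[volume] fun x => (G x - conv M G x) + conv K h x := by
    filter_upwards [hE, hMK, WInt.ae_convAt md wM wGd, WInt.ae_convAt md wM wKE,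
      WInt.ae_convAt md wK wE, WInt.ae_convAt md wK wME] with x h1 h2 h3 h4 h5 h6
    have e1 : conv M logKernel x = conv M G x + conv K (conv M logKernel) x := by
      rw [← h2, ← conv_add_right h3 h4]
      exact congrFun (conv_congr_right hE M) x
    have e2 : conv K h x = conv K logKernel x - conv K (conv M logKernel) x :=
      conv_sub_right h5 h6
    simp only [hh] at e2 ⊢
    rw [e2]
    linear_combination h1 - e1
  have hv' : conv K v =ᵐ[volume] v := by
    filter_upwards [hvz] with x hx
    rw [hx, hK, conv_const_mul_left]
  have hKhv : conv (conv K h) v =ᵐ[volume] conv h v := by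
    rw [conv_comm K h]
    refine (conv_assoc_ae md wh wK hv).trans ?_
    rw [conv_congr_right hv']
  have hMGv : conv (conv M G) v =ᵐ[volume] conv M (conv G v) := conv_assoc_ae md wM wG hv
  -- the disc mean of `v = -z² 𝒢 * v`
  have hMv : ∀ x, conv M v x = -z ^ 2 * conv M (conv G v) x := fun x => by
    rw [← conv_const_mul_right, conv_congr_right hvz]
  filter_upwards [hKhv, hMGv, hvz, WInt.ae_convAt md (wG.sub wMG) hv, WInt.ae_convAt md wKh hv,
    WInt.ae_convAt md wG hv, WInt.ae_convAt md wMG hv] with x h1 h2 h3 h4 h5 h6 h7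
  have e1 : conv h v x = (conv G v x - conv (conv M G) v x) + conv (conv K h) v x := by
    rw [conv_congr_left hhe, conv_add_left h4 h5, conv_sub_left h6 h7]
  rw [h1, h2] at e1
  rw [h3, hMv]
  linear_combination z ^ 2 * e1

/-- The means over two discs of radius `R` differ only through an annulus of width `2‖x - x'‖`,
so they differ by `O(R^{-1/2})` if the function grows no faster than a square root. -/
theorem norm_conv_discKernel_sub_le {v : Plane → ℂ} {C ρ R : ℝ} (hC : 0 ≤ C)
    (hv : ∀ y, ρ ≤ ‖y‖ → ‖v y‖ ≤ C * Real.sqrt (1 + ‖y‖)) (x x' : Plane)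
    (hR : ρ + ‖x‖ + ‖x - x'‖ ≤ R) (hR0 : 0 < R) (hρ : 0 ≤ ρ)
    (h1 : ConvAt (discKernel R) v x) (h2 : ConvAt (discKernel R) v x') :
    ‖conv (discKernel R) v x - conv (discKernel R) v x'‖ ≤
      4 * ‖x - x'‖ * C * Real.sqrt (1 + ‖x‖ + ‖x - x'‖ + R) / R := by
  set d := ‖x - x'‖ with hd
  have hd0 : 0 ≤ d := norm_nonneg _
  have hsw : ∀ x, ConvAt (discKernel R) v x →
      Integrable fun y => discKernel R (x - y) * v y := fun x h => by
    have := (integrable_comp_sub_left (fun t => discKernel R t * v (x - t)) x).2 h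
    simpa using this
  rw [conv_eq_integral, conv_eq_integral, ← integral_sub (hsw x h1) (hsw x' h2)]
  set B := (Real.pi * R ^ 2)⁻¹ * (C * Real.sqrt (1 + ‖x‖ + d + R)) with hB
  have hB0 : 0 ≤ B := by positivity
  have hI1 : Integrable ((Metric.ball x (R + d)).indicator fun _ => B) :=
    (integrable_indicator_iff measurableSet_ball).2 (integrableOn_const measure_ball_lt_top.ne)
  have hI2 : Integrable ((Metric.ball x (R - d)).indicator fun _ => B) :=
    (integrable_indicator_iff measurableSet_ball).2 (integrableOn_const measure_ball_lt_top.ne)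
  refine (norm_integral_le_of_norm_le (hI1.sub hI2) (Eventually.of_forall fun y => ?_)).trans
    (le_of_eq ?_)
  · have ht1 : ‖x' - y‖ ≤ ‖x - y‖ + d := by
      have := norm_sub_le (x - y) (x - x')
      rwa [sub_sub_sub_cancel_left] at this
    have ht2 : ‖x - y‖ ≤ ‖x' - y‖ + d := by
      have := norm_add_le (x' - y) (x - x')
      rwa [sub_add_sub_comm, add_comm x' x, add_sub_add_right_eq_sub] at this
    have hmem : ∀ r, y ∈ Metric.ball x r ↔ ‖x - y‖ < r := fun r => by
      rw [Metric.mem_ball, dist_comm, dist_eq_norm]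
    simp only [Pi.sub_apply, indicator, hmem, discKernel, discProfile]
    by_cases c1 : ‖x - y‖ < R - d
    · have c2 : ‖x - y‖ < R := by linarith
      have c3 : ‖x' - y‖ < R := by linarith
      have c4 : ‖x - y‖ < R + d := by linarith
      simp [c1, c2, c3, c4]
    by_cases c2 : ‖x - y‖ < R + d
    · have hy1 : ρ ≤ ‖y‖ := by
        have := norm_sub_le x y
        linarith
      have hy2 : ‖y‖ ≤ ‖x‖ + d + R := by
        have := norm_sub_norm_le y x
        rw [norm_sub_rev] at this
        linarith
      have hvB : ‖(((Real.pi * R ^ 2)⁻¹ : ℝ) : ℂ) * v y‖ ≤ B := by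
        rw [norm_mul, Complex.norm_real, Real.norm_of_nonneg (by positivity), hB]
        gcongr
        exact (hv y hy1).trans (mul_le_mul_of_nonneg_left (Real.sqrt_le_sqrt (by linarith)) hC)
      simp only [c1, c2, if_true, if_false, sub_zero]
      by_cases c3 : ‖x - y‖ < R <;> by_cases c4 : ‖x' - y‖ < R
      · simpa [c3, c4] using hB0
      · simpa only [c3, c4, if_true, if_false, zero_mul, sub_zero] using hvB
      · simpa only [c3, c4, if_true, if_false, zero_mul, zero_sub, norm_neg] using hvB
      · simpa [c3, c4] using hB0
    · have c3 : ¬ ‖x - y‖ < R := by linarith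
      have c4 : ¬ ‖x' - y‖ < R := by linarith
      simp [c1, c2, c3, c4]
  · have hRd : 0 ≤ R - d := by linarith [norm_nonneg x]
    simp only [Pi.sub_apply]
    rw [integral_sub hI1 hI2, integral_indicator_const _ measurableSet_ball,
      integral_indicator_const _ measurableSet_ball, volume_real_ball _ (by linarith),
      volume_real_ball _ hRd, hB]
    have := Real.pi_pos
    simp only [smul_eq_mul]
    field_simp
    ring

/-- Liouville's theorem for tempered solutions of `v = -z² 𝒢_z * v` growing slower than
linearly. -/
theorem exists_ae_eq_const {z : ℂ} (hz : 0 < z.im) {v : Plane → ℂ} (hv : WInt decayWeight v)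
    (hvz : v =ᵐ[volume] fun x => -z ^ 2 * conv (green z) v x) {C ρ : ℝ} (hC : 0 ≤ C) (hρ : 0 ≤ ρ)
    (hg : ∀ y, ρ ≤ ‖y‖ → ‖v y‖ ≤ C * Real.sqrt (1 + ‖y‖)) :
    ∃ c : ℂ, v =ᵐ[volume] fun _ => c := by
  have hgood : ∀ᵐ x, ∀ n : ℕ, v x = conv (discKernel (n + 1)) v x ∧
      ConvAt (discKernel (n + 1)) v x := by
    refine ae_all_iff.2 fun n => ?_
    filter_upwards [ae_eq_conv_discKernel hz hv hvz (by positivity : (0 : ℝ) < n + 1),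
      WInt.ae_convAt moderate_decayWeight (wInt_discKernel (n + 1)) hv] with x h1 h2
    exact ⟨h1, h2⟩
  obtain ⟨x', hx'⟩ := hgood.exists
  refine ⟨v x', ?_⟩
  filter_upwards [hgood] with x hx
  set d := ‖x - x'‖
  have hd0 : 0 ≤ d := norm_nonneg _
  set A := 4 * d * C * Real.sqrt (2 + ‖x‖ + d) with hA
  have hb : ∀ᶠ n : ℕ in atTop, ‖v x - v x'‖ ≤ A * (Real.sqrt (n + 1))⁻¹ := by
    filter_upwards [eventually_ge_atTop ⌈ρ + ‖x‖ + d⌉₊] with n hn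
    have hn' : ρ + ‖x‖ + d ≤ n := (Nat.le_ceil _).trans (by exact_mod_cast hn)
    have hR1 : (1 : ℝ) ≤ n + 1 := by linarith [n.cast_nonneg (α := ℝ)]
    have h := norm_conv_discKernel_sub_le hC hg x x' (R := n + 1) (by linarith) (by linarith) hρ
      (hx n).2 (hx' n).2
    rw [← (hx n).1, ← (hx' n).1] at h
    refine h.trans ?_
    set R : ℝ := n + 1
    have h3 : Real.sqrt (1 + ‖x‖ + d + R) ≤ Real.sqrt (2 + ‖x‖ + d) * Real.sqrt R := by
      rw [← Real.sqrt_mul (by positivity)]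
      apply Real.sqrt_le_sqrt
      nlinarith [norm_nonneg x]
    have h4 : 0 < Real.sqrt R := Real.sqrt_pos.2 (by linarith)
    have h5 : Real.sqrt R * (Real.sqrt R)⁻¹ ^ 2 = (Real.sqrt R)⁻¹ := by field_simp
    have h6 : R⁻¹ = (Real.sqrt R)⁻¹ ^ 2 := by
      rw [inv_pow, Real.sq_sqrt (by linarith)]
    calc 4 * ‖x - x'‖ * C * Real.sqrt (1 + ‖x‖ + ‖x - x'‖ + R) / R
        ≤ 4 * ‖x - x'‖ * C * (Real.sqrt (2 + ‖x‖ + d) * Real.sqrt R) / R := by gcongr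
      _ = A * (Real.sqrt R * (Real.sqrt R)⁻¹ ^ 2) := by rw [hA, div_eq_mul_inv, h6]; ring
      _ = _ := by rw [h5]
  have hlim : Tendsto (fun n : ℕ => A * (Real.sqrt (n + 1))⁻¹) atTop (𝓝 0) := by
    have h1 : Tendsto (fun n : ℕ => Real.sqrt ((n : ℝ) + 1)) atTop atTop :=
      Real.tendsto_sqrt_atTop.comp (tendsto_atTop_add_const_right _ _ tendsto_natCast_atTop_atTop)
    simpa using h1.inv_tendsto_atTop.const_mul A
  have h0 := ge_of_tendsto hlim hb
  exact sub_eq_zero.1 (norm_le_zero_iff.1 h0)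

/-! ### Logarithmic potentials and the matrices of the model -/

variable {N : ℕ}

/-- The function `c + ∑ a_j E(x - y_j)`, where `E` is the fundamental solution of `-Δ`. -/
noncomputable def potential (Y : Fin N → Plane) (c : ℂ) (a : Fin N → ℂ) (x : Plane) : ℂ :=
  c + ∑ j, a j * logKernel (x - Y j)

theorem logFun_eq_potential (α : Fin N → ℝ) (Y : Fin N → Plane) (a : Fin N → ℂ) :
    logFun α Y a = potential Y (constTerm α Y a) a := by
  ext x
  rw [logFun, potential, sub_eq_add_neg, ← neg_mul, Finset.mul_sum]
  congr 1
  refine Finset.sum_congr rfl fun j _ => ?_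
  rw [logKernel]; ring

theorem memWeighted_potential {σ : ℝ} (hσ : 1 < σ) (hσ2 : σ < 2) (Y : Fin N → Plane) (c : ℂ)
    (a : Fin N → ℂ) : MemWeighted (-σ) (potential Y c a) :=
  (memWeighted_const hσ c).add
    (MemWeighted.sum fun j _ => (memWeighted_logKernel hσ hσ2 (Y j)).const_mul (a j))

theorem integral_green_mul_potential {z : ℂ} (hz : 0 < z.im) (Y : Fin N → Plane) (c : ℂ)
    (a : Fin N → ℂ) (x : Plane) :
    -z ^ 2 * ∫ y, green z (x - y) * potential Y c a y =
      c + ∑ j, a j * (-z ^ 2 * ∫ y, green z y * logKernel (x - Y j - y)) := by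
  have hI : ∀ f : Plane → ℂ, MemWeighted (-(3 / 2)) f → Integrable fun y => green z (x - y) * f y :=
    fun f hf => (sqDecay_green hz).integrable_mul (by norm_num) hf x
  have hc := hI _ (memWeighted_const (by norm_num) c)
  have hj : ∀ j, Integrable fun y => a j * (green z (x - y) * logKernel (y - Y j)) := fun j =>
    (hI _ (memWeighted_logKernel (by norm_num) (by norm_num) (Y j))).const_mul (a j)
  have h1 : ∀ y, green z (x - y) * potential Y c a y =
      green z (x - y) * c + ∑ j, a j * (green z (x - y) * logKernel (y - Y j)) := fun y => by
    rw [potential, mul_add, Finset.mul_sum]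
    congr 1
    exact Finset.sum_congr rfl fun j _ => by ring
  simp only [h1]
  rw [integral_add hc (integrable_finsetSum _ fun j _ => hj j),
    integral_finsetSum _ fun j _ => hj j, mul_add, Finset.mul_sum]
  congr 1
  · rw [integral_mul_const, integral_sub_left_eq_self (green z) volume x, ← mul_assoc,
      integral_green hz, one_mul]
  · refine Finset.sum_congr rfl fun j _ => ?_
    rw [integral_const_mul, mul_left_comm]
    have h2 := integral_sub_left_eq_self (fun y => green z y * logKernel (x - Y j - y)) volume x
    rw [← h2]
    congr 2
    refine integral_congr_ae (Eventually.of_forall fun y => ?_)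
    simp only []
    rw [show x - Y j - (x - y) = y - Y j by abel]

/-- `-z² 𝒢 * φ = φ - ∑ a_j 𝒢(x - y_j)` for `φ = c + ∑ a_j E(x - y_j)`. -/
theorem integral_green_mul_potential_of_notMem {z : ℂ} (hz : 0 < z.im) (Y : Fin N → Plane) (c : ℂ)
    (a : Fin N → ℂ) {x : Plane} (hx : x ∉ range Y) :
    -z ^ 2 * ∫ y, green z (x - y) * potential Y c a y =
      potential Y c a x - ∑ j, a j * green z (x - Y j) := by
  rw [integral_green_mul_potential hz, potential, add_sub_assoc, ← Finset.sum_sub_distrib]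
  congr 1
  refine Finset.sum_congr rfl fun j _ => ?_
  rw [integral_green_mul_logKernel hz (sub_ne_zero.2 fun h => hx ⟨j, h.symm⟩)]; ring

/-- At the points of interaction, `-z² 𝒢 * φ` takes the values `c - D̃ a + Γ(z) a`. -/
theorem integral_green_mul_potential_apply {z : ℂ} (hz : 0 < z.im) (α : Fin N → ℝ)
    {Y : Fin N → Plane} (hY : Function.Injective Y) (c : ℂ) (a : Fin N → ℂ) (k : Fin N) :
    -z ^ 2 * ∫ y, green z (y - Y k) * potential Y c a y =
      c - (dMatrix α Y).mulVec a k + (gammaMatrix α Y z).mulVec a k := by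
  have h : ∀ y, green z (y - Y k) = green z (Y k - y) := fun y => by rw [← green_neg, neg_sub]
  simp only [h]
  rw [integral_green_mul_potential hz, sub_add, sub_eq_add_neg]
  congr 1
  simp only [Matrix.mulVec, dotProduct]
  rw [← Finset.sum_sub_distrib, ← Finset.sum_neg_distrib]
  refine Finset.sum_congr rfl fun j _ => ?_
  by_cases hjk : k = j
  · subst hjk
    rw [sub_self, integral_green_mul_logKernel_zero hz]
    simp [dMatrix, gammaMatrix]; ring
  · rw [integral_green_mul_logKernel hz (sub_ne_zero.2 (hY.ne hjk))]
    simp [dMatrix, gammaMatrix, hjk, logKernel]; ring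

theorem sMatrix_mulVec (a : Fin N → ℂ) (j : Fin N) :
    (sMatrix N).mulVec a j = a j - (∑ k, a k) / N := by
  rw [sMatrix, Matrix.sub_mulVec, Matrix.one_mulVec, Pi.sub_apply]
  simp [Matrix.mulVec, dotProduct, ← Finset.mul_sum, div_eq_inv_mul]

theorem mem_sSpace_iff (hN : 1 ≤ N) {a : Fin N → ℂ} : a ∈ sSpace N ↔ ∑ j, a j = 0 := by
  have hN' : (N : ℂ) ≠ 0 := by exact_mod_cast (by omega : N ≠ 0)
  constructor
  · rintro ⟨b, rfl⟩
    simp only [Matrix.mulVecLin_apply, sMatrix_mulVec]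
    rw [Finset.sum_sub_distrib]
    simp
    field_simp
    simp
  · intro h
    refine ⟨a, ?_⟩
    ext j
    rw [Matrix.mulVecLin_apply, sMatrix_mulVec, h]; simp

theorem sMatrix_mulVec_of_mem (hN : 1 ≤ N) {a : Fin N → ℂ} (ha : a ∈ sSpace N) :
    (sMatrix N).mulVec a = a := by
  ext j
  rw [sMatrix_mulVec, (mem_sSpace_iff hN).1 ha]; simp

theorem sdsMatrix_mulVec_of_mem (hN : 1 ≤ N) (α : Fin N → ℝ) (Y : Fin N → Plane)
    {a : Fin N → ℂ} (ha : a ∈ sSpace N) (j : Fin N) :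
    (sdsMatrix α Y).mulVec a j = (dMatrix α Y).mulVec a j - constTerm α Y a := by
  rw [sdsMatrix, ← Matrix.mulVec_mulVec, sMatrix_mulVec_of_mem hN ha, ← Matrix.mulVec_mulVec,
    sMatrix_mulVec, constTerm]
  simp [dotProduct]

/-- The coefficients of the resonances: `∑ a_j = 0` and `D̃ a` is constant. -/
theorem mem_coeffSpace_iff (hN : 1 ≤ N) (α : Fin N → ℝ) (Y : Fin N → Plane) {a : Fin N → ℂ} :
    a ∈ coeffSpace α Y ↔
      ∑ j, a j = 0 ∧ ∀ j, (dMatrix α Y).mulVec a j = constTerm α Y a := by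
  rw [coeffSpace, Submodule.mem_inf, and_comm, ← mem_sSpace_iff hN]
  refine and_congr_right fun ha => ?_
  rw [LinearMap.mem_ker, Matrix.mulVecLin_apply, funext_iff]
  refine forall_congr' fun j => ?_
  rw [sdsMatrix_mulVec_of_mem hN α Y ha, Pi.zero_apply, sub_eq_zero]

theorem constTerm_eq_of_forall (hN : 1 ≤ N) (α : Fin N → ℝ) (Y : Fin N → Plane) {a : Fin N → ℂ}
    {c : ℂ} (h : ∀ j, (dMatrix α Y).mulVec a j = c) : constTerm α Y a = c := by
  have hN' : (N : ℂ) ≠ 0 := by exact_mod_cast (by omega : N ≠ 0)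
  rw [constTerm, dotProduct]
  simp [h]
  field_simp

/-! ### Expansion of the resonances at infinity -/

/-- `log |x - y| = log |x| - ⟨x, y⟩ / |x|² + O(|x|⁻²)`, from the expansion of `log (1 - t)` with
`|x - y|² = |x|² (1 - t)`. -/
theorem abs_log_norm_sub_le {x y : Plane} (hx : x ≠ 0) (hxy : 6 * ‖y‖ ≤ ‖x‖) :
    |Real.log ‖x - y‖ - Real.log ‖x‖ + inner ℝ x y / ‖x‖ ^ 2| ≤ 10 * ‖y‖ ^ 2 * (‖x‖ ^ 2)⁻¹ := by
  have hr : 0 < ‖x‖ := norm_pos_iff.2 hx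
  have hy := norm_nonneg y
  set r := ‖x‖ with hrdef
  set s := ‖y‖ with hs
  set p : ℝ := inner ℝ x y with hp
  have hpb : |p| ≤ r * s := abs_real_inner_le_norm x y
  set t : ℝ := (2 * p - s ^ 2) / r ^ 2 with ht
  have htr : t * r ^ 2 = 2 * p - s ^ 2 := by rw [ht]; field_simp
  have ht1 : |t| ≤ 3 * s / r := by
    rw [ht, abs_div, abs_of_pos (by positivity : 0 < r ^ 2), div_le_div_iff₀ (by positivity) hr]
    have h1 : |2 * p - s ^ 2| ≤ 3 * s * r := by
      rw [abs_le] at hpb ⊢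
      constructor <;> nlinarith
    nlinarith
  have ht2 : |t| ≤ 1 / 2 := ht1.trans (by rw [div_le_div_iff₀ hr (by norm_num)]; linarith)
  have hlog : Real.log ‖x - y‖ - Real.log r = 1 / 2 * Real.log (1 - t) := by
    have h1 : ‖x - y‖ ^ 2 = r ^ 2 * (1 - t) := by
      rw [norm_sub_sq_real]; linear_combination htr
    have h2 : 0 < 1 - t := by linarith [le_abs_self t]
    have h3 := congrArg Real.log h1
    rw [Real.log_mul (by positivity) h2.ne', Real.log_pow, Real.log_pow] at h3
    push_cast at h3
    linarith
  have h4 := Real.abs_log_sub_add_sum_range_le (ht2.trans_lt (by norm_num)) 1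
  simp only [Finset.sum_range_one, zero_add, pow_one, Nat.cast_zero, div_one, one_add_one_eq_two]
    at h4
  have h5 : |t + Real.log (1 - t)| ≤ 18 * s ^ 2 / r ^ 2 := by
    refine h4.trans ?_
    rw [div_le_iff₀ (by linarith)]
    have h6 : |t| ^ 2 ≤ 9 * s ^ 2 / r ^ 2 :=
      (pow_le_pow_left₀ (abs_nonneg _) ht1 2).trans_eq (by ring)
    have h7 : 0 ≤ 18 * s ^ 2 / r ^ 2 := by positivity
    have h8 : 18 * s ^ 2 / r ^ 2 = 2 * (9 * s ^ 2 / r ^ 2) := by ring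
    nlinarith
  have h9 : Real.log ‖x - y‖ - Real.log r + p / r ^ 2 =
      1 / 2 * (t + Real.log (1 - t)) + s ^ 2 / (2 * r ^ 2) := by
    rw [hlog, ht]; field_simp; ring
  rw [h9]
  refine (abs_add_le _ _).trans ?_
  rw [abs_mul, abs_of_nonneg (by positivity : 0 ≤ s ^ 2 / (2 * r ^ 2)),
    abs_of_pos (by norm_num : (0 : ℝ) < 1 / 2)]
  calc 1 / 2 * |t + Real.log (1 - t)| + s ^ 2 / (2 * r ^ 2)
      ≤ 1 / 2 * (18 * s ^ 2 / r ^ 2) + s ^ 2 / (2 * r ^ 2) := by gcongr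
    _ ≤ 10 * s ^ 2 * (r ^ 2)⁻¹ := by
      have : 0 ≤ s ^ 2 * (r ^ 2)⁻¹ := by positivity
      have e : 1 / 2 * (18 * s ^ 2 / r ^ 2) + s ^ 2 / (2 * r ^ 2) =
        (19 / 2) * (s ^ 2 * (r ^ 2)⁻¹) := by field_simp; ring
      rw [e]; linarith

theorem isBigO_log_norm_sub (y : Plane) :
    (fun x : Plane => Real.log ‖x - y‖ - Real.log ‖x‖ + inner ℝ x y / ‖x‖ ^ 2)
      =O[Bornology.cobounded Plane] fun x : Plane => (‖x‖ ^ 2)⁻¹ := by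
  refine Asymptotics.IsBigO.of_bound (10 * ‖y‖ ^ 2) ?_
  have h := tendsto_norm_cobounded_atTop (E := Plane)
  filter_upwards [h.eventually_ge_atTop (6 * ‖y‖), h.eventually_gt_atTop 0] with x h1 h2
  rw [Real.norm_eq_abs, Real.norm_of_nonneg (by positivity)]
  exact abs_log_norm_sub_le (norm_pos_iff.1 h2) h1

/-- The logarithms cancel to first order because `∑ a_j = 0`. -/
theorem logFun_isBigO (α : Fin N → ℝ) (Y : Fin N → Plane) {a : Fin N → ℂ} (ha : ∑ j, a j = 0) :
    (fun x : Plane => logFun α Y a x - (constTerm α Y a + 1 / (2 * (Real.pi : ℂ)) *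
        ∑ j, a j * ((inner ℝ (‖x‖⁻¹ • x) (Y j) : ℝ) : ℂ) / (‖x‖ : ℂ)))
      =O[Bornology.cobounded Plane] fun x : Plane => (‖x‖ ^ 2)⁻¹ := by
  have h : ∀ x : Plane, logFun α Y a x - (constTerm α Y a + 1 / (2 * (Real.pi : ℂ)) *
      ∑ j, a j * ((inner ℝ (‖x‖⁻¹ • x) (Y j) : ℝ) : ℂ) / (‖x‖ : ℂ)) =
      ∑ j, (-(1 / (2 * (Real.pi : ℂ))) * a j) * ((Real.log ‖x - Y j‖ - Real.log ‖x‖ +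
        inner ℝ x (Y j) / ‖x‖ ^ 2 : ℝ) : ℂ) := fun x => by
    have h0 : ∑ j, (-(1 / (2 * (Real.pi : ℂ)))) * a j * (Real.log ‖x‖ : ℂ) = 0 := by
      rw [← Finset.sum_mul, ← Finset.mul_sum, ha]; simp
    rw [logFun, ← sub_eq_zero, sub_add_eq_sub_sub, sub_sub_cancel_left, Finset.mul_sum,
      Finset.mul_sum, ← h0, ← Finset.sum_neg_distrib, ← Finset.sum_sub_distrib,
      ← Finset.sum_sub_distrib]
    refine Finset.sum_congr rfl fun j _ => ?_
    rw [real_inner_smul_left]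
    push_cast
    ring
  simp only [h]
  refine Asymptotics.IsBigO.fun_sum fun j _ => ?_
  exact (Complex.isBigO_ofReal_left.2 (isBigO_log_norm_sub (Y j))).const_mul_left _

/-! ### Boundedness and singularities of logarithmic potentials -/

theorem isBigO_one_log_norm_sub (y : Plane) :
    (fun x : Plane => Real.log ‖x - y‖ - Real.log ‖x‖)
      =O[Bornology.cobounded Plane] fun _ : Plane => (1 : ℝ) := by
  have h := tendsto_norm_cobounded_atTop (E := Plane)
  have h1 : (fun x : Plane => (‖x‖ ^ 2)⁻¹) =O[Bornology.cobounded Plane]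
      fun _ : Plane => (1 : ℝ) := by
    refine Asymptotics.IsBigO.of_bound 1 ?_
    filter_upwards [h.eventually_ge_atTop 1] with x hx
    rw [Real.norm_of_nonneg (by positivity), norm_one, mul_one]
    exact inv_le_one_of_one_le₀ (one_le_pow₀ hx)
  have h2 : (fun x : Plane => inner ℝ x y / ‖x‖ ^ 2) =O[Bornology.cobounded Plane]
      fun _ : Plane => (1 : ℝ) := by
    refine Asymptotics.IsBigO.of_bound ‖y‖ ?_
    filter_upwards [h.eventually_ge_atTop 1] with x hx
    rw [norm_one, mul_one, norm_div, norm_pow, norm_norm,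
      div_le_iff₀ (by positivity)]
    refine (abs_real_inner_le_norm x y).trans ?_
    rw [mul_comm]
    exact mul_le_mul_of_nonneg_left (le_self_pow₀ hx two_ne_zero) (norm_nonneg y)
  refine (((isBigO_log_norm_sub y).trans h1).sub h2).congr_left fun x => ?_
  ring

/-- At infinity a potential behaves like its total charge placed at the origin, up to `O(1)`. -/
theorem potential_sub_isBigO_one (Y : Fin N → Plane) (c : ℂ) (a : Fin N → ℂ) :
    (fun x : Plane => potential Y c a x - (∑ j, a j) * logKernel x)
      =O[Bornology.cobounded Plane] fun _ : Plane => (1 : ℝ) := by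
  have h : ∀ x : Plane, potential Y c a x - (∑ j, a j) * logKernel x =
      c + ∑ j, (a j * -(1 / (2 * (Real.pi : ℂ)))) *
        ((Real.log ‖x - Y j‖ - Real.log ‖x‖ : ℝ) : ℂ) := fun x => by
    rw [potential, Finset.sum_mul, add_sub_assoc, ← Finset.sum_sub_distrib]
    congr 1
    refine Finset.sum_congr rfl fun j _ => ?_
    rw [logKernel, logKernel]; push_cast; ring
  simp only [h]
  refine (Asymptotics.isBigO_const_const c one_ne_zero _).add
    (Asymptotics.IsBigO.fun_sum fun j _ => ?_)
  exact (Complex.isBigO_ofReal_left.2 (isBigO_one_log_norm_sub (Y j))).const_mul_left _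

theorem exists_norm_le_of_isBigO_one {f : Plane → ℂ}
    (h : f =O[Bornology.cobounded Plane] fun _ : Plane => (1 : ℝ)) :
    ∃ C ρ : ℝ, 0 ≤ C ∧ 1 ≤ ρ ∧ ∀ x, ρ ≤ ‖x‖ → ‖f x‖ ≤ C := by
  obtain ⟨C, hC, hb⟩ := h.exists_nonneg
  rw [Asymptotics.IsBigOWith] at hb
  obtain ⟨ρ, -, hρ⟩ := (hasBasis_cobounded_norm (E := Plane)).eventually_iff.1 hb
  refine ⟨C, max 1 ρ, hC, le_max_left _ _, fun x hx => ?_⟩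
  simpa using hρ ((le_max_right _ _).trans hx)

theorem norm_logKernel_le {x : Plane} (hx : 1 ≤ ‖x‖) : ‖logKernel x‖ ≤ Real.sqrt (1 + ‖x‖) := by
  have h0 : 0 ≤ Real.log ‖x‖ := Real.log_nonneg hx
  have h1 : Real.log ‖x‖ ≤ 2 * Real.sqrt ‖x‖ := by
    have h2 : Real.log (Real.sqrt ‖x‖) ≤ Real.sqrt ‖x‖ :=
      (Real.log_le_sub_one_of_pos (Real.sqrt_pos.2 (by linarith))).trans (by linarith)
    rw [Real.log_sqrt (by linarith)] at h2
    linarith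
  have h2 : ‖logKernel x‖ = 1 / (2 * Real.pi) * Real.log ‖x‖ := by
    rw [logKernel, norm_mul, norm_neg, Complex.norm_real, Real.norm_of_nonneg h0]
    congr 1
    rw [show (1 / (2 * (Real.pi : ℂ))) = ((1 / (2 * Real.pi) : ℝ) : ℂ) by push_cast; ring,
      Complex.norm_real, Real.norm_of_nonneg (by positivity)]
  have h3 : 1 / (2 * Real.pi) ≤ 1 / 2 := by
    have := Real.pi_gt_three
    exact one_div_le_one_div_of_le (by norm_num) (by linarith)
  rw [h2]
  calc 1 / (2 * Real.pi) * Real.log ‖x‖ ≤ 1 / 2 * (2 * Real.sqrt ‖x‖) := by gcongr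
    _ = Real.sqrt ‖x‖ := by ring
    _ ≤ _ := Real.sqrt_le_sqrt (by linarith)

theorem exists_norm_potential_le (Y : Fin N → Plane) (c : ℂ) (a : Fin N → ℂ) :
    ∃ C ρ : ℝ, 0 ≤ C ∧ 1 ≤ ρ ∧ ∀ x, ρ ≤ ‖x‖ → ‖potential Y c a x‖ ≤ C * Real.sqrt (1 + ‖x‖) := by
  obtain ⟨C, ρ, hC, hρ, h⟩ := exists_norm_le_of_isBigO_one (potential_sub_isBigO_one Y c a)
  refine ⟨C + ‖∑ j, a j‖, ρ, by positivity, hρ, fun x hx => ?_⟩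
  have h1 : 1 ≤ Real.sqrt (1 + ‖x‖) := Real.one_le_sqrt.2 (by linarith [norm_nonneg x])
  have h2 := norm_logKernel_le (hρ.trans hx)
  calc ‖potential Y c a x‖
      = ‖(potential Y c a x - (∑ j, a j) * logKernel x) + (∑ j, a j) * logKernel x‖ := by
        rw [sub_add_cancel]
    _ ≤ C + ‖∑ j, a j‖ * ‖logKernel x‖ :=
        (norm_add_le _ _).trans (add_le_add (h x hx) (norm_mul_le _ _))
    _ ≤ C * Real.sqrt (1 + ‖x‖) + ‖∑ j, a j‖ * Real.sqrt (1 + ‖x‖) :=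
        add_le_add (le_mul_of_one_le_right hC h1) (mul_le_mul_of_nonneg_left h2 (norm_nonneg _))
    _ = _ := by ring

theorem tendsto_norm_logKernel_cobounded :
    Tendsto (fun x => ‖logKernel x‖) (Bornology.cobounded Plane) atTop := by
  have h := Real.tendsto_log_atTop.comp (tendsto_norm_cobounded_atTop (E := Plane))
  have hc : 0 < ‖-(1 / (2 * (Real.pi : ℂ)))‖ := by
    rw [norm_pos_iff, neg_ne_zero]; exact one_div_ne_zero two_pi_ne_zero
  have h2 := (tendsto_abs_atTop_atTop.comp h).const_mul_atTop hc
  refine h2.congr fun x => ?_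
  simp [logKernel]

theorem tendsto_norm_logKernel_nhdsNE (y : Plane) :
    Tendsto (fun x => ‖logKernel (x - y)‖) (𝓝[≠] y) atTop := by
  have h0 : Tendsto (fun x : Plane => ‖x - y‖) (𝓝[≠] y) (𝓝[>] 0) := tendsto_norm_sub_self_nhdsNE y
  have h := Real.tendsto_log_nhdsGT_zero.comp h0
  have hc : 0 < ‖-(1 / (2 * (Real.pi : ℂ)))‖ := by
    rw [norm_pos_iff, neg_ne_zero]; exact one_div_ne_zero two_pi_ne_zero
  have h2 := (tendsto_abs_atBot_atTop.comp h).const_mul_atTop hc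
  refine h2.congr fun x => ?_
  simp [logKernel]

theorem continuousAt_logKernel {x : Plane} (hx : x ≠ 0) : ContinuousAt logKernel x := by
  unfold logKernel
  refine continuousAt_const.mul (Complex.continuous_ofReal.continuousAt.comp ?_)
  exact (continuous_norm.continuousAt).log (norm_ne_zero_iff.2 hx)

theorem continuousAt_potential (Y : Fin N → Plane) (c : ℂ) (a : Fin N → ℂ) {x : Plane}
    (hx : x ∉ range Y) : ContinuousAt (potential Y c a) x := by
  unfold potential
  refine continuousAt_const.add (tendsto_finsetSum _ fun j _ => ContinuousAt.mul
    continuousAt_const ?_)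
  have h : x - Y j ≠ 0 := sub_ne_zero.2 fun h => hx ⟨j, h.symm⟩
  exact (continuousAt_logKernel h).comp (f := fun x => x - Y j)
    (continuousAt_id.sub continuousAt_const)

/-- Bounded potentials have total charge zero. -/
theorem sum_eq_zero_of_isBigO (Y : Fin N → Plane) {c : ℂ} {a : Fin N → ℂ}
    (h : potential Y c a =O[Bornology.cobounded Plane] fun _ : Plane => (1 : ℝ)) :
    ∑ j, a j = 0 := by
  by_contra hne
  -- otherwise the logarithm would be bounded at infinity
  have h1 := (h.sub (potential_sub_isBigO_one Y c a)).congr_left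
    (fun x => sub_sub_cancel _ ((∑ j, a j) * logKernel x))
  rw [Asymptotics.isBigO_const_mul_left_iff hne, Asymptotics.isBigO_one_iff] at h1
  exact not_isBoundedUnder_of_tendsto_atTop tendsto_norm_logKernel_cobounded h1

/-- The coefficients of a potential are determined by its singularities. -/
theorem eq_zero_of_potential_eq_zero {Y : Fin N → Plane} (hY : Function.Injective Y) {c : ℂ}
    {a : Fin N → ℂ} (h : ∀ x, x ∉ range Y → potential Y c a x = 0) : a = 0 := by
  ext k
  by_contra hne
  rw [Pi.zero_apply] at hne
  -- if `a k ≠ 0`, then off `Y` the singular term equals `g`, which is continuous at `Y k`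
  set g : Plane → ℂ := fun x =>
    -(a k)⁻¹ * (c + ∑ j ∈ Finset.univ.erase k, a j * logKernel (x - Y j))
    with hg
  have hcont : ContinuousAt g (Y k) := by
    refine continuousAt_const.mul (continuousAt_const.add (tendsto_finsetSum _ fun j hj =>
      ContinuousAt.mul continuousAt_const ?_))
    have h : Y k - Y j ≠ 0 := sub_ne_zero.2 (hY.ne (Finset.ne_of_mem_erase hj).symm)
    exact (continuousAt_logKernel h).comp (f := fun x => x - Y j)
      (continuousAt_id.sub continuousAt_const)
  have hev : ∀ᶠ x in 𝓝[≠] (Y k), x ∉ range Y := by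
    have h1 : ((range Y) \ {Y k})ᶜ ∈ 𝓝 (Y k) :=
      ((finite_range Y).subset sdiff_subset).isClosed.isOpen_compl.mem_nhds (by simp)
    filter_upwards [mem_nhdsWithin_of_mem_nhds h1, self_mem_nhdsWithin] with x hx hx' hr
    exact hx ⟨hr, hx'⟩
  have heq : (fun x => ‖g x‖) =ᶠ[𝓝[≠] (Y k)] fun x => ‖logKernel (x - Y k)‖ := by
    filter_upwards [hev] with x hx
    have h1 := h x hx
    rw [potential, ← Finset.add_sum_erase _ _ (Finset.mem_univ k)] at h1
    congr 1
    simp only [hg]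
    field_simp
    linear_combination -h1
  have h2 := (hcont.norm.tendsto.mono_left nhdsWithin_le_nhds).congr' heq
  exact not_tendsto_nhds_of_tendsto_atTop (tendsto_norm_logKernel_nhdsNE (Y k)) _ h2

theorem isCb_potential (Y : Fin N → Plane) (c : ℂ) {a : Fin N → ℂ} (ha : ∑ j, a j = 0) :
    IsCb Y fun x => potential Y c a x := by
  refine ⟨continuous_iff_continuousAt.2 fun x =>
    (continuousAt_potential Y c a x.2).comp continuousAt_subtype_val, ?_⟩
  obtain ⟨C, ρ, -, -, h⟩ := exists_norm_le_of_isBigO_one (potential_sub_isBigO_one Y c a)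
  obtain ⟨R, hR⟩ := (finite_range Y).isBounded.subset_ball 0
  refine ⟨Metric.ball 0 (max ρ R), Metric.isOpen_ball, Metric.isBounded_ball,
    hR.trans (Metric.ball_subset_ball (le_max_right _ _)), C, fun x hx => ?_⟩
  rw [Metric.mem_ball, dist_zero_right, not_lt] at hx
  simpa [ha] using h x ((le_max_left _ _).trans hx)

theorem IsCb.exists_norm_le {Y : Fin N → Plane} {φ : Punctured Y → ℂ} (h : IsCb Y φ) :
    ∃ C ρ : ℝ, 0 ≤ C ∧ 0 ≤ ρ ∧ ∀ x : Plane, ρ ≤ ‖x‖ → ∃ hx : x ∉ range Y, ‖φ ⟨x, hx⟩‖ ≤ C := by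
  obtain ⟨-, U, -, hU, hYU, C, hC⟩ := h
  obtain ⟨R, hR⟩ := hU.subset_ball 0
  refine ⟨max C 0, max R 0, le_max_right _ _, le_max_right _ _, fun x hx => ?_⟩
  have hxU : x ∉ U := fun h => by
    have := hR h
    rw [Metric.mem_ball, dist_zero_right] at this
    exact absurd ((le_max_left _ _).trans hx) (not_le.2 this)
  exact ⟨fun hr => hxU (hYU hr), (hC ⟨x, fun hr => hxU (hYU hr)⟩ hxU).trans (le_max_left _ _)⟩

/-- Non-singularity means trivial kernel, as `S ℂ^N` has finite dimension and is preserved by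
`S D̃ S`. -/
theorem nonsingularOnS_iff (α : Fin N → ℝ) (Y : Fin N → Plane) :
    NonsingularOnS α Y ↔ ∀ a ∈ coeffSpace α Y, a = 0 := by
  constructor
  · rintro ⟨-, hinj, -⟩ a ⟨ha, haS⟩
    refine hinj haS (sSpace N).zero_mem ?_
    simpa using ha
  · intro h
    have hmaps : ∀ a ∈ sSpace N, (sdsMatrix α Y).mulVecLin a ∈ sSpace N := fun a _ =>
      ⟨(dMatrix α Y * sMatrix N).mulVec a, by
        rw [Matrix.mulVecLin_apply, Matrix.mulVecLin_apply, Matrix.mulVec_mulVec, sdsMatrix,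
          Matrix.mul_assoc]⟩
    set T : sSpace N →ₗ[ℂ] sSpace N := (sdsMatrix α Y).mulVecLin.restrict hmaps with hT
    have hinj : Function.Injective T := by
      rw [← LinearMap.ker_eq_bot, LinearMap.ker_eq_bot']
      intro a ha
      have h1 : (sdsMatrix α Y).mulVecLin a = 0 := congrArg Subtype.val ha
      exact Subtype.ext (h a ⟨h1, a.2⟩)
    refine ⟨fun a ha => hmaps a ha, fun a ha b hb hab => ?_, fun b hb => ?_⟩
    · exact congrArg Subtype.val (@hinj ⟨a, ha⟩ ⟨b, hb⟩ (Subtype.ext hab))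
    · obtain ⟨a, ha⟩ := (LinearMap.injective_iff_surjective.1 hinj) ⟨b, hb⟩
      exact ⟨a, a.2, congrArg Subtype.val ha⟩

/-! ### The extended resolvent -/

theorem weighted_sub (s : ℝ) (u v : Plane → ℂ) :
    weighted s (u - v) = weighted s u - weighted s v := by
  ext x; simp [weighted, mul_sub]

theorem MemWeighted.aestronglyMeasurable {s : ℝ} {u : Plane → ℂ} (h : MemWeighted (-s) u) :
    AEStronglyMeasurable u :=
  aestronglyMeasurable_of_weighted h.1

theorem norm_weighted (s : ℝ) (u : Plane → ℂ) (x : Plane) :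
    ‖weighted s u x‖ = (1 + ‖x‖ ^ 2) ^ (s / 2) * ‖u x‖ := by
  rw [weighted, norm_mul, Complex.norm_real, Real.norm_of_nonneg (by positivity)]

theorem MemWeighted.mono {s : ℝ} {u v : Plane → ℂ} (hv : MemWeighted s v)
    (hu : AEStronglyMeasurable u) (h : ∀ᵐ x, ‖u x‖ ≤ ‖v x‖) : MemWeighted s u := by
  refine MemLp.of_le hv (AEStronglyMeasurable.weighted hu) ?_
  filter_upwards [h] with x hx
  rw [norm_weighted, norm_weighted]
  gcongr

theorem MemWeighted.norm {s : ℝ} {u : Plane → ℂ} (hu : MemWeighted (-s) u) :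
    MemWeighted (-s) fun x => (‖u x‖ : ℂ) :=
  hu.mono (Complex.continuous_ofReal.comp_aestronglyMeasurable hu.aestronglyMeasurable.norm)
    (by simp)

theorem memWeighted_of_memLp {σ : ℝ} (hσ : 0 ≤ σ) {u : Plane → ℂ} (hu : MemLp u 2 volume) :
    MemWeighted (-σ) u := by
  refine MemLp.of_le hu (AEStronglyMeasurable.weighted hu.1) (Eventually.of_forall fun x => ?_)
  rw [norm_weighted]
  refine mul_le_of_le_one_left (norm_nonneg _) ?_
  exact Real.rpow_le_one_of_one_le_of_nonpos (by nlinarith [norm_nonneg x]) (by linarith)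

theorem SqDecay.memLp {K : Plane → ℂ} (hK : SqDecay K) : MemLp K 2 volume := by
  have h := (hK.memLp_translate (σ := 0) (by norm_num) 0).comp_measurePreserving
    (Measure.measurePreserving_neg volume)
  simpa [Function.comp_def] using h

/-- Dominated convergence in `L²_s`. -/
theorem tendstoWeighted_of_dominated {s : ℝ} {u : ℕ → Plane → ℂ} {v g : Plane → ℂ}
    (hu : ∀ n, AEStronglyMeasurable (u n)) (hv : AEStronglyMeasurable v) (hg : MemWeighted s g)
    (hb : ∀ n, ∀ᵐ x, ‖u n x - v x‖ ≤ ‖g x‖)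
    (hlim : ∀ᵐ x, Tendsto (fun n => u n x) atTop (𝓝 (v x))) : TendstoWeighted s u v := by
  rw [TendstoWeighted]
  simp only [eLpNorm_eq_lintegral_rpow_enorm_toReal two_ne_zero ENNReal.ofNat_ne_top]
  have h0 : Tendsto (fun n => ∫⁻ x, ‖weighted s (u n - v) x‖ₑ ^ (2 : ENNReal).toReal) atTop
      (𝓝 (∫⁻ _ : Plane, 0)) := by
    refine tendsto_lintegral_of_dominated_convergence'
      (fun x => ‖weighted s g x‖ₑ ^ (2 : ENNReal).toReal) (fun n => ?_) (fun n => ?_) ?_ ?_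
    · exact (AEStronglyMeasurable.weighted ((hu n).sub hv)).enorm.pow_const _
    · filter_upwards [hb n] with x hx
      refine ENNReal.rpow_le_rpow (enorm_le_iff_norm_le.2 ?_) (by simp)
      rw [norm_weighted, norm_weighted]
      gcongr
      exact hx
    · exact (lintegral_rpow_enorm_lt_top_of_eLpNorm_lt_top two_ne_zero ENNReal.ofNat_ne_top
        hg.2).ne
    · filter_upwards [hlim] with x hx
      have h1 : Tendsto (fun n => weighted s (u n - v) x) atTop (𝓝 0) := by
        have := (hx.sub_const (v x)).const_mul ((((1 + ‖x‖ ^ 2) ^ (s / 2) : ℝ) : ℂ))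
        simpa [weighted] using this
      have h2 := (h1.enorm).ennrpow_const (2 : ENNReal).toReal
      simpa using h2
  have h3 := h0.ennrpow_const (1 / (2 : ENNReal).toReal)
  simpa using h3

variable {z : ℂ} {σ : ℝ}

theorem convAt_green (hz : 0 < z.im) (hσ : σ ≤ 2) {f : Plane → ℂ} (hf : MemWeighted (-σ) f)
    (x : Plane) : ConvAt (green z) f x := by
  have h := (integrable_comp_sub_left (fun y => green z (x - y) * f y) x).2
    ((sqDecay_green hz).integrable_mul hσ hf x)
  simpa [ConvAt] using h

theorem resolventFun_eq_conv (α : Fin N → ℝ) (Y : Fin N → Plane) (z : ℂ) (f : Plane → ℂ)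
    (x : Plane) :
    resolventFun α Y z f x = conv (green z) f x +
      ∑ j, ((gammaMatrix α Y z)⁻¹.mulVec fun k => conv (green z) f (Y k)) j *
        green z (x - Y j) := by
  rw [resolventFun, ← conv_eq_integral]
  congr 1
  refine Finset.sum_congr rfl fun j _ => ?_
  rw [Matrix.mulVec, dotProduct, Finset.sum_mul]
  refine Finset.sum_congr rfl fun k _ => ?_
  have h : ∀ y, green z (y - Y k) = green z (Y k - y) := fun y => by rw [← green_neg, neg_sub]
  simp only [h, conv_eq_integral]
  ring

theorem aestronglyMeasurable_resolventFun (hz : 0 < z.im) (α : Fin N → ℝ) (Y : Fin N → Plane)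
    {f : Plane → ℂ} (hf : AEStronglyMeasurable f) :
    AEStronglyMeasurable (resolventFun α Y z f) := by
  have h : resolventFun α Y z f = _ := funext (resolventFun_eq_conv α Y z f)
  have hG := aestronglyMeasurable_green hz
  rw [h]
  refine (aestronglyMeasurable_conv hG hf).add (Finset.aestronglyMeasurable_fun_sum _ fun j _ =>
    aestronglyMeasurable_const.mul ?_)
  exact hG.comp_measurePreserving (measurePreserving_sub_right volume (Y j))

/-- `𝒢_z * f` at a point depends continuously on `f` in `L²_{-σ}`. -/
theorem tendsto_conv_green (hz : 0 < z.im) (hσ : σ ≤ 2) {w : ℕ → Plane → ℂ} {v : Plane → ℂ}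
    (hw : ∀ n, MemWeighted (-σ) (w n)) (hv : MemWeighted (-σ) v)
    (h : TendstoWeighted (-σ) w v) (x : Plane) :
    Tendsto (fun n => conv (green z) (w n) x) atTop (𝓝 (conv (green z) v x)) := by
  obtain ⟨C, hC, hb⟩ := (sqDecay_green hz).enorm_integral_le hσ x
  rw [tendsto_iff_edist_tendsto_0]
  have h1 : Tendsto (fun n => C * eLpNorm (weighted (-σ) (w n - v)) 2 volume) atTop (𝓝 0) := by
    simpa using ENNReal.Tendsto.const_mul h (Or.inr hC)
  refine tendsto_of_tendsto_of_tendsto_of_le_of_le tendsto_const_nhds h1 (fun _ => bot_le)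
    fun n => ?_
  have h2 : conv (green z) (w n) x - conv (green z) v x = ∫ y, green z (x - y) * (w n - v) y := by
    rw [← conv_sub_right (convAt_green hz hσ (hw n) x) (convAt_green hz hσ hv x),
      conv_eq_integral]
    rfl
  show edist (conv (green z) (w n) x) (conv (green z) v x) ≤ _
  rw [edist_eq_enorm_sub, h2]
  exact hb _ ((hw n).aestronglyMeasurable.sub hv.aestronglyMeasurable)

theorem tendsto_resolventFun (hz : 0 < z.im) (hσ : σ ≤ 2) (α : Fin N → ℝ) (Y : Fin N → Plane)
    {w : ℕ → Plane → ℂ} {v : Plane → ℂ} (hw : ∀ n, MemWeighted (-σ) (w n))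
    (hv : MemWeighted (-σ) v) (h : TendstoWeighted (-σ) w v) (x : Plane) :
    Tendsto (fun n => resolventFun α Y z (w n) x) atTop (𝓝 (resolventFun α Y z v x)) := by
  simp only [resolventFun_eq_conv, Matrix.mulVec, dotProduct]
  have hc := tendsto_conv_green hz hσ hw hv h
  exact (hc x).add (tendsto_finsetSum _ fun j _ =>
    (tendsto_finsetSum _ fun k _ => (hc (Y k)).const_mul _).mul_const _)

/-- Limits in `L²_{-σ}` of resolvents are given by the resolvent formula. -/
theorem ExtendedResolvent.ae_eq (hz : 0 < z.im) (hσ0 : 0 ≤ σ) (hσ : σ ≤ 2) {α : Fin N → ℝ}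
    {Y : Fin N → Plane} {w u : Plane → ℂ} (h : ExtendedResolvent α Y σ z w u) :
    u =ᵐ[volume] resolventFun α Y z w := by
  obtain ⟨hw, hu, wn, hwn, hwlim, hulim⟩ := h
  have hwn' : ∀ n, MemWeighted (-σ) (wn n) := fun n => memWeighted_of_memLp hσ0 (hwn n)
  have hm : TendstoInMeasure volume (fun n => weighted (-σ) (resolventFun α Y z (wn n))) atTop
      (weighted (-σ) u) := by
    refine tendstoInMeasure_of_tendsto_eLpNorm two_ne_zero (fun n => ?_) hu.1 ?_
    · exact AEStronglyMeasurable.weighted (aestronglyMeasurable_resolventFun hz α Y (hwn n).1)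
    · simpa only [TendstoWeighted, weighted_sub] using hulim
  -- a subsequence converges almost everywhere to `u`, and everywhere to the resolvent formula
  obtain ⟨ns, hns, hlim⟩ := hm.exists_seq_tendsto_ae
  filter_upwards [hlim] with x hx
  have h1 := (tendsto_resolventFun hz hσ α Y hwn' hw hwlim x).comp hns.tendsto_atTop
  have h2 := h1.const_mul ((((1 + ‖x‖ ^ 2) ^ (-σ / 2) : ℝ) : ℂ))
  have h3 := tendsto_nhds_unique hx h2
  exact mul_left_cancel₀ (by exact_mod_cast (one_add_norm_sq_rpow_pos x _).ne') h3

/-- On bounded functions the resolvent is dominated by the supremum times a fixed element of all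
the spaces `L²_{-σ}`, `σ > 1`. -/
theorem exists_norm_resolventFun_le (hz : 0 < z.im) (α : Fin N → ℝ) (Y : Fin N → Plane) :
    ∃ g : Plane → ℂ, (∀ σ, 1 < σ → MemWeighted (-σ) g) ∧ ∀ f : Plane → ℂ, ∀ C, 0 ≤ C →
      (∀ x, ‖f x‖ ≤ C) → ∀ x, ‖resolventFun α Y z f x‖ ≤ C * ‖g x‖ := by
  set G := green z
  set I : ℝ := ∫ t, ‖G t‖ with hI
  have hI0 : 0 ≤ I := integral_nonneg fun _ => norm_nonneg _
  have hconv : ∀ f : Plane → ℂ, ∀ C, 0 ≤ C → (∀ x, ‖f x‖ ≤ C) → ∀ x, ‖conv G f x‖ ≤ C * I := by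
    intro f C _ hf x
    rw [hI, ← integral_const_mul]
    refine norm_integral_le_of_norm_le ((integrable_green hz).norm.const_mul C)
      (Eventually.of_forall fun t => ?_)
    rw [norm_mul, mul_comm]
    gcongr
    exact hf _
  set Q := (gammaMatrix α Y z)⁻¹
  have hnn : ∀ x, 0 ≤ I + ∑ j, (∑ k, ‖Q j k‖ * I) * ‖G (x - Y j)‖ := fun x => by positivity
  refine ⟨fun x => I + ∑ j, (∑ k, ‖Q j k‖ * I : ℝ) * (‖G (x - Y j)‖ : ℂ), fun σ hσ => ?_,
    fun f C hC hf x => ?_⟩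
  · refine (memWeighted_const hσ _).add (MemWeighted.sum fun j _ => MemWeighted.const_mul ?_ _)
    refine (memWeighted_of_memLp (by linarith) ?_).norm
    exact (sqDecay_green hz).memLp.comp_measurePreserving (measurePreserving_sub_right volume (Y j))
  · have hc := hconv f C hC hf
    have e : ‖(I : ℂ) + ∑ j, ((∑ k, ‖Q j k‖ * I : ℝ) : ℂ) * (‖G (x - Y j)‖ : ℂ)‖ =
        I + ∑ j, (∑ k, ‖Q j k‖ * I) * ‖G (x - Y j)‖ := by
      rw [← Real.norm_of_nonneg (hnn x), ← Complex.norm_real]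
      push_cast; rfl
    simp only [e]
    rw [resolventFun_eq_conv, mul_add, Finset.mul_sum]
    refine (norm_add_le _ _).trans (add_le_add (hc x) ((norm_sum_le _ _).trans
      (Finset.sum_le_sum fun j _ => ?_)))
    rw [norm_mul, ← mul_assoc]
    refine mul_le_mul_of_nonneg_right ?_ (norm_nonneg _)
    rw [Matrix.mulVec, dotProduct, Finset.mul_sum]
    refine (norm_sum_le _ _).trans (Finset.sum_le_sum fun k _ => ?_)
    rw [norm_mul, mul_left_comm]
    exact mul_le_mul_of_nonneg_left (hc (Y k)) (norm_nonneg _)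

theorem resolventFun_sub (hz : 0 < z.im) (hσ : σ ≤ 2) (α : Fin N → ℝ) (Y : Fin N → Plane)
    {f g : Plane → ℂ} (hf : MemWeighted (-σ) f) (hg : MemWeighted (-σ) g) (x : Plane) :
    resolventFun α Y z (fun x => f x - g x) x =
      resolventFun α Y z f x - resolventFun α Y z g x := by
  have h := fun x => conv_sub_right (convAt_green hz hσ hf x) (convAt_green hz hσ hg x)
  simp only [resolventFun_eq_conv, h, Matrix.mulVec, dotProduct, mul_sub, sub_mul,
    Finset.sum_sub_distrib]
  ring

/-- The resolvent formula gives the extended resolvent at functions bounded near infinity: the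
truncations to large balls differ from such a function by uniformly bounded errors, to which
dominated convergence applies. -/
theorem extendedResolvent_resolventFun (hz : 0 < z.im) (hσ1 : 1 < σ) (hσ : σ ≤ 2)
    (α : Fin N → ℝ) (Y : Fin N → Plane) {w u : Plane → ℂ} (hw : MemWeighted (-σ) w)
    (hu : MemWeighted (-σ) u) {C ρ : ℝ} (hC : 0 ≤ C) (hb : ∀ x, ρ ≤ ‖x‖ → ‖w x‖ ≤ C)
    (huw : u =ᵐ[volume] resolventFun α Y z w) : ExtendedResolvent α Y σ z w u := by
  have hwm := hw.aestronglyMeasurable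
  set wn : ℕ → Plane → ℂ := fun n => (Metric.ball 0 (n + ρ)).indicator w with hwn
  have hmeas : ∀ n, AEStronglyMeasurable (wn n) := fun n => hwm.indicator measurableSet_ball
  have hle : ∀ n x, ‖wn n x‖ ≤ ‖w x‖ := fun n x => norm_indicator_le_norm_self _ _
  have hdiff : ∀ n x, ‖wn n x - w x‖ ≤ C := fun n x => by
    by_cases hx : x ∈ Metric.ball (0 : Plane) (n + ρ)
    · simpa [hwn, hx] using hC
    · simp only [hwn, indicator_of_notMem hx, zero_sub, norm_neg]
      rw [Metric.mem_ball, dist_zero_right, not_lt] at hx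
      exact hb x (by linarith [n.cast_nonneg (α := ℝ)])
  have hL2 : ∀ n, MemLp (wn n) 2 volume := fun n => by
    refine MemLp.of_le_mul (c := (1 + |n + ρ|) ^ 2) hw (hmeas n) (Eventually.of_forall fun x => ?_)
    by_cases hx : x ∈ Metric.ball (0 : Plane) (n + ρ)
    · have hx' := hx
      rw [Metric.mem_ball, dist_zero_right] at hx'
      simp only [hwn, indicator_of_mem hx]
      rw [eq_mul_weighted σ w x, norm_mul, Complex.norm_real, Real.norm_of_nonneg (by positivity)]
      refine mul_le_mul_of_nonneg_right ((one_add_norm_sq_rpow_le hσ x).trans ?_) (norm_nonneg _)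
      have := le_abs_self (n + ρ)
      gcongr
      linarith
    · simp only [hwn, indicator_of_notMem hx, norm_zero]
      positivity
  have hwlim : TendstoWeighted (-σ) wn w := by
    refine tendstoWeighted_of_dominated hmeas hwm (memWeighted_const hσ1 (C : ℂ))
      (fun n => Eventually.of_forall fun x => ?_) (Eventually.of_forall fun x => ?_)
    · rw [Complex.norm_real, Real.norm_of_nonneg hC]; exact hdiff n x
    · refine tendsto_const_nhds.congr' ?_
      filter_upwards [eventually_gt_atTop ⌈‖x‖ - ρ⌉₊] with n hn
      have h1 : ‖x‖ - ρ < n := (Nat.le_ceil _).trans_lt (by exact_mod_cast hn)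
      have hx : x ∈ Metric.ball (0 : Plane) (n + ρ) := by
        rw [Metric.mem_ball, dist_zero_right]; linarith
      simp [hwn, hx]
  have hwn' : ∀ n, MemWeighted (-σ) (wn n) := fun n =>
    memWeighted_of_memLp (by linarith) (hL2 n)
  obtain ⟨g, hg, hRb⟩ := exists_norm_resolventFun_le hz α Y
  refine ⟨hw, hu, wn, hL2, hwlim, ?_⟩
  refine tendstoWeighted_of_dominated
    (fun n => aestronglyMeasurable_resolventFun hz α Y (hmeas n)) hu.aestronglyMeasurable
    ((hg σ hσ1).const_mul C) (fun n => ?_) ?_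
  · filter_upwards [huw] with x hx
    rw [hx, ← resolventFun_sub hz hσ α Y (hwn' n) hw, norm_mul, Complex.norm_real,
      Real.norm_of_nonneg hC]
    exact hRb _ C hC (hdiff n) x
  · filter_upwards [huw] with x hx
    rw [hx]
    exact tendsto_resolventFun hz hσ α Y hwn' hw hwlim x

/-! ### Threshold resonances -/

theorem conv_green_neg_sq_mul_potential_apply (hz : 0 < z.im) (α : Fin N → ℝ) {Y : Fin N → Plane}
    (hY : Function.Injective Y) (c : ℂ) (a : Fin N → ℂ) (k : Fin N) :
    -z ^ 2 * conv (green z) (potential Y c a) (Y k) =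
      c - (dMatrix α Y).mulVec a k + (gammaMatrix α Y z).mulVec a k := by
  rw [← integral_green_mul_potential_apply hz α hY, conv_eq_integral]
  congr 2
  ext y
  rw [← green_neg, neg_sub]

/-- If `D̃ a = c`, then `φ = c + ∑ a_j E(x - y_j)` satisfies `φ = R(z²)(-z² φ)`. -/
theorem resolventFun_potential (hz : 0 < z.im) {α : Fin N → ℝ} {Y : Fin N → Plane}
    (hY : Function.Injective Y) (hdet : (gammaMatrix α Y z).det ≠ 0) {c : ℂ} {a : Fin N → ℂ}
    (ha : ∀ k, (dMatrix α Y).mulVec a k = c) {x : Plane} (hx : x ∉ range Y) :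
    resolventFun α Y z (fun x => -z ^ 2 * potential Y c a x) x = potential Y c a x := by
  have hb : (fun k => conv (green z) (fun x => -z ^ 2 * potential Y c a x) (Y k)) =
      (gammaMatrix α Y z).mulVec a := by
    ext k
    rw [conv_const_mul_right, conv_green_neg_sq_mul_potential_apply hz α hY, ha, sub_self, zero_add]
  rw [resolventFun_eq_conv, hb, Matrix.mulVec_mulVec,
    Matrix.nonsing_inv_mul _ (isUnit_iff_ne_zero.2 hdet), Matrix.one_mulVec, conv_const_mul_right,
    conv_eq_integral, integral_green_mul_potential_of_notMem hz Y c a hx]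
  ring

theorem ae_notMem_range (Y : Fin N → Plane) : ∀ᵐ x, x ∉ range Y :=
  (finite_range Y).countable.ae_notMem volume

/-- The functions `logFun α Y a` with `a ∈ coeffSpace α Y` are threshold resonances. -/
theorem logFun_mem_resonances (hN : 1 ≤ N) (hz : 0 < z.im) (hσ1 : 1 < σ) (hσ2 : σ < 2)
    {α : Fin N → ℝ} {Y : Fin N → Plane} (hY : Function.Injective Y)
    (hdet : (gammaMatrix α Y z).det ≠ 0) {a : Fin N → ℂ} (ha : a ∈ coeffSpace α Y) :
    (fun x : Punctured Y => logFun α Y a x) ∈ resonances α Y σ z := by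
  obtain ⟨hsum, hD⟩ := (mem_coeffSpace_iff hN α Y).1 ha
  rw [logFun_eq_potential]
  set c := constTerm α Y a
  have hu : MemWeighted (-σ) (potential Y c a) := memWeighted_potential hσ1 hσ2 Y c a
  have h0 : MemWeighted (-σ) (0 : Plane → ℂ) := memWeighted_const hσ1 0
  obtain ⟨C, ρ, hC, -, hb⟩ := exists_norm_le_of_isBigO_one (potential_sub_isBigO_one Y c a)
  have hw : (fun x => (0 : Plane → ℂ) x - z ^ 2 * potential Y c a x) =
      fun x => -z ^ 2 * potential Y c a x := by
    ext x; simp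
  refine ⟨isCb_potential Y c hsum, potential Y c a, ⟨hu, h0, ?_⟩, fun x => rfl⟩
  rw [hw]
  refine extendedResolvent_resolventFun hz hσ1 hσ2.le α Y (hu.const_mul _) hu
    (C := ‖-z ^ 2‖ * C) (ρ := ρ) (by positivity) (fun x hx => ?_) ?_
  · rw [norm_mul]
    refine mul_le_mul_of_nonneg_left ?_ (norm_nonneg _)
    simpa [hsum] using hb x hx
  · filter_upwards [ae_notMem_range Y] with x hx
    rw [resolventFun_potential hz hY hdet hD hx]

/-- A function in the kernel of the Hamiltonian is of the form `c + ∑ a_j E(x - y_j)`: after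
subtraction of its logarithmic singularities it solves `v = -z² 𝒢_z * v`. -/
theorem exists_ae_eq_potential (hz : 0 < z.im) (hσ1 : 1 < σ) (hσ2 : σ < 2)
    {α : Fin N → ℝ} {Y : Fin N → Plane} {u : Plane → ℂ} (hu : MemWeighted (-σ) u)
    (hR : u =ᵐ[volume] resolventFun α Y z fun x => -z ^ 2 * u x) {C ρ : ℝ} (hC : 0 ≤ C)
    (hb : ∀ x, ρ ≤ ‖x‖ → ‖u x‖ ≤ C) :
    ∃ c, u =ᵐ[volume] potential Y c ((gammaMatrix α Y z)⁻¹.mulVec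
      fun k => conv (green z) (fun x => -z ^ 2 * u x) (Y k)) := by
  set a := (gammaMatrix α Y z)⁻¹.mulVec fun k => conv (green z) (fun x => -z ^ 2 * u x) (Y k)
    with ha
  have hp : MemWeighted (-σ) (potential Y 0 a) := memWeighted_potential hσ1 hσ2 Y 0 a
  have hvz : (fun x => u x - potential Y 0 a x) =ᵐ[volume]
      fun x => -z ^ 2 * conv (green z) (fun x => u x - potential Y 0 a x) x := by
    filter_upwards [hR, ae_notMem_range Y] with x hx hxY
    rw [resolventFun_eq_conv, ← ha, conv_const_mul_right] at hx
    have h2 := integral_green_mul_potential_of_notMem hz Y 0 a hxY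
    rw [← conv_eq_integral] at h2
    rw [conv_sub_right (convAt_green hz hσ2.le hu x) (convAt_green hz hσ2.le hp x), mul_sub, h2]
    linear_combination hx
  obtain ⟨C', ρ', hC', hρ', hb'⟩ := exists_norm_potential_le Y 0 a
  obtain ⟨c, hc⟩ := exists_ae_eq_const hz ((hu.wInt hσ2.le).sub (hp.wInt hσ2.le)) hvz
    (C := C + C') (ρ := max ρ ρ') (by positivity)
    ((zero_le_one.trans hρ').trans (le_max_right _ _)) fun y hy => by
      have h1 : 1 ≤ Real.sqrt (1 + ‖y‖) := Real.one_le_sqrt.2 (by linarith [norm_nonneg y])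
      rw [add_mul]
      exact (norm_sub_le _ _).trans (add_le_add ((hb y ((le_max_left _ _).trans hy)).trans
        (le_mul_of_one_le_right hC h1)) (hb' y ((le_max_right _ _).trans hy)))
  refine ⟨c, ?_⟩
  filter_upwards [hc] with x hx
  rw [sub_eq_iff_eq_add] at hx
  rw [hx, potential, potential, zero_add]

/-- Every threshold resonance is `logFun α Y a` for some `a ∈ coeffSpace α Y`. -/
theorem exists_eq_logFun_of_mem_resonances (hN : 1 ≤ N) (hz : 0 < z.im) (hσ1 : 1 < σ) (hσ2 : σ < 2)
    {α : Fin N → ℝ} {Y : Fin N → Plane} (hY : Function.Injective Y)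
    (hdet : (gammaMatrix α Y z).det ≠ 0) {φ : Punctured Y → ℂ} (hφ : φ ∈ resonances α Y σ z) :
    ∃ a ∈ coeffSpace α Y, φ = fun x : Punctured Y => logFun α Y a x := by
  obtain ⟨hcb, u, ⟨hu, -, hext⟩, hφu⟩ := hφ
  have hR := hext.ae_eq hz (by linarith) hσ2.le
  have hw : (fun x => (0 : Plane → ℂ) x - z ^ 2 * u x) = fun x => -z ^ 2 * u x := by
    ext x; simp
  rw [hw] at hR
  obtain ⟨C, ρ, hC, hρ, hb⟩ := hcb.exists_norm_le
  have hub : ∀ x, ρ ≤ ‖x‖ → ‖u x‖ ≤ C := fun x hx => by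
    obtain ⟨hxY, h⟩ := hb x hx
    rwa [← hφu ⟨x, hxY⟩] at h
  obtain ⟨c, hc⟩ := exists_ae_eq_potential hz hσ1 hσ2 hu hR hC hub
  set b : Fin N → ℂ := fun k => conv (green z) (fun x => -z ^ 2 * u x) (Y k) with hbdef
  set a := (gammaMatrix α Y z)⁻¹.mulVec b with ha
  have hopen : IsOpen (range Y)ᶜ := (finite_range Y).isClosed.isOpen_compl
  -- both functions are continuous off `Y`, so they agree there and not only almost everywhere
  have heq : EqOn u (potential Y c a) (range Y)ᶜ := by
    refine Measure.eqOn_open_of_ae_eq (ae_restrict_of_ae hc) hopen ?_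
      fun x hx => (continuousAt_potential Y c a hx).continuousWithinAt
    rw [continuousOn_iff_continuous_domRestrict]
    exact hcb.1.congr fun x => (hφu x).symm
  have hbdd : potential Y c a =O[Bornology.cobounded Plane] fun _ : Plane => (1 : ℝ) := by
    refine Asymptotics.IsBigO.of_bound C ?_
    filter_upwards [(tendsto_norm_cobounded_atTop (E := Plane)).eventually_ge_atTop ρ] with x hx
    rw [norm_one, mul_one, ← heq (hb x hx).1]
    exact hub x hx
  -- `b` equals `Γ a` by the choice of `a` and `c - D̃ a + Γ a` by the form of `u`
  have hD : ∀ k, (dMatrix α Y).mulVec a k = c := fun k => by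
    have h1 : b k = c - (dMatrix α Y).mulVec a k + (gammaMatrix α Y z).mulVec a k := by
      rw [← conv_green_neg_sq_mul_potential_apply hz α hY, ← conv_congr_right hc]
      exact conv_const_mul_right _ _ _ _
    have h2 : (gammaMatrix α Y z).mulVec a = b := by
      rw [ha, Matrix.mulVec_mulVec, Matrix.mul_nonsing_inv _ (isUnit_iff_ne_zero.2 hdet),
        Matrix.one_mulVec]
    rw [h2] at h1
    linear_combination h1
  have hconst := constTerm_eq_of_forall hN α Y hD
  refine ⟨a, (mem_coeffSpace_iff hN α Y).2 ⟨sum_eq_zero_of_isBigO Y hbdd, fun k => ?_⟩, ?_⟩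
  · rw [hD, hconst]
  · ext x
    rw [logFun_eq_potential, hconst, ← hφu x]
    exact heq x.2

end PointInteraction

theorem theorem1p4 (N : ℕ) (hN : 1 ≤ N) (α : Fin N → ℝ)
    (Y : Fin N → PointInteraction.Plane) (hY : Function.Injective Y)
    (σ : ℝ) (hσ1 : 1 < σ) (hσ2 : σ < 2)
    (z : ℂ) (hz : 0 < z.im) (hdet : (PointInteraction.gammaMatrix α Y z).det ≠ 0) :
    PointInteraction.resonances α Y σ z =
        {φ | ∃ a ∈ PointInteraction.coeffSpace α Y,
          φ = fun x : PointInteraction.Punctured Y => PointInteraction.logFun α Y a x} ∧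
    (∀ a ∈ PointInteraction.coeffSpace α Y,
      (fun x : PointInteraction.Plane =>
        PointInteraction.logFun α Y a x -
          (PointInteraction.constTerm α Y a +
            1 / (2 * (Real.pi : ℂ)) *
              ∑ j, a j * ((inner ℝ (‖x‖⁻¹ • x) (Y j) : ℝ) : ℂ) / (‖x‖ : ℂ)))
        =O[Bornology.cobounded PointInteraction.Plane]
          fun x : PointInteraction.Plane => (‖x‖ ^ 2)⁻¹) ∧
    (PointInteraction.resonances α Y σ z = {0} ↔ PointInteraction.NonsingularOnS α Y) := by
  open PointInteraction in
  have hres : resonances α Y σ z =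
      {φ | ∃ a ∈ coeffSpace α Y, φ = fun x : Punctured Y => logFun α Y a x} := by
    ext φ
    refine ⟨exists_eq_logFun_of_mem_resonances hN hz hσ1 hσ2 hY hdet, ?_⟩
    rintro ⟨a, ha, rfl⟩
    exact logFun_mem_resonances hN hz hσ1 hσ2 hY hdet ha
  refine ⟨hres, fun a ha =>
    PointInteraction.logFun_isBigO α Y ((PointInteraction.mem_coeffSpace_iff hN α Y).1 ha).1, ?_⟩
  have h0 : PointInteraction.logFun α Y 0 = 0 := by
    ext x; simp [PointInteraction.logFun, PointInteraction.constTerm]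
  rw [hres, PointInteraction.nonsingularOnS_iff]
  constructor
  · intro h a ha
    have h1 : (fun x : PointInteraction.Punctured Y => PointInteraction.logFun α Y a x) = 0 :=
      Set.mem_singleton_iff.1 (h ▸ ⟨a, ha, rfl⟩)
    refine PointInteraction.eq_zero_of_potential_eq_zero hY
      (c := PointInteraction.constTerm α Y a) fun x hx => ?_
    rw [← PointInteraction.logFun_eq_potential]
    exact congrFun h1 ⟨x, hx⟩
  · intro h
    ext φ
    rw [Set.mem_singleton_iff]
    constructor
    · rintro ⟨a, ha, rfl⟩
      rw [h a ha, h0]; rfl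
    · rintro rfl
      exact ⟨0, Submodule.zero_mem _, by rw [h0]; rfl⟩
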